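/- Let $F$ be a non-archimedean local field of characteristic $0$ with ring of integers $\mathfrak o$, maximal ideal $\mathfrak p$, prime element $\pi$, residue field of odd cardinality $q$, and absolute value normalized by $|\pi|=q^{-1}$. Fix $\delta\in\mathfrak o^\times\setminus(\mathfrak o^\times)^2$, an additive character $\psi:F\to\mathbb C^1$ of order $0$ (trivial on $\mathfrak o$, non-trivial on $\pi^{-1}\mathfrak o$), a character $\omega$ of $F^\times$ with $\omega^2=1$, an integer $n\ge 0$, and a symmetric matrix $B\in M_n(F)$ with $\det B\ne0$. Haar measures $dX$ on $\mathrm{Sym}_n(F)$ and $d\gamma$ on $M_n(F)$ are normalized by $\int_{\mathrm{Sym}_n(\mathfrak o)}dX=\int_{M_n(\mathfrak o)}d\gamma=1$. *The Siegel series.* Let $w_i=\begin{pmatrix}1_{n-i}&&&\\&0_i&&-1_i\\&&1_{n-i}&\\&1_i&&0_i\end{pmatrix}\in \mathrm{Sp}_n(F)$ for $0\le i\le n$, let $\Gamma=\{\begin{pmatrix}A&B'\\C&D\end{pmatrix}\in\mathrm{Sp}_n(\mathfrak o): C\equiv0\bmod\mathfrak p\}$, and for $s\in\mathbb C$ let $f_{0,s}$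 be the locally constant function on $\mathrm{Sp}_n(F)$ with $$f_{0,s}\!\left(\begin{pmatrix}A&*\\0&{}^t\!A^{-1}\end{pmatrix}g\right)=\omega(\det A)|\det A|^{s}f_{0,s}(g),\qquad f_{0,s}(gk)=\omega(\det D)f_{0,s}(g)\quad\Bigl(k=\begin{pmatrix}A&B'\\C&D\end{pmatrix}\in\Gamma\Bigr),$$ $f_{0,s}(w_0)=1$ and $f_{0,s}(w_i)=0$ for $1\le i\le n$. The series $$S_0(B,s)^\omega=\int_{\mathrm{Sym}_n(F)}f_{0,s}\!\left(w_n\begin{pmatrix}1&X\\0&1\end{pmatrix}\right)\psi(-\mathrm{tr}(BX))\,dX$$ is defined by this integral where it converges absolutely, and by meromorphic continuation to $s\in\mathbb C$ otherwise. *The orbit data.* Let $\Gamma_0=\{\gamma\in\mathrm{GL}_n(\mathfrak o):\gamma_{ij}\in\mathfrak p\ (i>j)\}$. Let $\Lambda_n$ be the set of $(\sigma,h,\varepsilon)\in\mathfrak S_n\times\mathbb Z^n\times\{1,\delta\}^n$ with $\sigma^2=1$, $h_{\sigma(i)}=h_i$ for all $i$, and $\varepsilon_i=1$ whenever $\sigma(i)\ne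 i$; let $S_{\sigma,h,\varepsilon}$ be the symmetric matrix with $(i,j)$ entry $\varepsilon_i\pi^{h_i}$ if $i=\sigma(j)$ and $0$ otherwise. For non-degenerate symmetric $Y,T\in M_n(F)$ put $$\mathscr G_{\Gamma_0}(Y,T)=\int_{\Gamma_0}\psi(-\mathrm{tr}(Y\,{}^t\gamma T\gamma))\,d\gamma,\qquad \alpha(\Gamma_0;Y)=\lim_{l\to\infty}q^{-ln(n-1)/2}N_l(\Gamma_0;Y),$$ where, with $m\ge0$ the least integer such that $\pi^mY$ is integral, $$N_l(\Gamma_0;Y)=q^{-mn^2}\,\#\{\gamma\in\Gamma_0\bmod\mathfrak p^{l+m}:\gamma Y\,{}^t\gamma\equiv Y\bmod\mathfrak p^l\}$$ (for integral $Y$ simply the number of solutions in $\Gamma_0\bmod\mathfrak p^l$). **Theorem.** The functions $f_{0,s}$ exist, the integral defining $S_0(B,s)^\omega$ converges absolutely on some right half-plane and has a meromorphic continuation to $\mathbb C$, the limits $\alpha(\Gamma_0;S_{\sigma,h,\varepsilon})$ exist and are positive for all $(\sigma,h,\varepsilon)\in\Lambda_n$ with all $h_i\le-1$, and $\mathscr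 G_{\Gamma_0}(S_{\sigma,h,\varepsilon},B)\neq0$ for only finitely many of these. For every $s\in\mathbb C$, $$S_0(B,s)^\omega=\sum_{\substack{(\sigma,h,\varepsilon)\in\Lambda_n\\ h_i\le-1\ (1\le i\le n)}}\omega(\det S_{\sigma,h,\varepsilon})\,|\det S_{\sigma,h,\varepsilon}|^{-s}\;\frac{\mathscr G_{\Gamma_0}(S_{\sigma,h,\varepsilon},B)}{\alpha(\Gamma_0;S_{\sigma,h,\varepsilon})},$$ where the left side is the integral itself whenever that converges absolutely. -/

import Mathlib

open MeasureTheory Filter Topology Matrix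
open scoped NormedField Valued

/-!
Throughout, a non-archimedean local field is a nontrivially normed field `F` whose distance is
ultrametric and whose topology is locally compact.  Its ring of integers is `𝒪[F] = {‖x‖ ≤ 1}`, its
maximal ideal is `{‖x‖ < 1}`, and the statement asks that the norm be normalized, i.e. that a prime
element have norm `q⁻¹`, where `q` is the number of elements of the residue field.
-/

namespace RamifiedSiegel

noncomputable section

/-- The cardinality `q` of the residue field of `F`. -/
def resCard (F : Type*) [NontriviallyNormedField F] [IsUltrametricDist F] : ℕ :=
  Nat.card 𝓀[F]

/-- The additive character `ψ` has order `0`: it is trivial on the ring of integers, but not on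
the inverse of the maximal ideal. -/
def HasOrderZero {F : Type*} [NontriviallyNormedField F] [IsUltrametricDist F]
    (ϖ : 𝒪[F]) (ψ : AddChar F Circle) : Prop :=
  (∀ x : 𝒪[F], ψ (x : F) = 1) ∧ ∃ x : 𝒪[F], ψ ((ϖ : F)⁻¹ * (x : F)) ≠ 1

/-! ### Symplectic group and the induced representation -/

/-- `Sp_n(F)`, with `2n × 2n` matrices written in `n × n` blocks. -/
abbrev Sp (n : ℕ) (F : Type*) [Field F] := Matrix.symplecticGroup (Fin n) F

/-- The blocks of `g = (A, B; C, D)`. -/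
def blockA {n : ℕ} {F : Type*} [Field F] (g : Sp n F) : Matrix (Fin n) (Fin n) F :=
  (g : Matrix (Fin n ⊕ Fin n) (Fin n ⊕ Fin n) F).toBlocks₁₁

def blockC {n : ℕ} {F : Type*} [Field F] (g : Sp n F) : Matrix (Fin n) (Fin n) F :=
  (g : Matrix (Fin n ⊕ Fin n) (Fin n ⊕ Fin n) F).toBlocks₂₁

def blockD {n : ℕ} {F : Type*} [Field F] (g : Sp n F) : Matrix (Fin n) (Fin n) F :=
  (g : Matrix (Fin n ⊕ Fin n) (Fin n ⊕ Fin n) F).toBlocks₂₂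

/-- The Siegel parabolic subgroup `P = {C = 0}`. -/
def siegelParabolic (n : ℕ) (F : Type*) [Field F] : Set (Sp n F) :=
  {g | blockC g = 0}

/-- The subgroup `Γ = {C ≡ 0 mod 𝔭}` of `Sp_n(𝔬)`. -/
def siegelGamma (n : ℕ) (F : Type*) [NontriviallyNormedField F] : Set (Sp n F) :=
  {g | (∀ i j, ‖(g : Matrix (Fin n ⊕ Fin n) (Fin n ⊕ Fin n) F) i j‖ ≤ 1) ∧
    ∀ i j, ‖blockC g i j‖ < 1}

/-- The diagonal idempotent matrix selecting the indices `j < n - i` (0-based). -/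
def lowIdem (n i : ℕ) (F : Type*) [Field F] : Matrix (Fin n) (Fin n) F :=
  Matrix.diagonal fun j => if (j : ℕ) + i < n then 1 else 0

/-- The diagonal idempotent matrix selecting the last `i` indices. -/
def highIdem (n i : ℕ) (F : Type*) [Field F] : Matrix (Fin n) (Fin n) F :=
  Matrix.diagonal fun j => if (j : ℕ) + i < n then 0 else 1

/-- The representatives `w_i` (`0 ≤ i ≤ n`) of `P \ Sp_n(F) / Γ`. In particular `w_0 = 1` and
`w_n = (0, -1; 1, 0)`. -/
def weyl (n i : ℕ) (F : Type*) [Field F] : Sp n F :=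
  ⟨Matrix.fromBlocks (lowIdem n i F) (-highIdem n i F) (highIdem n i F) (lowIdem n i F), by
    rw [SymplecticGroup.fromBlocks_mem_iff]
    refine ⟨?_, ?_, ?_⟩
    · simp only [lowIdem, highIdem, Matrix.diagonal_transpose, Matrix.diagonal_mul_diagonal]
      congr 1; funext j; split_ifs <;> simp
    · simp only [lowIdem, highIdem, Matrix.diagonal_transpose, Matrix.transpose_neg,
        Matrix.neg_mul, Matrix.mul_neg, Matrix.diagonal_mul_diagonal]
      congr 2; funext j; split_ifs <;> simp
    · simp only [lowIdem, highIdem, Matrix.diagonal_transpose, Matrix.mul_neg, sub_neg_eq_add,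
        Matrix.diagonal_mul_diagonal, Matrix.diagonal_add]
      rw [← Matrix.diagonal_one]
      congr 1; funext j; split_ifs <;> simp⟩

/-- Membership of `f` in `I_n(ω, s)^{Γ, ω}`: `f` is a smooth (locally constant) function on
`Sp_n(F)`, `f(pg) = ω(det A) |det A|^{s + (n+1)/2} f(g)` for `p = (A, *; 0, ᵗA⁻¹) ∈ P`, and
`f(gk) = ω(det D) f(g)` for `k = (A, B; C, D) ∈ Γ`. -/
structure IsInduced {n : ℕ} {F : Type*} [NontriviallyNormedField F]
    (ω : MulChar F ℂ) (s : ℂ) (f : Sp n F → ℂ) : Prop where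
  smooth : IsLocallyConstant f
  left : ∀ p ∈ siegelParabolic n F, ∀ g : Sp n F,
    f (p * g) = ω (blockA p).det * ((‖(blockA p).det‖ : ℝ) : ℂ) ^ (s + ((n : ℂ) + 1) / 2) * f g
  right : ∀ k ∈ siegelGamma n F, ∀ g : Sp n F, f (g * k) = ω (blockD k).det * f g

/-- `f` is the function `f_t` of `I_n(ω, s - (n+1)/2)^{Γ, ω}` with `f_t(w_i) = δ_{t,i}` for
`0 ≤ i ≤ n`. -/
def IsStandardSection {n : ℕ} {F : Type*} [NontriviallyNormedField F]
    (ω : MulChar F ℂ) (s : ℂ) (t : ℕ) (f : Sp n F → ℂ) : Prop :=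
  IsInduced ω (s - ((n : ℂ) + 1) / 2) f ∧ ∀ i ≤ n, f (weyl n i F) = if t = i then 1 else 0

/-! ### Haar measures -/

/-- The Haar measure on `F` giving the ring of integers volume `1`. -/
def fieldHaar (F : Type*) [NontriviallyNormedField F] [LocallyCompactSpace F]
    [MeasurableSpace F] [BorelSpace F] : Measure F :=
  haveI : ProperSpace F := ProperSpace.of_locallyCompactSpace F
  Measure.addHaarMeasure
    { carrier := Metric.closedBall (0 : F) 1
      isCompact' := isCompact_closedBall 0 1
      interior_nonempty' := ⟨0, mem_interior_iff_mem_nhds.mpr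
        (Metric.closedBall_mem_nhds 0 one_pos)⟩ }

instance matrixMeasurableSpace {n : ℕ} {F : Type*} [MeasurableSpace F] :
    MeasurableSpace (Matrix (Fin n) (Fin n) F) :=
  inferInstanceAs (MeasurableSpace (Fin n → Fin n → F))

/-- The Haar measure on `M_n(F)` giving `M_n(𝔬)` volume `1`: the product measure of the entries. -/
def matrixHaar (n : ℕ) (F : Type*) [NontriviallyNormedField F] [LocallyCompactSpace F]
    [MeasurableSpace F] [BorelSpace F] : Measure (Matrix (Fin n) (Fin n) F) :=
  (Measure.pi fun _ : Fin n => Measure.pi fun _ : Fin n => fieldHaar F :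
    Measure (Fin n → Fin n → F))

/-- `Sym_n(F)`, as a subtype of the square matrices. -/
abbrev SymMat (n : ℕ) (F : Type*) := {X : Matrix (Fin n) (Fin n) F // X.IsSymm}

/-- The symmetric matrix with prescribed entries on and above the diagonal. -/
def symOfUpper {n : ℕ} {F : Type*} (x : {p : Fin n × Fin n // p.1 ≤ p.2} → F) : SymMat n F :=
  ⟨Matrix.of fun i j => x ⟨(min i j, max i j), min_le_max⟩, by
    refine Matrix.IsSymm.ext fun i j => ?_
    simp only [Matrix.of_apply, min_comm, max_comm]⟩

/-- The Haar measure on `Sym_n(F)` giving `Sym_n(𝔬)` volume `1`: the product measure of the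
entries on and above the diagonal. -/
def symHaar (n : ℕ) (F : Type*) [NontriviallyNormedField F] [LocallyCompactSpace F]
    [MeasurableSpace F] [BorelSpace F] : Measure (SymMat n F) :=
  (Measure.pi fun _ : {p : Fin n × Fin n // p.1 ≤ p.2} => fieldHaar F).map symOfUpper

/-! ### The Siegel series -/

/-- The element `(1, X; 0, 1)` of `Sp_n(F)`. -/
def unipotent {n : ℕ} {F : Type*} [Field F] (X : SymMat n F) : Sp n F :=
  ⟨Matrix.fromBlocks 1 X.1 0 1, by
    rw [SymplecticGroup.fromBlocks_mem_iff]
    have h : X.1ᵀ = X.1 := X.2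
    simp [h]⟩

/-- The integrand `φ(w_n (1, X; 0, 1)) ψ(-tr(BX))` of the Siegel series. -/
def siegelIntegrand {n : ℕ} {F : Type*} [Field F] (ψ : AddChar F Circle)
    (B : Matrix (Fin n) (Fin n) F) (φ : Sp n F → ℂ) (X : SymMat n F) : ℂ :=
  φ (weyl n n F * unipotent X) * (ψ (-(B * X.1).trace) : ℂ)

/-- `Z` is the Siegel series attached to the family `φ_s`, as a meromorphic function of `s ∈ ℂ`:
on some right half-plane the integral converges absolutely and equals `Z`, and `Z` is meromorphic
on `ℂ` (in normal form, so that its values are determined everywhere). -/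
def IsSiegelSeries {n : ℕ} {F : Type*} [NontriviallyNormedField F] [LocallyCompactSpace F]
    [MeasurableSpace F] [BorelSpace F] (ψ : AddChar F Circle)
    (B : Matrix (Fin n) (Fin n) F) (φ : ℂ → Sp n F → ℂ) (Z : ℂ → ℂ) : Prop :=
  MeromorphicNFOn Z Set.univ ∧
    ∃ a : ℝ, ∀ s : ℂ, a < s.re →
      Integrable (siegelIntegrand ψ B (φ s)) (symHaar n F) ∧
        Z s = ∫ X, siegelIntegrand ψ B (φ s) X ∂(symHaar n F)

/-! ### The group `Γ₀`, orbit representatives, character sums and local densities -/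

/-- `Γ₀ = {γ ∈ GL_n(𝔬) : γ_{ij} ∈ 𝔭 for i > j}`, as a set of matrices over `F`. -/
def Gamma0 (n : ℕ) (F : Type*) [NontriviallyNormedField F] : Set (Matrix (Fin n) (Fin n) F) :=
  {γ | (∀ i j, ‖γ i j‖ ≤ 1) ∧ ‖γ.det‖ = 1 ∧ ∀ i j, j < i → ‖γ i j‖ < 1}

/-- The set `Λ_n` of all triples `(σ, h, ε)` in `𝔖_n × ℤⁿ × {1, δ}ⁿ` with `σ² = 1`,
`h_{σ(i)} = h_i`, and `ε_i = 1` if `σ(i) ≠ i`. -/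
def Lam (n : ℕ) {F : Type*} [Field F] (δ : F) :
    Set (Equiv.Perm (Fin n) × (Fin n → ℤ) × (Fin n → F)) :=
  {x | x.1 ^ 2 = 1 ∧ (∀ i, x.2.1 (x.1 i) = x.2.1 i) ∧ (∀ i, x.2.2 i = 1 ∨ x.2.2 i = δ) ∧
    ∀ i, x.1 i ≠ i → x.2.2 i = 1}

/-- The set of all `(σ, h, ε) ∈ Λ_n` with `h_i ≤ -1` for all `i`. -/
def LamNeg (n : ℕ) {F : Type*} [Field F] (δ : F) :
    Set (Equiv.Perm (Fin n) × (Fin n → ℤ) × (Fin n → F)) :=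
  {x | x ∈ Lam n δ ∧ ∀ i, x.2.1 i ≤ -1}

/-- The matrix `S_{σ,h,ε}`, with `(i, j)` entry `ε_i ϖ^{h_i}` if `i = σ(j)` and `0` otherwise. -/
def repS {n : ℕ} {F : Type*} [Field F] (ϖ : F)
    (x : Equiv.Perm (Fin n) × (Fin n → ℤ) × (Fin n → F)) : Matrix (Fin n) (Fin n) F :=
  Matrix.of fun i j => if i = x.1 j then x.2.2 i * ϖ ^ x.2.1 i else 0

/-- The character sum `𝒢_{Γ₀}(Y, T) = ∫_{Γ₀} ψ(-tr(Y ᵗγ T γ)) dγ`. -/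
def charSum {n : ℕ} {F : Type*} [NontriviallyNormedField F] [LocallyCompactSpace F]
    [MeasurableSpace F] [BorelSpace F] (ψ : AddChar F Circle)
    (Y T : Matrix (Fin n) (Fin n) F) : ℂ :=
  ∫ γ in Gamma0 n F, (ψ (-(Y * (γᵀ * T * γ)).trace) : ℂ) ∂(matrixHaar n F)

/-- The additive subgroup `𝔭^k M_n(𝔬)` of `M_n(F)`. -/
def congrLattice (n : ℕ) {F : Type*} [NontriviallyNormedField F] [IsUltrametricDist F]
    (ϖ : F) (k : ℕ) : AddSubgroup (Matrix (Fin n) (Fin n) F) where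
  carrier := {X | ∀ i j, ‖X i j‖ ≤ ‖ϖ‖ ^ k}
  zero_mem' := fun i j => by simp
  add_mem' := fun {X Y} hX hY i j =>
    (IsUltrametricDist.norm_add_le_max (X i j) (Y i j)).trans (max_le (hX i j) (hY i j))
  neg_mem' := fun {X} hX i j => by simpa using hX i j

/-- The least `m ≥ 0` such that `ϖ^m Y` has integral entries; it is `0` if `Y` is integral. -/
def denExp {n : ℕ} {F : Type*} [NontriviallyNormedField F] (ϖ : F)
    (Y : Matrix (Fin n) (Fin n) F) : ℕ :=
  sInf {m : ℕ | ∀ i j, ‖ϖ ^ m * Y i j‖ ≤ 1}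

/-- The number `N_l(Γ₀; Y)` of `γ ∈ Γ₀ mod 𝔭^l` with `γ Y ᵗγ ≡ Y mod 𝔭^l`.

If `Y` is integral then `m = denExp ϖ Y = 0` and this is literally the number of such residue
classes.  If `Y` has denominator `ϖ^m`, the congruence `γ Y ᵗγ ≡ Y mod 𝔭^l` depends on `γ` modulo
`𝔭^(l+m)` only, and each class modulo `𝔭^l` consists of `q^(m n²)` classes modulo `𝔭^(l+m)`; the
solutions are therefore counted modulo `𝔭^(l+m)`, each with weight `q^(-m n²)`. -/
def solCount {n : ℕ} {F : Type*} [NontriviallyNormedField F] [IsUltrametricDist F]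
    (ϖ : F) (Y : Matrix (Fin n) (Fin n) F) (l : ℕ) : ℝ :=
  ((((QuotientAddGroup.mk : Matrix (Fin n) (Fin n) F →
      Matrix (Fin n) (Fin n) F ⧸ congrLattice n ϖ (l + denExp ϖ Y)) ''
    {γ | γ ∈ Gamma0 n F ∧ γ * Y * γᵀ - Y ∈ congrLattice n ϖ l}).ncard : ℕ) : ℝ) /
    (resCard F : ℝ) ^ (denExp ϖ Y * n ^ 2)

/-- The sequence `q^{-l n(n-1)/2} N_l(Γ₀; Y)`; the exponent is `l` times `n choose 2`. -/
def densitySeq {n : ℕ} {F : Type*} [NontriviallyNormedField F] [IsUltrametricDist F]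
    (ϖ : F) (Y : Matrix (Fin n) (Fin n) F) (l : ℕ) : ℝ :=
  solCount ϖ Y l / (resCard F : ℝ) ^ (l * n.choose 2)

/-- The local density `α(Γ₀; Y) = lim_{l → ∞} q^{-l n(n-1)/2} N_l(Γ₀; Y)`. -/
def localDensity {n : ℕ} {F : Type*} [NontriviallyNormedField F] [IsUltrametricDist F]
    (ϖ : F) (Y : Matrix (Fin n) (Fin n) F) : ℝ :=
  limUnder atTop (densitySeq ϖ Y)

/-- The finite sum `∑ c_{σ,h,ε,ω}(s) 𝒢_{Γ₀}(S_{σ,h,ε}, B) / α(Γ₀; S_{σ,h,ε})` over all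
`(σ, h, ε) ∈ Λ_n` with all `h_i ≤ -1`, where `c_{σ,h,ε,ω}(s) = ω(det S) |det S|^{-s}`. -/
def orbitSum {n : ℕ} {F : Type*} [NontriviallyNormedField F] [IsUltrametricDist F]
    [LocallyCompactSpace F] [MeasurableSpace F] [BorelSpace F] (ϖ δ : F) (ψ : AddChar F Circle)
    (ω : MulChar F ℂ) (B : Matrix (Fin n) (Fin n) F) (s : ℂ) : ℂ :=
  ∑ᶠ x ∈ LamNeg n δ,
    ω (repS ϖ x).det * ((‖(repS ϖ x).det‖ : ℝ) : ℂ) ^ (-s) *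
      (charSum ψ (repS ϖ x) B / (localDensity ϖ (repS ϖ x) : ℂ))

end

end RamifiedSiegel

/-!
The symmetric matrices `X` of non-zero determinant form countably many open orbits under
`X ↦ γ X γᵀ` with `γ` in the Iwahori group `Γ₀`, and the matrices `S_{σ,h,ε}` represent them: since
`2` is a unit, an entry of maximal norm, chosen suitably among ties, can be made part of a `1 × 1`
or `2 × 2` monomial block and the rest of its rows and columns cleared. On the orbit of
`S = S_{σ,h,ε}` the value of `f₀` at `w_n (1, X; 0, 1)` is `ω(det S) |det S|⁻ˢ` when all `h_i ≤ -1`,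
and `0` otherwise because the point then lies in the cell of some `w_i` with `i ≥ 1`. The orbit map
carries the Haar measure of `Γ₀` to `α(Γ₀; S)` times that of `Sym_n(F)`, so integrating orbit by
orbit gives the formula. For deep `h` the phase `tr(S γᵀ B γ)` oscillates under small translations
of `γ`, so only finitely many character sums survive; a finite sum of exponentials in `s` is entire
and provides the continuation.
-/

namespace RamifiedSiegel

section Ultrametric

variable {E : Type*} [SeminormedAddCommGroup E] [IsUltrametricDist E] {x y : E} {c : ℝ}

theorem norm_add_lt_of_lt (hx : ‖x‖ < c) (hy : ‖y‖ < c) : ‖x + y‖ < c :=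
  (IsUltrametricDist.norm_add_le_max x y).trans_lt (max_lt hx hy)

theorem norm_add_le_of_le_of_le (hx : ‖x‖ ≤ c) (hy : ‖y‖ ≤ c) : ‖x + y‖ ≤ c :=
  (IsUltrametricDist.norm_add_le_max x y).trans (max_le hx hy)

theorem norm_sub_lt_of_lt (hx : ‖x‖ < c) (hy : ‖y‖ < c) : ‖x - y‖ < c := by
  rw [sub_eq_add_neg]; exact norm_add_lt_of_lt hx (by rwa [norm_neg])

theorem norm_sub_le_of_le_of_le (hx : ‖x‖ ≤ c) (hy : ‖y‖ ≤ c) : ‖x - y‖ ≤ c := by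
  rw [sub_eq_add_neg]; exact norm_add_le_of_le_of_le hx (by rwa [norm_neg])

theorem norm_eq_of_norm_sub_lt (h : ‖x - y‖ < ‖y‖) : ‖x‖ = ‖y‖ := by
  simpa [max_eq_right h.le] using IsUltrametricDist.norm_add_eq_max_of_norm_ne_norm h.ne

theorem norm_sum_lt_of_forall_lt {ι : Type*} {s : Finset ι} {f : ι → E} (hc : 0 < c)
    (h : ∀ i ∈ s, ‖f i‖ < c) : ‖∑ i ∈ s, f i‖ < c := by
  rcases s.eq_empty_or_nonempty with rfl | hs
  · simpa using hc
  · obtain ⟨i, hi, hle⟩ := IsUltrametricDist.exists_norm_finsetSum_le_of_nonempty hs f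
    exact hle.trans_lt (h i hi)

end Ultrametric

/-! ### The field -/

section Field

variable {F : Type*} [NontriviallyNormedField F]

/-- `ϖ` is a prime element of the field `F`, expressed by the norm: `‖ϖ‖ < 1`, and every nonzero
norm is a power of `‖ϖ‖`. -/
structure IsUniformizer (ϖ : F) : Prop where
  ne_zero : ϖ ≠ 0
  norm_lt_one : ‖ϖ‖ < 1
  exists_norm_eq_zpow : ∀ x : F, x ≠ 0 → ∃ k : ℤ, ‖x‖ = ‖ϖ‖ ^ k

/-- `1` and the unit `δ` represent the two classes of units modulo squares, expressed by the
norm: every unit is congruent to `1` or `δ` up to squares, and `δ` is not a square modulo the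
maximal ideal. -/
structure IsNonsquareUnit (δ : F) : Prop where
  norm_eq_one : ‖δ‖ = 1
  one_le_norm_sq_sub : ∀ v : F, ‖v‖ = 1 → 1 ≤ ‖v ^ 2 - δ‖
  exists_sq_mul_eq : ∀ u : F, ‖u‖ = 1 → ∃ v : F, ‖v‖ = 1 ∧ (v ^ 2 * u = 1 ∨ v ^ 2 * u = δ)

namespace IsUniformizer

variable {ϖ : F}

theorem norm_pos (hϖ : IsUniformizer ϖ) : 0 < ‖ϖ‖ := norm_pos_iff.mpr hϖ.ne_zero

theorem norm_le_zpow_iff_lt (hϖ : IsUniformizer ϖ) {x : F} {k : ℤ} :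
    ‖x‖ ≤ ‖ϖ‖ ^ (k + 1) ↔ ‖x‖ < ‖ϖ‖ ^ k := by
  rcases eq_or_ne x 0 with rfl | hx
  · simp [zpow_pos hϖ.norm_pos, zpow_nonneg (norm_nonneg ϖ)]
  · obtain ⟨l, hl⟩ := hϖ.exists_norm_eq_zpow x hx
    rw [hl, zpow_le_zpow_iff_right_of_lt_one₀ hϖ.norm_pos hϖ.norm_lt_one,
      zpow_lt_zpow_iff_right_of_lt_one₀ hϖ.norm_pos hϖ.norm_lt_one, Int.add_one_le_iff]

theorem norm_le_iff_lt_one (hϖ : IsUniformizer ϖ) {x : F} : ‖x‖ ≤ ‖ϖ‖ ↔ ‖x‖ < 1 := by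
  simpa using hϖ.norm_le_zpow_iff_lt (x := x) (k := 0)

end IsUniformizer

variable [IsUltrametricDist F]

theorem exists_sq_eq_one_add [CompleteSpace F] (h2 : ‖(2 : F)‖ = 1) {a : F} (ha : ‖a‖ < 1) :
    ∃ r : F, ‖r - 1‖ < 1 ∧ r ^ 2 = 1 + a := by
  have h20 : (2 : F) ≠ 0 := fun h => by simp [h] at h2
  set s : Set F := Metric.closedBall 0 ‖a‖
  have mem_s {y : F} : y ∈ s ↔ ‖y‖ ≤ ‖a‖ := mem_closedBall_zero_iff
  -- `1 + y` is a square root of `1 + a` when `y` is a fixed point of this contraction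
  have hmaps : Set.MapsTo (fun y : F => (a - y ^ 2) / 2) s s := by
    intro y hy
    rw [mem_s] at hy ⊢
    rw [norm_div, h2, div_one]
    refine norm_sub_le_of_le_of_le le_rfl ?_
    rw [norm_pow]
    nlinarith [norm_nonneg y]
  have hcontr : ContractingWith ‖a‖₊ (hmaps.restrict _ s s) := by
    refine ⟨by exact_mod_cast ha, LipschitzWith.of_dist_le_mul fun ⟨x, hx⟩ ⟨y, hy⟩ => ?_⟩
    change dist ((a - x ^ 2) / 2) ((a - y ^ 2) / 2) ≤ ‖a‖ * dist x y
    have hdiff : (a - x ^ 2) / 2 - (a - y ^ 2) / 2 = -((x + y) * (x - y) / 2) := by ring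
    rw [dist_eq_norm, dist_eq_norm, hdiff, norm_neg, norm_div, h2, div_one, norm_mul]
    gcongr
    exact norm_add_le_of_le_of_le (mem_s.mp hx) (mem_s.mp hy)
  obtain ⟨y, hy, hfix, -⟩ := hcontr.exists_fixedPoint' Metric.isClosed_closedBall.isComplete hmaps
    (x := 0) (by simp [mem_s]) (edist_ne_top _ _)
  refine ⟨1 + y, by simpa using (mem_s.mp hy).trans_lt ha, ?_⟩
  have hroot : (a - y ^ 2) / 2 = y := hfix
  field_simp at hroot
  linear_combination -hroot

theorem exists_sq_eq_of_norm_sq_sub_lt_one [CompleteSpace F] (h2 : ‖(2 : F)‖ = 1) {u v : F}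
    (hv : ‖v‖ = 1) (huv : ‖v ^ 2 - u‖ < 1) : ∃ w : F, ‖w‖ = 1 ∧ w ^ 2 = u := by
  have hv0 : v ≠ 0 := fun h => by simp [h] at hv
  obtain ⟨r, hr, hr2⟩ := exists_sq_eq_one_add h2 (a := (u - v ^ 2) / v ^ 2) (by
    rwa [norm_div, norm_pow, hv, one_pow, div_one, norm_sub_rev])
  refine ⟨v * r, ?_, ?_⟩
  · rw [norm_mul, hv, one_mul, norm_eq_of_norm_sub_lt (y := 1) (by simpa using hr), norm_one]
  · rw [mul_pow, hr2]; field_simp; ring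

end Field

section ResidueField

variable {F : Type*} [NontriviallyNormedField F] [IsUltrametricDist F]

theorem residue_eq_zero_iff_norm_lt_one {x : 𝒪[F]} :
    IsLocalRing.residue 𝒪[F] x = 0 ↔ ‖(x : F)‖ < 1 := by
  rw [IsLocalRing.residue_eq_zero_iff, IsLocalRing.mem_maximalIdeal, mem_nonunits_iff,
    Valued.integer.isUnit_iff_norm_eq_one]
  exact (Valued.integer.norm_le_one x).lt_iff_ne.symm

theorem two_ne_zero_residueField (hq : Odd (resCard F)) : (2 : 𝓀[F]) ≠ 0 := by
  have : Finite 𝓀[F] := Nat.finite_of_card_ne_zero hq.pos.ne'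
  have := Fintype.ofFinite 𝓀[F]
  refine Ring.two_ne_zero fun h => Nat.not_even_iff_odd.mpr hq (Nat.even_iff.mpr ?_)
  rw [resCard, Nat.card_eq_fintype_card]
  exact FiniteField.even_card_of_char_two h

theorem norm_two_eq_one (hq : Odd (resCard F)) : ‖(2 : F)‖ = 1 := by
  have h := (residue_eq_zero_iff_norm_lt_one (x := (2 : 𝒪[F]))).not.mp
    (by rw [map_ofNat]; exact two_ne_zero_residueField hq)
  exact le_antisymm (Valued.integer.norm_le_one 2) (not_lt.mp h)

theorem isUniformizer_of_irreducible [ProperSpace F] {ϖ : 𝒪[F]} (hϖ : Irreducible ϖ) :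
    IsUniformizer (ϖ : F) := by
  have : CompactSpace 𝒪[F] := by
    have hball : ((𝒪[F] : Subring F) : Set F) = Metric.closedBall 0 1 := by
      ext x; simpa using Valued.integer.mem_iff
    exact isCompact_iff_compactSpace.mp (hball ▸ isCompact_closedBall 0 1)
  have : (Valued.v : Valuation F NNReal).IsNontrivial :=
    inferInstanceAs (NormedField.valuation (K := F)).IsNontrivial
  have : IsDiscreteValuationRing 𝒪[F] := Valued.integer.isDiscreteValuationRing_of_compactSpace
  have of_norm_le_one (x : F) (hx : x ≠ 0) (hx1 : ‖x‖ ≤ 1) : ∃ k : ℤ, ‖x‖ = ‖(ϖ : F)‖ ^ k := by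
    obtain ⟨k, u, hu⟩ := IsDiscreteValuationRing.eq_unit_mul_pow_irreducible
      (x := (⟨x, Valued.integer.mem_iff.mpr hx1⟩ : 𝒪[F])) (by simpa [Subtype.ext_iff] using hx) hϖ
    have hu' : x = (u : 𝒪[F]) * (ϖ : F) ^ k := congrArg Subtype.val hu
    refine ⟨k, ?_⟩
    rw [hu', norm_mul, Valued.integer.norm_coe_unit, one_mul, norm_pow, zpow_natCast]
  refine ⟨by simpa using hϖ.ne_zero, Valued.integer.norm_irreducible_lt_one hϖ, fun x hx => ?_⟩
  rcases le_total ‖x‖ 1 with h | h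
  · exact of_norm_le_one x hx h
  · obtain ⟨k, hk⟩ := of_norm_le_one x⁻¹ (inv_ne_zero hx)
      (by rw [norm_inv]; exact inv_le_one_of_one_le₀ h)
    exact ⟨-k, by rw [_root_.zpow_neg, ← hk, norm_inv, inv_inv]⟩

theorem exists_sq_eq_of_isSquare_residue [CompleteSpace F] (h2 : ‖(2 : F)‖ = 1) {u : 𝒪[F]}
    (hu : ‖(u : F)‖ = 1) (hsq : IsSquare (IsLocalRing.residue 𝒪[F] u)) :
    ∃ w : F, ‖w‖ = 1 ∧ w ^ 2 = u := by
  obtain ⟨y, hy⟩ := hsq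
  obtain ⟨y, rfl⟩ := IsLocalRing.residue_surjective y
  have hyu : ‖(y ^ 2 - u : F)‖ < 1 := by
    have : IsLocalRing.residue 𝒪[F] (y ^ 2 - u) = 0 := by rw [map_sub, map_pow, hy]; ring
    exact residue_eq_zero_iff_norm_lt_one.mp this
  have hy1 : ‖(y : F)‖ ^ 2 = 1 := by
    rw [← norm_pow, norm_eq_of_norm_sub_lt (y := (u : F)) (by rwa [hu]), hu]
  exact exists_sq_eq_of_norm_sq_sub_lt_one h2
    ((pow_eq_one_iff_of_nonneg (norm_nonneg _) two_ne_zero).mp hy1) hyu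

theorem isSquare_of_sq_eq {δ : 𝒪[F]ˣ} {w : F} (hw : w ^ 2 = ((δ : 𝒪[F]) : F)) : IsSquare δ := by
  have hw1 : ‖w‖ = 1 := by
    rw [← pow_eq_one_iff_of_nonneg (norm_nonneg w) two_ne_zero, ← norm_pow, hw,
      Valued.integer.norm_coe_unit]
  have hunit : IsUnit (⟨w, Valued.integer.mem_iff.mpr hw1.le⟩ : 𝒪[F]) :=
    Valued.integer.isUnit_iff_norm_eq_one.mpr hw1
  refine ⟨hunit.unit, ?_⟩
  ext
  simp [← hw, pow_two]

theorem isSquare_mul_of_not_isSquare {k : Type*} [Field k] [Finite k] {a b : k}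
    (ha : ¬ IsSquare a) (hb : ¬ IsSquare b) : IsSquare (a * b) := by
  classical
  have := Fintype.ofFinite k
  by_contra h
  rw [← quadraticChar_neg_one_iff_not_isSquare] at ha hb h
  rw [map_mul, ha, hb] at h
  norm_num at h

theorem isNonsquareUnit_of_not_isSquare [CompleteSpace F] (hq : Odd (resCard F)) {δ : 𝒪[F]ˣ}
    (hδ : ¬ IsSquare δ) : IsNonsquareUnit ((δ : 𝒪[F]) : F) := by
  have : Finite 𝓀[F] := Nat.finite_of_card_ne_zero hq.pos.ne'
  have h2 := norm_two_eq_one hq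
  have hδ1 : ‖((δ : 𝒪[F]) : F)‖ = 1 := Valued.integer.norm_coe_unit δ
  refine ⟨hδ1, fun v hv => ?_, fun u hu => ?_⟩
  · by_contra! h
    obtain ⟨w, -, hw⟩ := exists_sq_eq_of_norm_sq_sub_lt_one h2 hv h
    exact hδ (isSquare_of_sq_eq hw)
  · have hu0 : u ≠ 0 := fun h => by simp [h] at hu
    set u' : 𝒪[F] := ⟨u, Valued.integer.mem_iff.mpr hu.le⟩
    by_cases hsq : IsSquare (IsLocalRing.residue 𝒪[F] u')
    · obtain ⟨w, hw, hwu⟩ := exists_sq_eq_of_isSquare_residue h2 hu hsq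
      refine ⟨w⁻¹, by simp [hw], Or.inl ?_⟩
      rw [inv_pow, hwu, inv_mul_cancel₀ hu0]
    · have hδsq : ¬ IsSquare (IsLocalRing.residue 𝒪[F] δ) := fun h =>
        have ⟨w, _, hw⟩ := exists_sq_eq_of_isSquare_residue h2 hδ1 h
        hδ (isSquare_of_sq_eq hw)
      have hprod : IsSquare (IsLocalRing.residue 𝒪[F] ((δ : 𝒪[F]) * u')) := by
        rw [map_mul]; exact isSquare_mul_of_not_isSquare hδsq hsq
      obtain ⟨w, hw, hwu⟩ := exists_sq_eq_of_isSquare_residue h2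
        (show ‖((δ : 𝒪[F]) : F) * u‖ = 1 by rw [norm_mul, hδ1, hu, one_mul]) hprod
      have hwu' : w ^ 2 = ((δ : 𝒪[F]) : F) * u := hwu
      refine ⟨w / u, by rw [norm_div, hw, hu, div_one], Or.inr ?_⟩
      rw [div_pow, hwu']; field_simp

end ResidueField

section Character

variable {F : Type*} [NontriviallyNormedField F] [IsUltrametricDist F] {ϖ : 𝒪[F]}
  {ψ : AddChar F Circle}

theorem HasOrderZero.eq_one (hψ : HasOrderZero ϖ ψ) {x : F} (hx : ‖x‖ ≤ 1) : ψ x = 1 :=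
  hψ.1 ⟨x, Valued.integer.mem_iff.mpr hx⟩

theorem HasOrderZero.exists_ne_one (hψ : HasOrderZero ϖ ψ) (hϖ : IsUniformizer (ϖ : F)) {y : F}
    (hy : 1 < ‖y‖) : ∃ x : F, ‖x‖ ≤ 1 ∧ ψ (y * x) ≠ 1 := by
  obtain ⟨z, hz⟩ := hψ.2
  have hy0 : y ≠ 0 := norm_pos_iff.mp (zero_lt_one.trans hy)
  refine ⟨y⁻¹ * ((ϖ : F)⁻¹ * z), ?_, by rwa [mul_inv_cancel_left₀ hy0]⟩
  have hyϖ : ‖y⁻¹‖ ≤ ‖(ϖ : F)‖ :=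
    hϖ.norm_le_iff_lt_one.mpr (by rw [norm_inv]; exact inv_lt_one_of_one_lt₀ hy)
  rw [← mul_assoc, norm_mul, norm_mul, norm_inv (ϖ : F)]
  exact mul_le_one₀ (mul_inv_le_one_of_le₀ hyϖ (norm_nonneg _)) (norm_nonneg _)
    (Valued.integer.norm_le_one z)

end Character

/-! ### Integral matrices -/

open scoped Matrix.Norms.Elementwise

section MatrixNorm

variable {F : Type*} [NontriviallyNormedField F]
  {l m n : Type*} [Fintype l] [Fintype m] [Fintype n]

theorem norm_entry_le {M : Matrix m n F} {c : ℝ} (h : ‖M‖ ≤ c) (i : m) (j : n) : ‖M i j‖ ≤ c :=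
  (Matrix.norm_entry_le_entrywise_sup_norm M).trans h

theorem norm_entry_lt {M : Matrix m n F} {c : ℝ} (h : ‖M‖ < c) (i : m) (j : n) : ‖M i j‖ < c :=
  (Matrix.norm_entry_le_entrywise_sup_norm M).trans_lt h

theorem norm_one_matrix_le [DecidableEq n] : ‖(1 : Matrix n n F)‖ ≤ 1 := by
  refine (Matrix.norm_le_iff zero_le_one).mpr fun i j => ?_
  rw [Matrix.one_apply]; split_ifs <;> simp

theorem isUnit_det_of_norm_eq_one [DecidableEq n] {M : Matrix n n F} (hM : ‖M.det‖ = 1) :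
    IsUnit M.det :=
  isUnit_iff_ne_zero.mpr fun h => by simp [h] at hM

variable [IsUltrametricDist F]

instance : IsUltrametricDist (Matrix m n F) :=
  inferInstanceAs (IsUltrametricDist (m → n → F))

theorem norm_matrix_mul_le (M : Matrix l m F) (N : Matrix m n F) : ‖M * N‖ ≤ ‖M‖ * ‖N‖ := by
  refine (Matrix.norm_le_iff (by positivity)).mpr fun i j => ?_
  rw [Matrix.mul_apply]
  refine IsUltrametricDist.norm_sum_le_of_forall_le_of_nonneg (by positivity) fun k _ => ?_
  rw [norm_mul]
  exact mul_le_mul (norm_entry_le le_rfl i k) (norm_entry_le le_rfl k j) (norm_nonneg _)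
    (norm_nonneg _)

theorem norm_matrix_mul_le_of_le {M : Matrix l m F} {N : Matrix m n F} {c d : ℝ} (hM : ‖M‖ ≤ c)
    (hN : ‖N‖ ≤ d) : ‖M * N‖ ≤ c * d :=
  (norm_matrix_mul_le M N).trans
    (mul_le_mul hM hN (norm_nonneg _) ((norm_nonneg _).trans hM))

theorem norm_mul_mul_transpose_le {γ : Matrix m n F} (hγ : ‖γ‖ ≤ 1) (X : Matrix n n F) :
    ‖γ * X * γᵀ‖ ≤ ‖X‖ := by
  have hγt : ‖γᵀ‖ ≤ 1 := by rwa [Matrix.norm_transpose]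
  simpa using norm_matrix_mul_le_of_le (norm_matrix_mul_le_of_le hγ (le_refl ‖X‖)) hγt

end MatrixNorm

section Integral

variable {F : Type*} [NontriviallyNormedField F] [IsUltrametricDist F]
  {m n : Type*} [Fintype m] [Fintype n]

theorem exists_map_subtype_eq {M : Matrix m n F} (hM : ‖M‖ ≤ 1) :
    ∃ M' : Matrix m n 𝒪[F], M'.map (𝒪[F]).subtype = M :=
  ⟨fun i j => ⟨M i j, Valued.integer.mem_iff.mpr (norm_entry_le hM i j)⟩, rfl⟩

theorem norm_map_subtype_le (M : Matrix m n 𝒪[F]) : ‖M.map (𝒪[F]).subtype‖ ≤ 1 :=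
  (Matrix.norm_le_iff zero_le_one).mpr fun i j => Valued.integer.norm_le_one (M i j)

theorem residue_eq_iff_norm_sub_lt_one {x y : 𝒪[F]} :
    IsLocalRing.residue 𝒪[F] x = IsLocalRing.residue 𝒪[F] y ↔ ‖(x - y : F)‖ < 1 := by
  rw [← sub_eq_zero, ← map_sub]
  exact residue_eq_zero_iff_norm_lt_one

theorem norm_eq_one_iff_residue_ne_zero {x : 𝒪[F]} :
    ‖(x : F)‖ = 1 ↔ IsLocalRing.residue 𝒪[F] x ≠ 0 :=
  Valued.integer.isUnit_iff_norm_eq_one.symm.trans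
    (IsLocalRing.residue_ne_zero_iff_isUnit x).symm

variable [DecidableEq n]

theorem det_map_subtype (M : Matrix n n 𝒪[F]) : (M.map (𝒪[F]).subtype).det = (M.det : F) :=
  ((𝒪[F]).subtype.map_det M).symm

theorem norm_det_le_one {M : Matrix n n F} (hM : ‖M‖ ≤ 1) : ‖M.det‖ ≤ 1 := by
  obtain ⟨M, rfl⟩ := exists_map_subtype_eq hM
  rw [det_map_subtype]
  exact Valued.integer.norm_le_one _

theorem norm_det_sub_det_lt_one {M N : Matrix n n F} (hM : ‖M‖ ≤ 1) (hN : ‖N‖ ≤ 1)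
    (hMN : ‖M - N‖ < 1) : ‖M.det - N.det‖ < 1 := by
  obtain ⟨M, rfl⟩ := exists_map_subtype_eq hM
  obtain ⟨N, rfl⟩ := exists_map_subtype_eq hN
  have hres : (IsLocalRing.residue 𝒪[F]).mapMatrix M = (IsLocalRing.residue 𝒪[F]).mapMatrix N :=
    Matrix.ext fun i j => residue_eq_iff_norm_sub_lt_one.mpr (norm_entry_lt hMN i j)
  rw [det_map_subtype, det_map_subtype, ← residue_eq_iff_norm_sub_lt_one, RingHom.map_det, hres,
    RingHom.map_det]

theorem norm_inv_le_one {M : Matrix n n F} (hM : ‖M‖ ≤ 1) (hdet : ‖M.det‖ = 1) : ‖M⁻¹‖ ≤ 1 := by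
  obtain ⟨M, rfl⟩ := exists_map_subtype_eq hM
  rw [det_map_subtype] at hdet
  have hunit : IsUnit M.det := Valued.integer.isUnit_iff_norm_eq_one.mpr hdet
  have hinv : (M.map (𝒪[F]).subtype)⁻¹ = M⁻¹.map (𝒪[F]).subtype := by
    refine Matrix.inv_eq_left_inv ?_
    rw [← Matrix.map_mul, Matrix.nonsing_inv_mul _ hunit, Matrix.map_one _ rfl rfl]
  rw [hinv]
  exact norm_map_subtype_le _

end Integral

section Gamma0

theorem inv_mul_mul_inv_transpose {m R : Type*} [Fintype m] [DecidableEq m] [CommRing R]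
    {γ : Matrix m m R} (hγ : IsUnit γ.det) (X : Matrix m m R) :
    γ⁻¹ * (γ * X * γᵀ) * γ⁻¹ᵀ = X := by
  rw [Matrix.mul_assoc γ X, Matrix.nonsing_inv_mul_cancel_left _ _ hγ, Matrix.mul_assoc,
    ← Matrix.transpose_mul, Matrix.nonsing_inv_mul _ hγ, Matrix.transpose_one, Matrix.mul_one]

theorem isSymm_mul_mul_transpose {m l R : Type*} [Fintype m] [CommSemiring R]
    {X : Matrix m m R} (hX : X.IsSymm) (γ : Matrix l m R) : (γ * X * γᵀ).IsSymm := by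
  rw [Matrix.IsSymm, Matrix.transpose_mul, Matrix.transpose_mul, Matrix.transpose_transpose, hX.eq,
    Matrix.mul_assoc]

variable {F : Type*} [NontriviallyNormedField F] {n : ℕ} {γ η X Y Z : Matrix (Fin n) (Fin n) F}

theorem norm_le_one_of_mem_Gamma0 (hγ : γ ∈ Gamma0 n F) : ‖γ‖ ≤ 1 :=
  (Matrix.norm_le_iff zero_le_one).mpr hγ.1

theorem one_mem_Gamma0 : (1 : Matrix (Fin n) (Fin n) F) ∈ Gamma0 n F :=
  ⟨norm_entry_le norm_one_matrix_le, by simp, fun i j h => by simp [h.ne']⟩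

/-- `X` and `Y` lie in the same orbit of `Γ₀` acting by `γ ↦ γ X ᵗγ`. -/
def Gamma0Equiv (X Y : Matrix (Fin n) (Fin n) F) : Prop := ∃ γ ∈ Gamma0 n F, Y = γ * X * γᵀ

theorem Gamma0Equiv.refl : Gamma0Equiv X X := ⟨1, one_mem_Gamma0, by simp⟩

theorem Gamma0Equiv.norm_det (h : Gamma0Equiv X Y) : ‖Y.det‖ = ‖X.det‖ := by
  obtain ⟨γ, hγ, rfl⟩ := h
  simp [hγ.2.1]

theorem Gamma0Equiv.isSymm (h : Gamma0Equiv X Y) (hX : X.IsSymm) : Y.IsSymm := by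
  obtain ⟨γ, -, rfl⟩ := h
  exact isSymm_mul_mul_transpose hX γ

variable [IsUltrametricDist F]

theorem mem_Gamma0_iff_exists_map_subtype_eq : γ ∈ Gamma0 n F ↔
    ∃ M : Matrix (Fin n) (Fin n) 𝒪[F], M.map (𝒪[F]).subtype = γ ∧ IsUnit M.det ∧
      (M.map (IsLocalRing.residue 𝒪[F])).BlockTriangular id := by
  constructor
  · intro hγ
    obtain ⟨M, rfl⟩ := exists_map_subtype_eq (norm_le_one_of_mem_Gamma0 hγ)
    refine ⟨M, rfl, Valued.integer.isUnit_iff_norm_eq_one.mpr ?_,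
      fun i j hij => residue_eq_zero_iff_norm_lt_one.mpr (hγ.2.2 i j hij)⟩
    exact (congrArg norm (det_map_subtype M)).symm.trans hγ.2.1
  · rintro ⟨M, rfl, hdet, htri⟩
    refine ⟨fun i j => Valued.integer.norm_le_one (M i j), ?_, fun i j hij =>
      residue_eq_zero_iff_norm_lt_one.mp (htri hij)⟩
    rw [det_map_subtype]
    exact Valued.integer.isUnit_iff_norm_eq_one.mp hdet

theorem mem_Gamma0_iff_norm_diag : γ ∈ Gamma0 n F ↔
    ‖γ‖ ≤ 1 ∧ (∀ i, ‖γ i i‖ = 1) ∧ ∀ i j, j < i → ‖γ i j‖ < 1 := by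
  by_cases hγ : ‖γ‖ ≤ 1 ∧ ∀ i j, j < i → ‖γ i j‖ < 1
  swap
  · exact ⟨fun h => absurd ⟨norm_le_one_of_mem_Gamma0 h, h.2.2⟩ hγ, fun h => absurd ⟨h.1, h.2.2⟩ hγ⟩
  obtain ⟨M, rfl⟩ := exists_map_subtype_eq hγ.1
  have htri : (M.map (IsLocalRing.residue 𝒪[F])).BlockTriangular id := fun i j hij =>
    residue_eq_zero_iff_norm_lt_one.mpr (hγ.2 i j hij)
  have hdet : ‖(M.map (𝒪[F]).subtype).det‖ = 1 ↔ ∀ i, ‖(M i i : F)‖ = 1 := by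
    rw [det_map_subtype, norm_eq_one_iff_residue_ne_zero, RingHom.map_det,
      RingHom.mapMatrix_apply, Matrix.det_of_isUpperTriangular htri, Finset.prod_ne_zero_iff]
    simp only [norm_eq_one_iff_residue_ne_zero, Finset.mem_univ, true_imp_iff, Matrix.map_apply]
  exact ⟨fun h => ⟨hγ.1, hdet.mp h.2.1, h.2.2⟩,
    fun h => ⟨fun i j => norm_entry_le hγ.1 i j, hdet.mpr h.2.1, h.2.2⟩⟩

theorem mul_mem_Gamma0 (hγ : γ ∈ Gamma0 n F) (hη : η ∈ Gamma0 n F) : γ * η ∈ Gamma0 n F := by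
  obtain ⟨M, rfl, hM, hMtri⟩ := mem_Gamma0_iff_exists_map_subtype_eq.mp hγ
  obtain ⟨N, rfl, hN, hNtri⟩ := mem_Gamma0_iff_exists_map_subtype_eq.mp hη
  refine mem_Gamma0_iff_exists_map_subtype_eq.mpr ⟨M * N, Matrix.map_mul, ?_, ?_⟩
  · rw [Matrix.det_mul]; exact hM.mul hN
  · rw [Matrix.map_mul]; exact hMtri.mul hNtri

theorem inv_mem_Gamma0 (hγ : γ ∈ Gamma0 n F) : γ⁻¹ ∈ Gamma0 n F := by
  obtain ⟨M, rfl, hM, htri⟩ := mem_Gamma0_iff_exists_map_subtype_eq.mp hγ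
  have map_inv {R : Type _} [CommRing R] (f : 𝒪[F] →+* R) : M⁻¹.map f * M.map f = 1 := by
    rw [← Matrix.map_mul, Matrix.nonsing_inv_mul _ hM, Matrix.map_one _ f.map_zero f.map_one]
  refine mem_Gamma0_iff_exists_map_subtype_eq.mpr
    ⟨M⁻¹, (Matrix.inv_eq_left_inv (map_inv _)).symm, Matrix.isUnit_nonsing_inv_det M hM, ?_⟩
  have := Matrix.invertibleOfIsUnitDet _
    (Matrix.isUnit_det_of_left_inverse (map_inv (IsLocalRing.residue 𝒪[F])))
  rw [← Matrix.inv_eq_left_inv (map_inv _)]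
  exact Matrix.blockTriangular_inv_of_blockTriangular htri

theorem mem_Gamma0_of_norm_sub_lt_one (hγ : γ ∈ Gamma0 n F) (h : ‖η - γ‖ < 1) :
    η ∈ Gamma0 n F := by
  have hη : η = γ + (η - γ) := by abel
  have hγ' := mem_Gamma0_iff_norm_diag.mp hγ
  refine mem_Gamma0_iff_norm_diag.mpr ⟨?_, fun i => ?_, fun i j hij => ?_⟩
  · rw [hη]; exact norm_add_le_of_le_of_le hγ'.1 h.le
  · rw [← hγ'.2.1 i]
    exact norm_eq_of_norm_sub_lt ((norm_entry_lt h i i).trans_eq (hγ'.2.1 i).symm)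
  · rw [hη]; exact norm_add_lt_of_lt (hγ'.2.2 i j hij) (norm_entry_lt h i j)

theorem Gamma0Equiv.trans (h : Gamma0Equiv X Y) (h' : Gamma0Equiv Y Z) : Gamma0Equiv X Z := by
  obtain ⟨γ, hγ, rfl⟩ := h
  obtain ⟨η, hη, rfl⟩ := h'
  exact ⟨η * γ, mul_mem_Gamma0 hη hγ, by simp only [Matrix.transpose_mul, Matrix.mul_assoc]⟩

theorem Gamma0Equiv.symm (h : Gamma0Equiv X Y) : Gamma0Equiv Y X := by
  obtain ⟨γ, hγ, rfl⟩ := h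
  exact ⟨γ⁻¹, inv_mem_Gamma0 hγ,
    (inv_mul_mul_inv_transpose (isUnit_det_of_norm_eq_one hγ.2.1) X).symm⟩

end Gamma0

/-! ### Reduction of symmetric matrices under `Γ₀` -/

section Reduction

variable {F : Type*} [NontriviallyNormedField F] {n : ℕ} {X : Matrix (Fin n) (Fin n) F}
  {σ : Equiv.Perm (Fin n)} {D P : Finset (Fin n)} {i j : Fin n} {m : ℝ}

/-- `X` is symmetric and its rows indexed by `D` are those of a monomial matrix attached to the
involution `σ`, which fixes the indices outside `D`. -/
structure IsMonomialOn (X : Matrix (Fin n) (Fin n) F) (σ : Equiv.Perm (Fin n))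
    (D : Finset (Fin n)) : Prop where
  isSymm : X.IsSymm
  involutive : Function.Involutive σ
  apply_eq_self : ∀ k ∉ D, σ k = k
  eq_zero : ∀ k ∈ D, ∀ l, l ≠ σ k → X k l = 0

/-- Among the entries of `X` with both indices outside `D`, the largest norm is `m > 0`, and the
last row in which it occurs is the `i`-th. -/
structure IsPivotRow (X : Matrix (Fin n) (Fin n) F) (D : Finset (Fin n)) (m : ℝ) (i : Fin n) :
    Prop where
  notMem : i ∉ D
  pos : 0 < m
  norm_le : ∀ k ∉ D, ∀ l ∉ D, ‖X k l‖ ≤ m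
  norm_lt : ∀ k ∉ D, i < k → ∀ l ∉ D, ‖X k l‖ < m
  exists_norm_eq : ∃ l ∉ D, ‖X i l‖ = m

theorem exists_forall_lt_not {ι : Type*} [LinearOrder ι] [WellFoundedGT ι] {p : ι → Prop}
    (h : ∃ i, p i) : ∃ i, p i ∧ ∀ k, i < k → ¬ p k := by
  obtain ⟨i, hi, hmax⟩ := wellFounded_gt.has_min {i | p i} h
  exact ⟨i, hi, fun k hik hk => hmax k hk hik⟩

namespace IsMonomialOn

theorem apply_mem (hX : IsMonomialOn X σ D) {k : Fin n} (hk : k ∈ D) : σ k ∈ D := by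
  by_contra hσk
  exact hσk (by rwa [← hX.involutive k, hX.apply_eq_self _ hσk] at hk)

theorem eq_zero_of_mem_of_notMem (hX : IsMonomialOn X σ D) {k l : Fin n} (hk : k ∈ D)
    (hl : l ∉ D) : X k l = 0 :=
  hX.eq_zero k hk l fun h => hl (h ▸ hX.apply_mem hk)

theorem exists_isPivotRow (hX : IsMonomialOn X σ D) (hdet : X.det ≠ 0) (hD : D ≠ Finset.univ) :
    ∃ m i, IsPivotRow X D m i := by
  obtain ⟨a, ha⟩ : ∃ a, a ∉ D := by
    by_contra! hall; exact hD (Finset.eq_univ_iff_forall.mpr hall)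
  obtain ⟨b, hab⟩ : ∃ b, X a b ≠ 0 := by
    by_contra! hz; exact hdet (Matrix.det_eq_zero_of_row_eq_zero a hz)
  have hb : b ∉ D := fun hb =>
    hab ((hX.isSymm.apply b a).trans (hX.eq_zero_of_mem_of_notMem hb ha))
  obtain ⟨⟨k₀, l₀⟩, hmem, hmax⟩ := Finset.exists_max_image (Dᶜ ×ˢ Dᶜ) (fun p => ‖X p.1 p.2‖)
    ⟨(a, b), by simp [ha, hb]⟩
  simp only [Finset.mem_product, Finset.mem_compl, Prod.forall, and_imp] at hmem hmax
  obtain ⟨i, ⟨hi, hil⟩, hlast⟩ := exists_forall_lt_not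
    (p := fun k => k ∉ D ∧ ∃ l ∉ D, ‖X k l‖ = ‖X k₀ l₀‖) ⟨k₀, hmem.1, l₀, hmem.2, rfl⟩
  exact ⟨‖X k₀ l₀‖, i, hi, (norm_pos_iff.mpr hab).trans_le (hmax a b ha hb),
    fun k hk l hl => hmax k l hk hl,
    fun k hk hik l hl => (hmax k l hk hl).lt_of_ne fun h => hlast k hik ⟨hk, l, hl, h⟩, hil⟩

end IsMonomialOn

section Transvection

variable {R ι : Type*} [CommRing R] [Fintype ι] [DecidableEq ι]

theorem transvection_mul_mul_transpose_apply (X : Matrix ι ι R) (i j : ι) (t : R) (k l : ι) :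
    (Matrix.transvection i j t * X * (Matrix.transvection i j t)ᵀ) k l =
      X k l + (if k = i then t * X j l else 0) + (if l = i then X k j * t else 0) +
        if k = i ∧ l = i then t * X j j * t else 0 := by
  by_cases hk : k = i <;> by_cases hl : l = i <;>
    simp [Matrix.transvection, Matrix.add_mul, Matrix.mul_add, add_assoc, hk, hl,
      eq_comm (a := i)]

/-- The index `i` is the row that is added to the row `j`. -/
theorem transvection_mul_mul_transpose_of_block {X : Matrix ι ι R} (hX : X.IsSymm) {i j : ι}
    (hij : i ≠ j) (hzero : ∀ l, l ≠ i → l ≠ j → X i l = 0 ∧ X j l = 0) (t : R) {Y : Matrix ι ι R}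
    (hY : Y = Matrix.transvection j i t * X * (Matrix.transvection j i t)ᵀ) :
    Y i i = X i i ∧ Y i j = X i j + X i i * t ∧ Y j j = X j j + 2 * X i j * t + X i i * t ^ 2 ∧
      (∀ l, l ≠ i → l ≠ j → Y i l = 0 ∧ Y j l = 0) ∧ ∀ k, k ≠ i → k ≠ j → ∀ l, Y k l = X k l := by
  simp only [hY, transvection_mul_mul_transpose_apply]
  refine ⟨by simp [hij], by simp [hij], ?_, fun l hi hj => ?_, fun k hi hj l => ?_⟩
  · rw [hX.apply i j]; simp; ring
  · simp [hj, hij, hzero l hi hj]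
  · have hki : X k i = 0 := (hX.apply i k).trans (hzero k hi hj).1
    simp [hj, hki]

end Transvection

theorem IsMonomialOn.insert_pair (hX : IsMonomialOn X σ D) (hi : i ∉ D) (hj : j ∉ D) (hij : i ≠ j)
    {Y : Matrix (Fin n) (Fin n) F} (hY : Y.IsSymm) (hYX : ∀ k ∈ D, ∀ l, Y k l = X k l)
    (hYi : ∀ l, l ≠ j → Y i l = 0) (hYj : ∀ l, l ≠ i → Y j l = 0) :
    IsMonomialOn Y (σ * Equiv.swap i j) (insert i (insert j D)) := by
  have hσi := hX.apply_eq_self i hi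
  have hσj := hX.apply_eq_self j hj
  have hσ_ne {k l : Fin n} (hσl : σ l = l) (hkl : k ≠ l) : σ k ≠ l := fun h =>
    hkl (by rw [← hX.involutive k, h, hσl])
  have hswap {k : Fin n} (hki : k ≠ i) (hkj : k ≠ j) : (σ * Equiv.swap i j) k = σ k := by
    rw [Equiv.Perm.mul_apply, Equiv.swap_apply_of_ne_of_ne hki hkj]
  refine ⟨hY, fun k => ?_, fun k hk => ?_, fun k hk l hl => ?_⟩
  · rcases eq_or_ne k i with rfl | hki
    · simp [hσi, hσj]
    rcases eq_or_ne k j with rfl | hkj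
    · simp [hσi, hσj]
    rw [hswap hki hkj, hswap (hσ_ne hσi hki) (hσ_ne hσj hkj), hX.involutive]
  · simp only [Finset.mem_insert, not_or] at hk
    rw [hswap hk.1 hk.2.1, hX.apply_eq_self k hk.2.2]
  · rcases Finset.mem_insert.mp hk with rfl | hk
    · exact hYi l (by simpa [hσj] using hl)
    rcases Finset.mem_insert.mp hk with rfl | hk
    · exact hYj l (by simpa [hσi] using hl)
    rw [hYX k hk, hX.eq_zero k hk l]
    rwa [hswap (fun h => hi (h ▸ hk)) (fun h => hj (h ▸ hk))] at hl

theorem IsMonomialOn.one_add_mul_mul_transpose_apply (hX : IsMonomialOn X σ D) (hDP : Disjoint D P)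
    {N : Matrix (Fin n) (Fin n) F} (hrow : ∀ k ∈ D ∪ P, ∀ p, N k p = 0)
    (hcol : ∀ k, ∀ p ∉ P, N k p = 0) (hclear : ∀ k ∉ D ∪ P, ∀ p ∈ P, X k p + (N * X) k p = 0)
    {Y : Matrix (Fin n) (Fin n) F} (hY : Y = (1 + N) * X * (1 + N)ᵀ) :
    (∀ k ∈ D, ∀ l, Y k l = X k l) ∧
      ∀ p ∈ P, (∀ l ∈ P, Y p l = X p l) ∧ ∀ l ∉ P, Y p l = 0 := by
  have happly (k l : Fin n) (hk : k ∈ D ∪ P) : Y k l = X k l + (N * X) l k := by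
    have hXN : (X * Nᵀ) k l = (N * X) l k := by
      rw [← Matrix.transpose_apply (N * X), Matrix.transpose_mul, hX.isSymm.eq]
    simp [hY, Matrix.add_mul, Matrix.mul_add, Matrix.mul_assoc, hXN, Matrix.mul_apply (M := N),
      hrow k hk]
  have hNX_row (k l : Fin n) (hl : l ∈ D ∪ P) : (N * X) l k = 0 := by
    simp [Matrix.mul_apply, hrow l hl]
  have hXDP {k p : Fin n} (hk : k ∈ D) (hp : p ∈ P) : X k p = 0 :=
    hX.eq_zero_of_mem_of_notMem hk (Finset.disjoint_right.mp hDP hp)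
  have hNX_col (k l : Fin n) (hk : k ∈ D) : (N * X) l k = 0 := by
    refine (Matrix.mul_apply ..).trans (Finset.sum_eq_zero fun p _ => ?_)
    by_cases hp : p ∈ P
    · rw [hX.isSymm.apply k p, hXDP hk hp, mul_zero]
    · rw [hcol l p hp, zero_mul]
  refine ⟨fun k hk l => ?_, fun p hp => ⟨fun l hl => ?_, fun l hl => ?_⟩⟩
  · rw [happly k l (Finset.mem_union_left P hk), hNX_col k l hk, add_zero]
  · rw [happly p l (Finset.mem_union_right D hp), hNX_row p l (Finset.mem_union_right D hl),
      add_zero]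
  · rw [happly p l (Finset.mem_union_right D hp), hX.isSymm.apply l p]
    by_cases hlD : l ∈ D
    · rw [hNX_row p l (Finset.mem_union_left P hlD), add_zero, hXDP hlD hp]
    · exact hclear l (by simp [hlD, hl]) p hp

theorem transvection_mem_Gamma0 (hij : i ≠ j) {t : F} (ht : ‖t‖ ≤ 1) (hlow : j < i → ‖t‖ < 1) :
    Matrix.transvection i j t ∈ Gamma0 n F := by
  refine ⟨fun k l => ?_, by simp [Matrix.det_transvection_of_ne i j hij], fun k l hlk => ?_⟩ <;>
    rw [Matrix.transvection, Matrix.add_apply, Matrix.one_apply, Matrix.single_apply]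
  · split_ifs with hkl h h
    · exact absurd (h.1.trans (hkl.trans h.2.symm)) hij
    all_goals simp [ht]
  · rw [if_neg hlk.ne', zero_add]
    split_ifs with h
    · exact hlow (by rwa [h.1, h.2])
    · simp

/-- The row `i` is corrected by a multiple of the row `j`. -/
theorem exists_gamma0Equiv_antidiagonal (h2 : ‖(2 : F)‖ = 1) (hX : X.IsSymm) (hji : j < i)
    (hii : ‖X i i‖ < ‖X i j‖) (hjj : X j j = 0)
    (hzero : ∀ l, l ≠ i → l ≠ j → X i l = 0 ∧ X j l = 0) :
    ∃ Y, Gamma0Equiv X Y ∧ (∀ l, l ≠ j → Y i l = 0) ∧ (∀ l, l ≠ i → Y j l = 0) ∧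
      ∀ k, k ≠ i → k ≠ j → ∀ l, Y k l = X k l := by
  have hij : X i j ≠ 0 := norm_pos_iff.mp ((norm_nonneg _).trans_lt hii)
  have h20 : (2 : F) ≠ 0 := fun h => by simp [h] at h2
  set u : F := -(X i i / (2 * X i j)) with hu
  have hu1 : ‖u‖ < 1 := by
    rwa [hu, norm_neg, norm_div, norm_mul, h2, one_mul, div_lt_one (norm_pos_iff.mpr hij)]
  obtain ⟨hYjj, -, hYii, hYzero, hYX⟩ := transvection_mul_mul_transpose_of_block hX hji.ne
    (fun l hj hi => (hzero l hi hj).symm) u rfl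
  refine ⟨_, ⟨_, transvection_mem_Gamma0 hji.ne' hu1.le fun _ => hu1, rfl⟩, fun l hl => ?_,
    fun l hl => ?_, fun k hi hj => hYX k hj hi⟩
  · rcases eq_or_ne l i with rfl | hli
    · rw [hYii, hjj, hX.apply l j, hu]; field_simp; ring
    · exact (hYzero l hl hli).2
  · rcases eq_or_ne l j with rfl | hlj
    · rw [hYjj, hjj]
    · exact (hYzero l hlj hl).1

variable {ϖ δ : F}

theorem IsNonsquareUnit.exists_mul_mul_eq_one_or_eq (hδ : IsNonsquareUnit δ)
    (hσ : Function.Involutive σ) {v : Fin n → F} (hv : ∀ k, ‖v k‖ = 1) (hvσ : ∀ k, v (σ k) = v k) :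
    ∃ u : Fin n → F, (∀ k, ‖u k‖ = 1) ∧
      (∀ k, u k * v k * u (σ k) = 1 ∨ u k * v k * u (σ k) = δ) ∧
        ∀ k, σ k ≠ k → u k * v k * u (σ k) = 1 := by
  choose w hw hwv using fun k => hδ.exists_sq_mul_eq (v k) (hv k)
  have hv0 (k : Fin n) : v k ≠ 0 := norm_ne_zero_iff.mp (hv k ▸ one_ne_zero)
  set u : Fin n → F := fun k => if σ k = k then w k else if k < σ k then (v k)⁻¹ else 1 with hu
  have hmoved (k : Fin n) (hk : σ k ≠ k) : u k * v k * u (σ k) = 1 := by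
    simp only [hu, hσ k, if_neg hk, if_neg hk.symm]
    rcases hk.lt_or_gt with h | h
    · rw [if_neg h.not_gt, if_pos h, hvσ, one_mul, mul_inv_cancel₀ (hv0 k)]
    · rw [if_pos h, if_neg h.not_gt, mul_one, inv_mul_cancel₀ (hv0 k)]
  refine ⟨u, fun k => ?_, fun k => ?_, hmoved⟩
  · simp only [hu]
    split_ifs <;> simp [hw, hv]
  · by_cases hk : σ k = k
    · rw [hk, show u k * v k * u k = w k ^ 2 * v k by simp only [hu, if_pos hk]; ring]
      exact hwv k
    · exact .inl (hmoved k hk)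

theorem IsMonomialOn.exists_apply_eq_mul_zpow (hϖ : IsUniformizer ϖ)
    (hX : IsMonomialOn X σ Finset.univ) (hdet : X.det ≠ 0) :
    ∃ (h : Fin n → ℤ) (v : Fin n → F), (∀ k, h (σ k) = h k) ∧ (∀ k, ‖v k‖ = 1) ∧
      (∀ k, v (σ k) = v k) ∧ ∀ k, X k (σ k) = v k * ϖ ^ h k := by
  have hX0 (k : Fin n) : X k (σ k) ≠ 0 := fun h => hdet <|
    Matrix.det_eq_zero_of_row_eq_zero k fun l => by
      rcases eq_or_ne l (σ k) with rfl | hl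
      exacts [h, hX.eq_zero k (Finset.mem_univ k) l hl]
  have hXσ (k : Fin n) : X (σ k) (σ (σ k)) = X k (σ k) := by
    rw [hX.involutive, hX.isSymm.apply]
  choose h hh using fun k => hϖ.exists_norm_eq_zpow _ (hX0 k)
  have hhσ (k : Fin n) : h (σ k) = h k :=
    zpow_right_injective₀ hϖ.norm_pos hϖ.norm_lt_one.ne (by simp only [← hh, hXσ])
  refine ⟨h, fun k => X k (σ k) / ϖ ^ h k, hhσ, fun k => ?_, fun k => ?_,
    fun k => (div_mul_cancel₀ _ (zpow_ne_zero _ hϖ.ne_zero)).symm⟩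
  · rw [norm_div, norm_zpow, hh, div_self (zpow_ne_zero _ hϖ.norm_pos.ne')]
  · simp only [hXσ, hhσ]

theorem IsPivotRow.exists_lt_norm_apply_eq (hX : X.IsSymm) (hp : IsPivotRow X D m i)
    (hii : ‖X i i‖ ≠ m) : ∃ j ∉ D, j < i ∧ ‖X i j‖ = m ∧ ∀ k ∉ D, j < k → ‖X k i‖ < m := by
  obtain ⟨j, ⟨hj, hij⟩, hlast⟩ := exists_forall_lt_not hp.exists_norm_eq
  refine ⟨j, hj, ?_, hij, fun k hk hjk => (hp.norm_le k hk i hp.notMem).lt_of_ne fun h =>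
    hlast k hjk ⟨hk, hX.apply i k ▸ h⟩⟩
  rcases lt_trichotomy j i with h | rfl | h
  · exact h
  · exact absurd hij hii
  · exact absurd (hX.apply i j ▸ hij) (hp.norm_lt j hj h i hp.notMem).ne

variable [IsUltrametricDist F]

/-- Adding to the rows outside `D ∪ P` multiples of the rows in `P` splits off the block on `P`. -/
theorem IsMonomialOn.exists_gamma0Equiv_block (hX : IsMonomialOn X σ D) (hDP : Disjoint D P)
    (C : Matrix (Fin n) (Fin n) F) (hC : ∀ k ∉ D ∪ P, ∀ p ∈ P, ‖C k p‖ ≤ 1)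
    (hlow : ∀ k ∉ D ∪ P, ∀ p ∈ P, p < k → ‖C k p‖ < 1)
    (hclear : ∀ k ∉ D ∪ P, ∀ p ∈ P, X k p + ∑ r ∈ P, C k r * X r p = 0) :
    ∃ Y, Gamma0Equiv X Y ∧ (∀ k ∈ D, ∀ l, Y k l = X k l) ∧
      ∀ p ∈ P, (∀ l ∈ P, Y p l = X p l) ∧ ∀ l ∉ P, Y p l = 0 := by
  obtain ⟨N, hN⟩ : ∃ N : Matrix (Fin n) (Fin n) F,
      ∀ k p, N k p = if k ∉ D ∪ P ∧ p ∈ P then C k p else 0 := ⟨fun _ _ => _, fun _ _ => rfl⟩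
  have hrow : ∀ k ∈ D ∪ P, ∀ p, N k p = 0 := fun k hk p => by
    rw [hN, if_neg fun h => h.1 hk]
  have hcol : ∀ k, ∀ p ∉ P, N k p = 0 := fun k p hp => by rw [hN, if_neg fun h => hp h.2]
  have hN1 : ‖N‖ ≤ 1 := (Matrix.norm_le_iff zero_le_one).mpr fun k p => by
    rw [hN]; split_ifs with h
    exacts [hC k h.1 p h.2, by simp]
  have hγ : 1 + N ∈ Gamma0 n F := by
    refine mem_Gamma0_iff_norm_diag.mpr
      ⟨norm_add_le_of_le_of_le norm_one_matrix_le hN1, fun k => ?_, fun k p hpk => ?_⟩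
    · have hkk : N k k = 0 := by
        rw [hN, if_neg fun h => h.1 (Finset.mem_union_right D h.2)]
      simp [hkk]
    · rw [Matrix.add_apply, Matrix.one_apply_ne hpk.ne', zero_add, hN]
      split_ifs with h
      exacts [hlow k h.1 p h.2 hpk, by simp]
  refine ⟨_, ⟨1 + N, hγ, rfl⟩, hX.one_add_mul_mul_transpose_apply hDP hrow hcol
    (fun k hk p hp => ?_) rfl⟩
  rw [← hclear k hk p hp, Matrix.mul_apply, ← Finset.sum_subset (Finset.subset_univ P)
    fun r _ hr => by rw [hcol k r hr, zero_mul]]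
  exact congrArg (X k p + ·) (Finset.sum_congr rfl fun r hr => by rw [hN, if_pos ⟨hk, hr⟩])

theorem IsPivotRow.exists_gamma0Equiv_singleton (hX : IsMonomialOn X σ D)
    (hp : IsPivotRow X D m i) (hii : ‖X i i‖ = m) :
    ∃ Y, Gamma0Equiv X Y ∧ IsMonomialOn Y σ (insert i D) := by
  have hXii : X i i ≠ 0 := norm_pos_iff.mp (hii ▸ hp.pos)
  have hD {k : Fin n} (hk : k ∉ D ∪ {i}) : k ∉ D := fun h => hk (Finset.mem_union_left _ h)
  obtain ⟨Y, hXY, hYD, hYi⟩ := hX.exists_gamma0Equiv_block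
    (Finset.disjoint_singleton_right.mpr hp.notMem) (fun k _ => -(X k i / X i i))
    (fun k hk p _ => by
      rw [norm_neg, norm_div, hii, div_le_one hp.pos]
      exact hp.norm_le k (hD hk) i hp.notMem)
    (fun k hk p hpi hpk => by
      rw [norm_neg, norm_div, hii, div_lt_one hp.pos]
      exact hp.norm_lt k (hD hk) (Finset.mem_singleton.mp hpi ▸ hpk) i hp.notMem)
    (fun k _ p hpi => by
      rw [Finset.mem_singleton.mp hpi, Finset.sum_singleton, neg_mul, div_mul_cancel₀ _ hXii,
        add_neg_cancel])
  refine ⟨Y, hXY, hXY.isSymm hX.isSymm, hX.involutive,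
    fun k hk => hX.apply_eq_self k fun h => hk (Finset.mem_insert_of_mem h), fun k hk l hl => ?_⟩
  rcases Finset.mem_insert.mp hk with rfl | hk
  · rw [hX.apply_eq_self k hp.notMem] at hl
    exact (hYi k (Finset.mem_singleton_self k)).2 l (by simpa using hl)
  · rw [hYD k hk, hX.eq_zero k hk l hl]

theorem norm_mul_sub_mul_div_le_one {x y u v Δ : F} (hm : 0 < m) (hΔ : ‖Δ‖ = m ^ 2)
    (hx : ‖x‖ ≤ m) (hy : ‖y‖ ≤ m) (hu : ‖u‖ ≤ m) (hv : ‖v‖ ≤ m) : ‖(x * y - u * v) / Δ‖ ≤ 1 := by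
  rw [norm_div, hΔ, div_le_one (pow_pos hm 2)]
  refine norm_sub_le_of_le_of_le ?_ ?_ <;> rw [norm_mul, pow_two]
  exacts [mul_le_mul hx hy (norm_nonneg _) hm.le, mul_le_mul hu hv (norm_nonneg _) hm.le]

theorem norm_mul_sub_mul_div_lt_one {x y u v Δ : F} (hm : 0 < m) (hΔ : ‖Δ‖ = m ^ 2)
    (hx : ‖x‖ < m) (hy : ‖y‖ ≤ m) (hu : ‖u‖ < m) (hv : ‖v‖ ≤ m) : ‖(x * y - u * v) / Δ‖ < 1 := by
  rw [norm_div, hΔ, div_lt_one (pow_pos hm 2)]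
  refine norm_sub_lt_of_lt ?_ ?_ <;> rw [norm_mul, pow_two]
  exacts [mul_lt_mul_of_lt_of_le_of_nonneg_of_pos hx hy (norm_nonneg _) hm,
    mul_lt_mul_of_lt_of_le_of_nonneg_of_pos hu hv (norm_nonneg _) hm]

theorem norm_mul_sub_sq_eq {a b d : F} (ha : ‖a‖ ≤ ‖b‖) (hd : ‖d‖ < ‖b‖) :
    ‖d * a - b ^ 2‖ = ‖b‖ ^ 2 := by
  rw [← norm_neg, neg_sub, ← norm_pow]
  refine norm_eq_of_norm_sub_lt ?_
  rw [sub_sub_cancel_left, norm_neg, norm_mul, norm_pow, pow_two]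
  exact mul_lt_mul_of_lt_of_le_of_nonneg_of_pos hd ha (norm_nonneg _)
    ((norm_nonneg d).trans_lt hd)

theorem IsPivotRow.exists_gamma0Equiv_pair (hX : IsMonomialOn X σ D)
    (hp : IsPivotRow X D m i) (hii : ‖X i i‖ ≠ m) :
    ∃ Y, ∃ j ∉ D, Gamma0Equiv X Y ∧ j < i ∧ ‖Y i i‖ < ‖Y i j‖ ∧ ‖Y j j‖ ≤ ‖Y i j‖ ∧
      (∀ k ∈ D, ∀ l, Y k l = X k l) ∧ ∀ l, l ≠ i → l ≠ j → Y i l = 0 ∧ Y j l = 0 := by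
  obtain ⟨j, hj, hji, hij, hlast⟩ := hp.exists_lt_norm_apply_eq hX.isSymm hii
  have hXii : ‖X i i‖ < ‖X i j‖ := hij ▸ hlast i hp.notMem hji
  have hXjj : ‖X j j‖ ≤ ‖X i j‖ := hij ▸ hp.norm_le j hj j hj
  have hΔ : ‖X i i * X j j - X i j ^ 2‖ = m ^ 2 :=
    (norm_mul_sub_sq_eq hXjj hXii).trans (by rw [hij])
  have hΔ0 : X i i * X j j - X i j ^ 2 ≠ 0 := norm_pos_iff.mp (hΔ ▸ by have := hp.pos; positivity)
  set Δ := X i i * X j j - X i j ^ 2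
  have hne : i ≠ j := hji.ne'
  have hD {k : Fin n} (hk : k ∉ D ∪ {i, j}) : k ∉ D := fun h => hk (Finset.mem_union_left _ h)
  obtain ⟨Y, hXY, hYD, hYP⟩ := hX.exists_gamma0Equiv_block (P := {i, j})
    (by simp [hp.notMem, hj])
    (fun k p => if p = i then (X k j * X i j - X k i * X j j) / Δ
      else (X k i * X i j - X i i * X k j) / Δ)
    (fun k hk p _ => by
      have hki := hp.norm_le k (hD hk) i hp.notMem
      have hkj := hp.norm_le k (hD hk) j hj
      rcases eq_or_ne p i with hpi | hpi
      · rw [if_pos hpi]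
        exact norm_mul_sub_mul_div_le_one hp.pos hΔ hkj hij.le hki (hXjj.trans hij.le)
      · rw [if_neg hpi]
        exact norm_mul_sub_mul_div_le_one hp.pos hΔ hki hij.le (hXii.le.trans hij.le) hkj)
    (fun k hk p hpij hpk => by
      rcases eq_or_ne p i with rfl | hpi
      · rw [if_pos rfl]
        have hlt := hp.norm_lt k (hD hk) hpk
        exact norm_mul_sub_mul_div_lt_one hp.pos hΔ (hlt j hj) hij.le (hlt p hp.notMem)
          (hXjj.trans hij.le)
      · rw [if_neg hpi]
        obtain rfl : p = j := by simpa [hpi] using hpij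
        exact norm_mul_sub_mul_div_lt_one hp.pos hΔ (hlast k (hD hk) hpk) hij.le
          (hXii.trans_eq hij) (hp.norm_le k (hD hk) p hj))
    (fun k _ p hpij => by
      have hXji := hX.isSymm.apply i j
      rw [Finset.sum_pair hne, if_pos rfl, if_neg hne.symm]
      rcases Finset.mem_insert.mp hpij with rfl | hpj
      · rw [hXji]; field_simp; ring
      · rw [Finset.mem_singleton.mp hpj]; field_simp; ring)
  have hYi := hYP i (by simp)
  have hYj := hYP j (by simp)
  refine ⟨Y, j, hj, hXY, hji, ?_, ?_, hYD, fun l hli hlj => ⟨?_, ?_⟩⟩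
  · rwa [hYi.1 i (by simp), hYi.1 j (by simp)]
  · rwa [hYi.1 j (by simp), hYj.1 j (by simp)]
  · exact hYi.2 l (by simp [hli, hlj])
  · exact hYj.2 l (by simp [hli, hlj])

theorem exists_norm_le_one_quadratic_eq_zero [CompleteSpace F] (h2 : ‖(2 : F)‖ = 1) {a b d : F}
    (ha : ‖a‖ ≤ ‖b‖) (hd : ‖d‖ < ‖b‖) : ∃ t : F, ‖t‖ ≤ 1 ∧ a + 2 * b * t + d * t ^ 2 = 0 := by
  have hbpos : 0 < ‖b‖ := (norm_nonneg d).trans_lt hd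
  have hb : b ≠ 0 := norm_pos_iff.mp hbpos
  have hdisc : ‖-(a * d / b ^ 2)‖ < 1 := by
    rw [norm_neg, norm_div, norm_mul, norm_pow, div_lt_one (by positivity), mul_comm, pow_two]
    exact mul_lt_mul_of_lt_of_le_of_nonneg_of_pos hd ha (norm_nonneg _) hbpos
  obtain ⟨r, hr, hr2⟩ := exists_sq_eq_one_add h2 hdisc
  have hr1 : ‖1 + r‖ = 1 := h2 ▸ norm_eq_of_norm_sub_lt (by
    rwa [h2, show 1 + r - 2 = r - 1 by ring])
  have hr0 : 1 + r ≠ 0 := norm_pos_iff.mp (by rw [hr1]; exact one_pos)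
  refine ⟨-(a / (b * (1 + r))), ?_, ?_⟩
  · rw [norm_neg, norm_div, norm_mul, hr1, mul_one]
    exact div_le_one_of_le₀ ha (norm_nonneg _)
  · have hdisc' : b ^ 2 * r ^ 2 = b ^ 2 - a * d := by rw [hr2]; field_simp; ring
    field_simp
    linear_combination a * hdisc'

/-- The row `j` is corrected by a multiple of the row `i`. -/
theorem exists_gamma0Equiv_apply_eq_zero [CompleteSpace F] (h2 : ‖(2 : F)‖ = 1) (hX : X.IsSymm)
    (hji : j < i) (hii : ‖X i i‖ < ‖X i j‖) (hjj : ‖X j j‖ ≤ ‖X i j‖)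
    (hzero : ∀ l, l ≠ i → l ≠ j → X i l = 0 ∧ X j l = 0) :
    ∃ Y, Gamma0Equiv X Y ∧ Y j j = 0 ∧ ‖Y i i‖ < ‖Y i j‖ ∧
      (∀ l, l ≠ i → l ≠ j → Y i l = 0 ∧ Y j l = 0) ∧ ∀ k, k ≠ i → k ≠ j → ∀ l, Y k l = X k l := by
  obtain ⟨t, ht, hquad⟩ := exists_norm_le_one_quadratic_eq_zero h2 hjj hii
  obtain ⟨hYii, hYij, hYjj, hYzero, hYX⟩ :=
    transvection_mul_mul_transpose_of_block hX hji.ne' hzero t rfl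
  refine ⟨_, ⟨_, transvection_mem_Gamma0 hji.ne ht fun h => absurd h hji.not_gt, rfl⟩,
    hYjj.trans hquad, ?_, hYzero, hYX⟩
  have hnorm : ‖X i j + X i i * t‖ = ‖X i j‖ := norm_eq_of_norm_sub_lt (by
    rw [add_sub_cancel_left, norm_mul]
    exact (mul_le_of_le_one_right (norm_nonneg _) ht).trans_lt hii)
  rwa [hYii, hYij, hnorm]

theorem IsMonomialOn.exists_gamma0Equiv_ssubset [CompleteSpace F] (h2 : ‖(2 : F)‖ = 1)
    (hX : IsMonomialOn X σ D) (hdet : X.det ≠ 0) (hD : D ≠ Finset.univ) :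
    ∃ Y τ E, Gamma0Equiv X Y ∧ IsMonomialOn Y τ E ∧ D ⊂ E := by
  obtain ⟨m, i, hp⟩ := hX.exists_isPivotRow hdet hD
  by_cases hii : ‖X i i‖ = m
  · obtain ⟨Y, hXY, hY⟩ := hp.exists_gamma0Equiv_singleton hX hii
    exact ⟨Y, σ, _, hXY, hY, Finset.ssubset_insert hp.notMem⟩
  · obtain ⟨Y, j, hj, hXY, hji, hYii, hYjj, hYX, hYzero⟩ := hp.exists_gamma0Equiv_pair hX hii
    have hYsymm := hXY.isSymm hX.isSymm
    obtain ⟨Z, hYZ, hZjj, hZii, hZzero, hZY⟩ :=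
      exists_gamma0Equiv_apply_eq_zero h2 hYsymm hji hYii hYjj hYzero
    obtain ⟨W, hZW, hWi, hWj, hWZ⟩ :=
      exists_gamma0Equiv_antidiagonal h2 (hYZ.isSymm hYsymm) hji hZii hZjj hZzero
    have hXW := (hXY.trans hYZ).trans hZW
    refine ⟨W, _, _, hXW, hX.insert_pair hp.notMem hj hji.ne' (hXW.isSymm hX.isSymm)
      (fun k hk l => ?_) hWi hWj,
      (Finset.ssubset_insert hj).trans_subset (Finset.subset_insert i _)⟩
    have hki : k ≠ i := fun h => hp.notMem (h ▸ hk)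
    have hkj : k ≠ j := fun h => hj (h ▸ hk)
    rw [hWZ k hki hkj, hZY k hki hkj, hYX k hk]

theorem exists_gamma0Equiv_isMonomialOn_univ [CompleteSpace F] (h2 : ‖(2 : F)‖ = 1)
    (hX : X.IsSymm) (hdet : X.det ≠ 0) :
    ∃ Y σ, Gamma0Equiv X Y ∧ IsMonomialOn Y σ Finset.univ := by
  suffices key : ∀ (D : Finset (Fin n)) (X : Matrix (Fin n) (Fin n) F) (σ : Equiv.Perm (Fin n)),
      IsMonomialOn X σ D → X.det ≠ 0 → ∃ Y τ, Gamma0Equiv X Y ∧ IsMonomialOn Y τ Finset.univ from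
    key ∅ X 1 ⟨hX, fun _ => rfl, fun _ _ => rfl, by simp⟩ hdet
  intro D
  induction D using WellFoundedGT.induction with
  | ind D ih =>
    intro X σ hX hdet
    by_cases hD : D = Finset.univ
    · exact ⟨X, σ, .refl, hD ▸ hX⟩
    · obtain ⟨Y, τ, E, hXY, hY, hDE⟩ := hX.exists_gamma0Equiv_ssubset h2 hdet hD
      obtain ⟨Z, ρ, hYZ, hZ⟩ := ih E hDE Y τ hY
        (norm_ne_zero_iff.mp (hXY.norm_det ▸ norm_ne_zero_iff.mpr hdet))
      exact ⟨Z, ρ, hXY.trans hYZ, hZ⟩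

theorem diagonal_mem_Gamma0 {u : Fin n → F} (hu : ∀ i, ‖u i‖ = 1) :
    Matrix.diagonal u ∈ Gamma0 n F := by
  refine mem_Gamma0_iff_norm_diag.mpr ⟨?_, by simpa using hu, fun k l hlk => ?_⟩
  · refine (Matrix.norm_le_iff zero_le_one).mpr fun k l => ?_
    rw [Matrix.diagonal_apply]
    split_ifs <;> simp [hu]
  · simp [Matrix.diagonal_apply_ne _ hlk.ne']

theorem IsMonomialOn.exists_gamma0Equiv_repS (hϖ : IsUniformizer ϖ) (hδ : IsNonsquareUnit δ)
    (hX : IsMonomialOn X σ Finset.univ) (hdet : X.det ≠ 0) :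
    ∃ x ∈ Lam n δ, Gamma0Equiv X (repS ϖ x) := by
  obtain ⟨h, v, hhσ, hv, hvσ, hXv⟩ := hX.exists_apply_eq_mul_zpow hϖ hdet
  obtain ⟨u, hu, hε, hε1⟩ := hδ.exists_mul_mul_eq_one_or_eq hX.involutive hv hvσ
  refine ⟨(σ, h, fun k => u k * v k * u (σ k)), ⟨?_, hhσ, hε, hε1⟩, Matrix.diagonal u,
    diagonal_mem_Gamma0 hu, ?_⟩
  · ext k
    simp [sq, hX.involutive k]
  · ext k l
    rw [Matrix.diagonal_transpose, Matrix.mul_diagonal, Matrix.diagonal_mul]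
    by_cases hkl : k = σ l
    · obtain rfl : l = σ k := by rw [hkl, hX.involutive]
      rw [hXv]
      simp only [repS, Matrix.of_apply, if_pos hkl]
      ring
    · rw [hX.eq_zero k (Finset.mem_univ k) l fun h => hkl (by rw [h, hX.involutive])]
      simp [repS, hkl]

theorem exists_gamma0Equiv_repS [CompleteSpace F] (h2 : ‖(2 : F)‖ = 1) (hϖ : IsUniformizer ϖ)
    (hδ : IsNonsquareUnit δ) (hX : X.IsSymm) (hdet : X.det ≠ 0) :
    ∃ x ∈ Lam n δ, Gamma0Equiv X (repS ϖ x) := by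
  obtain ⟨Y, σ, hXY, hY⟩ := exists_gamma0Equiv_isMonomialOn_univ h2 hX hdet
  obtain ⟨x, hx, hYx⟩ := hY.exists_gamma0Equiv_repS hϖ hδ
    (norm_ne_zero_iff.mp (hXY.norm_det ▸ norm_ne_zero_iff.mpr hdet))
  exact ⟨x, hx, hXY.trans hYx⟩

end Reduction

/-! ### The representatives `S_{σ,h,ε}` -/

section Representatives

variable {F : Type*} [NontriviallyNormedField F] {n : ℕ} {ϖ δ : F}
  {x y : Equiv.Perm (Fin n) × (Fin n → ℤ) × (Fin n → F)} {X Z : Matrix (Fin n) (Fin n) F}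

/-- The non-zero entry `ε_k ϖ^{h_k}` in the `k`-th row of `S_{σ,h,ε}`. -/
def repCoeff (ϖ : F) (x : Equiv.Perm (Fin n) × (Fin n → ℤ) × (Fin n → F)) (k : Fin n) : F :=
  x.2.2 k * ϖ ^ x.2.1 k

theorem repS_eq_diagonal_mul_permMatrix (ϖ : F)
    (x : Equiv.Perm (Fin n) × (Fin n → ℤ) × (Fin n → F)) :
    repS ϖ x = Matrix.diagonal (repCoeff ϖ x) * (x.1⁻¹).permMatrix F := by
  ext i j
  simp [repS, repCoeff, Equiv.symm_apply_eq]

theorem mul_repS_apply (M : Matrix (Fin n) (Fin n) F) (ϖ : F)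
    (x : Equiv.Perm (Fin n) × (Fin n → ℤ) × (Fin n → F)) (i l : Fin n) :
    (M * repS ϖ x) i l = M i (x.1 l) * repCoeff ϖ x (x.1 l) := by
  simp [Matrix.mul_apply, repS, repCoeff]

theorem norm_det_permMatrix (σ : Equiv.Perm (Fin n)) : ‖(σ.permMatrix F).det‖ = 1 := by
  rw [Matrix.det_permutation]
  rcases Int.units_eq_one_or (Equiv.Perm.sign σ) with h | h <;> simp [h]

theorem norm_permMatrix_le_one (σ : Equiv.Perm (Fin n)) : ‖σ.permMatrix F‖ ≤ 1 := by
  refine (Matrix.norm_le_iff zero_le_one).mpr fun i j => ?_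
  rw [Equiv.Perm.permMatrix, PEquiv.toMatrix_apply]
  split_ifs <;> simp

namespace Lam

theorem involutive (hx : x ∈ Lam n δ) : Function.Involutive x.1 := fun k => by
  simpa [pow_two] using congrArg (fun τ : Equiv.Perm (Fin n) => τ k) hx.1

theorem eq_apply_iff (hx : x ∈ Lam n δ) {i j : Fin n} : i = x.1 j ↔ x.1 i = j :=
  ⟨fun h => by rw [h, involutive hx], fun h => by rw [← h, involutive hx]⟩

theorem repCoeff_apply (hx : x ∈ Lam n δ) (k : Fin n) :
    repCoeff ϖ x (x.1 k) = repCoeff ϖ x k := by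
  by_cases hk : x.1 k = k
  · rw [hk]
  · rw [repCoeff, repCoeff, hx.2.1, hx.2.2.2 k hk,
      hx.2.2.2 (x.1 k) (by rw [involutive hx]; exact Ne.symm hk)]

theorem norm_repCoeff (hδ : IsNonsquareUnit δ) (hx : x ∈ Lam n δ) (k : Fin n) :
    ‖repCoeff ϖ x k‖ = ‖ϖ‖ ^ x.2.1 k := by
  rw [repCoeff, norm_mul, norm_zpow]
  rcases hx.2.2.1 k with h | h <;> simp [h, hδ.norm_eq_one]

theorem repS_mul_apply (hx : x ∈ Lam n δ) (M : Matrix (Fin n) (Fin n) F) (i l : Fin n) :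
    (repS ϖ x * M) i l = repCoeff ϖ x i * M (x.1 i) l := by
  simp [Matrix.mul_apply, repS, repCoeff, eq_apply_iff hx]

theorem isSymm_repS (hx : x ∈ Lam n δ) : (repS ϖ x).IsSymm := by
  refine Matrix.IsSymm.ext fun i j => ?_
  have hentry (k l : Fin n) : repS ϖ x k l = if k = x.1 l then repCoeff ϖ x k else 0 := rfl
  rw [hentry, hentry]
  by_cases hij : i = x.1 j
  · rw [if_pos ((eq_apply_iff hx).mp hij).symm, if_pos hij, hij, repCoeff_apply hx]
  · rw [if_neg hij, if_neg fun h => hij ((eq_apply_iff hx).mpr h.symm)]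

theorem norm_det_repS (hδ : IsNonsquareUnit δ) (hx : x ∈ Lam n δ) :
    ‖(repS ϖ x).det‖ = ∏ i, ‖ϖ‖ ^ x.2.1 i := by
  rw [repS_eq_diagonal_mul_permMatrix, Matrix.det_mul, norm_mul, norm_det_permMatrix, mul_one,
    Matrix.det_diagonal, norm_prod]
  exact Finset.prod_congr rfl fun i _ => norm_repCoeff hδ hx i

theorem det_repS_add_ne_zero [IsUltrametricDist F] (hϖ : IsUniformizer ϖ) (hδ : IsNonsquareUnit δ)
    (hx : x ∈ Lam n δ) (hZ : ∀ a, ‖Z‖ < ‖ϖ‖ ^ x.2.1 a) : (repS ϖ x + Z).det ≠ 0 := by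
  have hcoeff (i : Fin n) : repCoeff ϖ x i ≠ 0 :=
    norm_ne_zero_iff.mp (norm_repCoeff hδ hx i ▸ zpow_ne_zero _ hϖ.norm_pos.ne')
  set P := (x.1⁻¹).permMatrix F
  set Z' : Matrix (Fin n) (Fin n) F := Matrix.of fun i j => (repCoeff ϖ x i)⁻¹ * Z i j with hZ'
  have hZ'lt : ‖Z'‖ < 1 := (Matrix.norm_lt_iff one_pos).mpr fun i j => by
    rw [hZ', Matrix.of_apply, norm_mul, norm_inv, norm_repCoeff hδ hx,
      inv_mul_lt_one₀ (zpow_pos hϖ.norm_pos _)]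
    exact norm_entry_lt (hZ i) i j
  have hfactor : repS ϖ x + Z = Matrix.diagonal (repCoeff ϖ x) * (P + Z') := by
    rw [Matrix.mul_add, ← repS_eq_diagonal_mul_permMatrix]
    congr 1
    ext i j
    rw [Matrix.diagonal_mul, hZ', Matrix.of_apply, mul_inv_cancel_left₀ (hcoeff i)]
  have hP1 := norm_permMatrix_le_one (F := F) x.1⁻¹
  have hdet : ‖(P + Z').det‖ = 1 := by
    rw [← norm_det_permMatrix (F := F) x.1⁻¹]
    refine norm_eq_of_norm_sub_lt ?_
    rw [norm_det_permMatrix]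
    exact norm_det_sub_det_lt_one (norm_add_le_of_le_of_le hP1 hZ'lt.le) hP1
      (by rwa [add_sub_cancel_left])
  rw [hfactor, Matrix.det_mul, Matrix.det_diagonal]
  exact mul_ne_zero (Finset.prod_ne_zero_iff.mpr fun i _ => hcoeff i)
    (norm_ne_zero_iff.mp (hdet ▸ one_ne_zero))

theorem det_repS_ne_zero [IsUltrametricDist F] (hϖ : IsUniformizer ϖ) (hδ : IsNonsquareUnit δ)
    (hx : x ∈ Lam n δ) : (repS ϖ x).det ≠ 0 := by
  simpa using det_repS_add_ne_zero (Z := 0) hϖ hδ hx fun a => by simpa using zpow_pos hϖ.norm_pos _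

end Lam

/-- The representatives attached to `x, y ∈ Λ_n` are `Γ₀`-equivalent through `γ`, up to an error
`Z` smaller than every entry of the first one. -/
structure NearEquiv (ϖ δ : F) (x y : Equiv.Perm (Fin n) × (Fin n → ℤ) × (Fin n → F))
    (γ Z : Matrix (Fin n) (Fin n) F) : Prop where
  mem_left : x ∈ Lam n δ
  mem_right : y ∈ Lam n δ
  mem_Gamma0 : γ ∈ Gamma0 n F
  eq : repS ϖ y = γ * repS ϖ x * γᵀ + Z
  norm_lt : ∀ a, ‖Z‖ < ‖ϖ‖ ^ x.2.1 a

namespace NearEquiv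

variable {γ : Matrix (Fin n) (Fin n) F} {a k : Fin n}

theorem apply_mul_repCoeff (h : NearEquiv ϖ δ x y γ Z) (i k : Fin n) :
    γ i k * repCoeff ϖ x k =
      repCoeff ϖ y i * γ⁻¹ (x.1 k) (y.1 i) - (Z * γ⁻¹ᵀ) i (x.1 k) := by
  have hγ := isUnit_det_of_norm_eq_one h.mem_Gamma0.2.1
  have hmul : γ * repS ϖ x = repS ϖ y * γ⁻¹ᵀ - Z * γ⁻¹ᵀ := by
    rw [h.eq, Matrix.add_mul, add_sub_cancel_right, Matrix.mul_assoc, ← Matrix.transpose_mul,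
      Matrix.nonsing_inv_mul _ hγ, Matrix.transpose_one, Matrix.mul_one]
  have hentry := congrFun (congrFun hmul i) (x.1 k)
  rwa [mul_repS_apply, Matrix.sub_apply, Lam.repS_mul_apply h.mem_right,
    Lam.involutive h.mem_left, Matrix.transpose_apply] at hentry

theorem repCoeff_eq_sum (h : NearEquiv ϖ δ x y γ Z) (a : Fin n) :
    repCoeff ϖ y a =
      ∑ l, γ a (x.1 l) * repCoeff ϖ x (x.1 l) * γ (y.1 a) l + Z a (y.1 a) := by
  have hentry := congrFun (congrFun h.eq a) (y.1 a)
  rw [Matrix.add_apply, Matrix.mul_apply, repS, Matrix.of_apply,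
    if_pos (Lam.involutive h.mem_right a).symm] at hentry
  rw [repCoeff, hentry]
  simp only [mul_repS_apply, Matrix.transpose_apply]

variable [IsUltrametricDist F]

theorem norm_inv_le_one (h : NearEquiv ϖ δ x y γ Z) : ‖γ⁻¹‖ ≤ 1 :=
  norm_le_one_of_mem_Gamma0 (inv_mem_Gamma0 h.mem_Gamma0)

theorem norm_apply_self (h : NearEquiv ϖ δ x y γ Z) : ‖γ a a‖ = 1 :=
  (mem_Gamma0_iff_norm_diag.mp h.mem_Gamma0).2.1 a

theorem norm_error_lt (h : NearEquiv ϖ δ x y γ Z) (a i j : Fin n) :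
    ‖(Z * γ⁻¹ᵀ) i j‖ < ‖ϖ‖ ^ x.2.1 a := by
  have hγ : ‖γ⁻¹ᵀ‖ ≤ 1 := by rw [Matrix.norm_transpose]; exact h.norm_inv_le_one
  have hle := norm_matrix_mul_le_of_le (le_refl ‖Z‖) hγ
  rw [mul_one] at hle
  exact (norm_entry_le hle i j).trans_lt (h.norm_lt a)

theorem norm_zpow_eq (hδ : IsNonsquareUnit δ) (h : NearEquiv ϖ δ x y γ Z) (a : Fin n) :
    ‖ϖ‖ ^ x.2.1 a = ‖ϖ‖ ^ y.2.1 a * ‖γ⁻¹ (x.1 a) (y.1 a)‖ := by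
  have hnorm : ‖γ a a * repCoeff ϖ x a‖ = ‖ϖ‖ ^ x.2.1 a := by
    rw [norm_mul, h.norm_apply_self, one_mul, Lam.norm_repCoeff hδ h.mem_left]
  rw [← Lam.norm_repCoeff hδ h.mem_right, ← norm_mul, ← hnorm]
  refine (norm_eq_of_norm_sub_lt ?_).symm
  rw [hnorm, h.apply_mul_repCoeff, sub_sub_cancel]
  exact h.norm_error_lt a _ _

theorem norm_zpow_le (hδ : IsNonsquareUnit δ) (h : NearEquiv ϖ δ x y γ Z) (a : Fin n) :
    ‖ϖ‖ ^ x.2.1 a ≤ ‖ϖ‖ ^ y.2.1 a := by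
  rw [h.norm_zpow_eq hδ]
  exact mul_le_of_le_one_right (zpow_nonneg (norm_nonneg ϖ) _) (norm_entry_le h.norm_inv_le_one _ _)

theorem symm (hδ : IsNonsquareUnit δ) (h : NearEquiv ϖ δ x y γ Z) :
    NearEquiv ϖ δ y x γ⁻¹ (-(γ⁻¹ * Z * γ⁻¹ᵀ)) where
  mem_left := h.mem_right
  mem_right := h.mem_left
  mem_Gamma0 := inv_mem_Gamma0 h.mem_Gamma0
  eq := by
    rw [h.eq, Matrix.mul_add, Matrix.add_mul,
      inv_mul_mul_inv_transpose (isUnit_det_of_norm_eq_one h.mem_Gamma0.2.1), add_neg_cancel_right]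
  norm_lt a := by
    rw [norm_neg]
    exact ((norm_mul_mul_transpose_le h.norm_inv_le_one Z).trans_lt (h.norm_lt a)).trans_le
      (h.norm_zpow_le hδ a)

theorem exponent_eq (hϖ : IsUniformizer ϖ) (hδ : IsNonsquareUnit δ)
    (h : NearEquiv ϖ δ x y γ Z) (a : Fin n) : x.2.1 a = y.2.1 a :=
  zpow_right_injective₀ hϖ.norm_pos hϖ.norm_lt_one.ne
    (le_antisymm (h.norm_zpow_le hδ a) ((h.symm hδ).norm_zpow_le hδ a))

theorem perm_le (hϖ : IsUniformizer ϖ) (hδ : IsNonsquareUnit δ) (h : NearEquiv ϖ δ x y γ Z)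
    (a : Fin n) : x.1 a ≤ y.1 a := by
  by_contra! hlt
  have hnorm := h.norm_zpow_eq hδ a
  rw [h.exponent_eq hϖ hδ a] at hnorm
  exact absurd hnorm (mul_lt_of_lt_one_right (zpow_pos hϖ.norm_pos _)
    ((inv_mem_Gamma0 h.mem_Gamma0).2.2 _ _ hlt)).ne'

theorem perm_eq (hϖ : IsUniformizer ϖ) (hδ : IsNonsquareUnit δ) (h : NearEquiv ϖ δ x y γ Z) :
    x.1 = y.1 :=
  Equiv.ext fun a => le_antisymm (h.perm_le hϖ hδ a) ((h.symm hδ).perm_le hϖ hδ a)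

theorem norm_apply_mul_repCoeff_le (hδ : IsNonsquareUnit δ)
    (h : NearEquiv ϖ δ x y γ Z) (a k : Fin n) : ‖γ a k * repCoeff ϖ x k‖ ≤ ‖ϖ‖ ^ y.2.1 a := by
  rw [h.apply_mul_repCoeff]
  refine norm_sub_le_of_le_of_le ?_ ((h.norm_error_lt a _ _).le.trans (h.norm_zpow_le hδ a))
  rw [norm_mul, Lam.norm_repCoeff hδ h.mem_right]
  exact mul_le_of_le_one_right (zpow_nonneg (norm_nonneg ϖ) _) (norm_entry_le h.norm_inv_le_one _ _)

theorem norm_apply_mul_repCoeff_lt (hϖ : IsUniformizer ϖ) (hδ : IsNonsquareUnit δ)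
    (h : NearEquiv ϖ δ x y γ Z) (hak : y.1 a < x.1 k) :
    ‖γ a k * repCoeff ϖ x k‖ < ‖ϖ‖ ^ y.2.1 a := by
  rw [h.apply_mul_repCoeff]
  refine norm_sub_lt_of_lt ?_ ((h.norm_error_lt a _ _).trans_le (h.norm_zpow_le hδ a))
  rw [norm_mul, Lam.norm_repCoeff hδ h.mem_right]
  exact mul_lt_of_lt_one_right (zpow_pos hϖ.norm_pos _)
    ((inv_mem_Gamma0 h.mem_Gamma0).2.2 _ _ hak)

theorem norm_sign_sub_lt (hϖ : IsUniformizer ϖ) (hδ : IsNonsquareUnit δ)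
    (h : NearEquiv ϖ δ x y γ Z) (ha : x.1 a = a) : ‖y.2.2 a - γ a a ^ 2 * x.2.2 a‖ < 1 := by
  have hpos : 0 < ‖ϖ‖ ^ y.2.1 a := zpow_pos hϖ.norm_pos _
  have hya : y.1 a = a := h.perm_eq hϖ hδ ▸ ha
  have hoff : ∀ l ∈ Finset.univ.erase a,
      ‖γ a (x.1 l) * repCoeff ϖ x (x.1 l) * γ a l‖ < ‖ϖ‖ ^ y.2.1 a := fun l hl => by
    rw [norm_mul]
    rcases lt_or_gt_of_ne (Finset.ne_of_mem_erase hl) with hla | hal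
    · calc _ ≤ ‖ϖ‖ ^ y.2.1 a * ‖γ a l‖ := by
            gcongr; exact h.norm_apply_mul_repCoeff_le hδ _ _
        _ < ‖ϖ‖ ^ y.2.1 a := mul_lt_of_lt_one_right hpos (h.mem_Gamma0.2.2 _ _ hla)
    · exact (mul_le_of_le_one_right (norm_nonneg _) (h.mem_Gamma0.1 _ _)).trans_lt
        (h.norm_apply_mul_repCoeff_lt hϖ hδ (by rwa [hya, Lam.involutive h.mem_left]))
  have hsum := h.repCoeff_eq_sum a
  rw [← Finset.add_sum_erase _ _ (Finset.mem_univ a), ha, hya, repCoeff, repCoeff,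
    h.exponent_eq hϖ hδ] at hsum
  have hdiff : (y.2.2 a - γ a a ^ 2 * x.2.2 a) * ϖ ^ y.2.1 a =
      ∑ l ∈ Finset.univ.erase a, γ a (x.1 l) * repCoeff ϖ x (x.1 l) * γ a l + Z a a := by
    linear_combination hsum
  have hlt : ‖(y.2.2 a - γ a a ^ 2 * x.2.2 a) * ϖ ^ y.2.1 a‖ < ‖ϖ‖ ^ y.2.1 a := by
    rw [hdiff, ← h.exponent_eq hϖ hδ a]
    exact norm_add_lt_of_lt
      (norm_sum_lt_of_forall_lt (zpow_pos hϖ.norm_pos _) (h.exponent_eq hϖ hδ a ▸ hoff))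
      (norm_entry_lt (h.norm_lt a) a a)
  rw [norm_mul, norm_zpow] at hlt
  exact (mul_lt_iff_lt_one_left hpos).mp hlt

theorem sign_eq (hϖ : IsUniformizer ϖ) (hδ : IsNonsquareUnit δ) (h : NearEquiv ϖ δ x y γ Z)
    (a : Fin n) : x.2.2 a = y.2.2 a := by
  by_cases ha : x.1 a = a
  swap
  · rw [h.mem_left.2.2.2 a ha, h.mem_right.2.2.2 a (by rwa [← h.perm_eq hϖ hδ])]
  have hlt := h.norm_sign_sub_lt hϖ hδ ha
  have hγ := h.norm_apply_self (a := a)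
  have hγ0 : γ a a ≠ 0 := norm_ne_zero_iff.mp (hγ ▸ one_ne_zero)
  rcases h.mem_left.2.2.1 a with hxa | hxa <;> rcases h.mem_right.2.2.1 a with hya | hya
  · rw [hxa, hya]
  · rw [hxa, hya, mul_one, norm_sub_rev] at hlt
    exact absurd hlt (hδ.one_le_norm_sq_sub _ hγ).not_gt
  · have hinv := hδ.one_le_norm_sq_sub (γ a a)⁻¹ (by rw [norm_inv, hγ, inv_one])
    rw [hxa, hya] at hlt
    rw [show (γ a a)⁻¹ ^ 2 - δ = (γ a a)⁻¹ ^ 2 * (1 - γ a a ^ 2 * δ) by field_simp, norm_mul,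
      norm_pow, norm_inv, hγ, inv_one, one_pow, one_mul] at hinv
    exact absurd hlt hinv.not_gt
  · rw [hxa, hya]

theorem rep_eq (hϖ : IsUniformizer ϖ) (hδ : IsNonsquareUnit δ) (h : NearEquiv ϖ δ x y γ Z) :
    x = y :=
  Prod.ext (h.perm_eq hϖ hδ)
    (Prod.ext (funext (h.exponent_eq hϖ hδ)) (funext (h.sign_eq hϖ hδ)))

end NearEquiv

variable [IsUltrametricDist F]

/-- The `Γ₀`-orbit of the representative `S_{σ,h,ε}`. -/
def orbit (ϖ : F) (x : Equiv.Perm (Fin n) × (Fin n → ℤ) × (Fin n → F)) :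
    Set (Matrix (Fin n) (Fin n) F) := {X | Gamma0Equiv (repS ϖ x) X}

theorem eq_of_mem_orbit (hϖ : IsUniformizer ϖ) (hδ : IsNonsquareUnit δ) (hx : x ∈ Lam n δ)
    (hy : y ∈ Lam n δ) (hXx : X ∈ orbit ϖ x) (hXy : X ∈ orbit ϖ y) : x = y := by
  obtain ⟨γ, hγ, hrep⟩ := hXx.trans hXy.symm
  exact NearEquiv.rep_eq (γ := γ) (Z := 0) hϖ hδ ⟨hx, hy, hγ, by rw [hrep, add_zero],
    fun a => by simpa using zpow_pos hϖ.norm_pos (x.2.1 a)⟩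

variable [CompleteSpace F]

theorem exists_mem_orbit (h2 : ‖(2 : F)‖ = 1) (hϖ : IsUniformizer ϖ) (hδ : IsNonsquareUnit δ)
    (hX : X.IsSymm) (hdet : X.det ≠ 0) : ∃ x ∈ Lam n δ, X ∈ orbit ϖ x := by
  obtain ⟨x, hx, h⟩ := exists_gamma0Equiv_repS h2 hϖ hδ hX hdet
  exact ⟨x, hx, h.symm⟩

theorem repS_add_mem_orbit (h2 : ‖(2 : F)‖ = 1) (hϖ : IsUniformizer ϖ) (hδ : IsNonsquareUnit δ)
    (hx : x ∈ Lam n δ) (hZsymm : Z.IsSymm) (hZ : ∀ a, ‖Z‖ < ‖ϖ‖ ^ x.2.1 a) :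
    repS ϖ x + Z ∈ orbit ϖ x := by
  obtain ⟨y, hy, γ, hγ, hrep⟩ := exists_gamma0Equiv_repS h2 hϖ hδ
    ((Lam.isSymm_repS hx).add hZsymm) (Lam.det_repS_add_ne_zero hϖ hδ hx hZ)
  have hnear : NearEquiv ϖ δ x y γ (γ * Z * γᵀ) :=
    ⟨hx, hy, hγ, by rw [hrep, Matrix.mul_add, Matrix.add_mul], fun a =>
      (norm_mul_mul_transpose_le (norm_le_one_of_mem_Gamma0 hγ) Z).trans_lt (hZ a)⟩
  obtain rfl := hnear.rep_eq hϖ hδ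
  exact Gamma0Equiv.symm ⟨γ, hγ, hrep⟩

theorem add_mem_orbit (h2 : ‖(2 : F)‖ = 1) (hϖ : IsUniformizer ϖ) (hδ : IsNonsquareUnit δ)
    (hx : x ∈ Lam n δ) (hX : X ∈ orbit ϖ x) (hZsymm : Z.IsSymm) (hZ : ∀ a, ‖Z‖ < ‖ϖ‖ ^ x.2.1 a) :
    X + Z ∈ orbit ϖ x := by
  obtain ⟨γ, hγ, rfl⟩ := hX
  have hγ' := inv_mem_Gamma0 hγ
  have hmem : repS ϖ x + γ⁻¹ * Z * γ⁻¹ᵀ ∈ orbit ϖ x :=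
    repS_add_mem_orbit h2 hϖ hδ hx (isSymm_mul_mul_transpose hZsymm _) fun a =>
      (norm_mul_mul_transpose_le (norm_le_one_of_mem_Gamma0 hγ') Z).trans_lt (hZ a)
  refine Gamma0Equiv.trans hmem (Gamma0Equiv.symm ⟨γ⁻¹, hγ', ?_⟩)
  rw [Matrix.mul_add, Matrix.add_mul,
    inv_mul_mul_inv_transpose (isUnit_det_of_norm_eq_one hγ.2.1)]

end Representatives

/-! ### Haar measures -/

theorem finite_image_mk_of_isOpen {G : Type*} [AddGroup G] [TopologicalSpace G]
    [IsTopologicalAddGroup G] {H : AddSubgroup G} (hH : IsOpen (H : Set G)) {A K : Set G}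
    (hK : IsCompact K) (hA : A ⊆ K) : ((QuotientAddGroup.mk : G → G ⧸ H) '' A).Finite :=
  have := QuotientAddGroup.discreteTopology hH
  ((hK.image QuotientAddGroup.continuous_mk).finite_of_discrete).subset (Set.image_mono hA)

section InvariantMeasure

variable {G : Type*} [AddGroup G] [MeasurableSpace G]

theorem measure_eq_ncard_image_mk_mul [MeasurableAdd G] (μ : Measure G) [μ.IsAddLeftInvariant]
    {H : AddSubgroup G} (hH : MeasurableSet (H : Set G)) {A : Set G}
    (hA : ∀ a ∈ A, ∀ h ∈ H, a + h ∈ A)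
    (hfin : ((QuotientAddGroup.mk : G → G ⧸ H) '' A).Finite) :
    μ A = ((QuotientAddGroup.mk : G → G ⧸ H) '' A).ncard * μ H := by
  have hcoset (c : G ⧸ H) :
      (QuotientAddGroup.mk : G → G ⧸ H) ⁻¹' {c} = (-c.out + ·) ⁻¹' H := by
    ext a
    rw [Set.mem_preimage, Set.mem_singleton_iff, eq_comm]
    nth_rewrite 1 [← QuotientAddGroup.out_eq' c]
    exact QuotientAddGroup.eq
  have hunion : A = ⋃ c ∈ hfin.toFinset, (QuotientAddGroup.mk : G → G ⧸ H) ⁻¹' {c} := by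
    ext a
    simp only [Set.Finite.mem_toFinset, Set.mem_iUnion, Set.mem_preimage, Set.mem_singleton_iff,
      exists_prop, exists_eq_right']
    refine ⟨Set.mem_image_of_mem _, ?_⟩
    rintro ⟨b, hb, hab⟩
    simpa using hA b hb _ (QuotientAddGroup.eq.mp hab)
  nth_rewrite 1 [hunion]
  rw [measure_biUnion_finset]
  · simp only [hcoset, measure_preimage_add, Finset.sum_const, nsmul_eq_mul,
      Set.ncard_eq_toFinset_card _ hfin]
  · exact fun c _ d _ hcd => Disjoint.preimage _ (Set.disjoint_singleton.mpr hcd)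
  · exact fun c _ => hcoset c ▸ measurable_const_add _ hH

theorem map_eq_of_preimage_eq_self [TopologicalSpace G] [IsTopologicalAddGroup G]
    [SecondCountableTopology G] [BorelSpace G] (μ : Measure G) [SigmaFinite μ]
    [μ.IsAddHaarMeasure] {e : G ≃+ G} (he : Continuous e) (he' : Continuous e.symm) {K : Set G}
    (hK : IsCompact K) (hKo : IsOpen K) (hK0 : K.Nonempty) (hpre : e ⁻¹' K = K) :
    Measure.map e μ = μ := by
  let K₀ : TopologicalSpace.PositiveCompacts G := ⟨⟨K, hK⟩, by rwa [hKo.interior_eq]⟩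
  have := e.isAddHaarMeasure_map μ he he'
  have : SigmaFinite (Measure.map e μ) :=
    (Homeomorph.mk e.toEquiv he he').toMeasurableEquiv.sigmaFinite_map
  have hK₀ : Measure.map e μ K₀ = μ K₀ := by
    change Measure.map e μ K = μ K
    rw [Measure.map_apply he.measurable hKo.measurableSet, hpre]
  rw [Measure.addHaarMeasure_unique (Measure.map e μ) K₀, hK₀, ← Measure.addHaarMeasure_unique]

end InvariantMeasure

section FieldHaar

variable {F : Type*} [NontriviallyNormedField F] [ProperSpace F] [MeasurableSpace F] [BorelSpace F]

instance isAddHaarMeasure_fieldHaar : (fieldHaar F).IsAddHaarMeasure := by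
  unfold fieldHaar; infer_instance

instance sigmaFinite_fieldHaar : SigmaFinite (fieldHaar F) :=
  inferInstance

theorem fieldHaar_closedBall_one : fieldHaar F (Metric.closedBall 0 1) = 1 :=
  Measure.addHaarMeasure_self

open scoped Pointwise in
theorem fieldHaar_closedBall_norm_zpow {a : F} (ha : a ≠ 0) (k : ℤ) :
    fieldHaar F (Metric.closedBall 0 (‖a‖ ^ k)) = (fieldHaar F (Metric.closedBall 0 ‖a‖)) ^ k := by
  have hscale (u : Fˣ) :
      fieldHaar F (Metric.closedBall 0 ‖(u : F)‖) = distribHaarChar F u := by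
    have hball : (u : F) • Metric.closedBall (0 : F) 1 = Metric.closedBall 0 ‖(u : F)‖ := by
      simpa using smul_closedBall' u.ne_zero (0 : F) 1
    have hu := distribHaarChar_mul (fieldHaar F) u (Metric.closedBall (0 : F) 1)
    rw [fieldHaar_closedBall_one, mul_one] at hu
    exact hball ▸ hu.symm
  have hk := hscale (Units.mk0 a ha ^ k)
  rw [Units.val_zpow_eq_zpow_val, Units.val_mk0, norm_zpow, map_zpow] at hk
  have h1 := hscale (Units.mk0 a ha)
  rw [Units.val_mk0] at h1
  rw [hk, h1, ENNReal.coe_zpow distribHaarChar_pos.ne']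

theorem resCard_mul_fieldHaar_ball [IsUltrametricDist F] :
    resCard F * fieldHaar F (Metric.ball 0 1) = 1 := by
  let H : OpenAddSubgroup F := IsUltrametricDist.ball_openAddSubgroup F one_pos
  let K : OpenAddSubgroup F := IsUltrametricDist.closedBall_openAddSubgroup F one_pos
  have hstable : ∀ a ∈ Metric.closedBall (0 : F) 1, ∀ h ∈ H.toAddSubgroup,
      a + h ∈ Metric.closedBall (0 : F) 1 := fun a ha h hh =>
    K.add_mem ha (Metric.ball_subset_closedBall hh)
  have hfin := finite_image_mk_of_isOpen H.isOpen (isCompact_closedBall (0 : F) 1) subset_rfl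
  have hcount := measure_eq_ncard_image_mk_mul (fieldHaar F) H.isOpen.measurableSet hstable hfin
  have hmk_eq {x y : 𝒪[F]} : (QuotientAddGroup.mk (x : F) : F ⧸ H.toAddSubgroup) =
      QuotientAddGroup.mk (y : F) ↔ IsLocalRing.residue 𝒪[F] x = IsLocalRing.residue 𝒪[F] y := by
    rw [QuotientAddGroup.eq, residue_eq_iff_norm_sub_lt_one, norm_sub_rev, sub_eq_neg_add]
    exact mem_ball_zero_iff
  let g : 𝓀[F] → 𝒪[F] := Function.surjInv IsLocalRing.residue_surjective
  have hg (c : 𝓀[F]) : IsLocalRing.residue 𝒪[F] (g c) = c := Function.surjInv_eq _ c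
  have hrange : (QuotientAddGroup.mk : F → F ⧸ H.toAddSubgroup) '' Metric.closedBall 0 1 =
      Set.range fun c => QuotientAddGroup.mk (g c : F) := by
    refine Set.Subset.antisymm ?_ (Set.range_subset_iff.mpr fun c =>
      Set.mem_image_of_mem _ (mem_closedBall_zero_iff.mpr (g c).2))
    rintro _ ⟨x, hx, rfl⟩
    exact ⟨IsLocalRing.residue 𝒪[F] ⟨x, mem_closedBall_zero_iff.mp hx⟩, hmk_eq.mpr (hg _)⟩
  rw [hrange, Set.ncard_range_of_injective fun c d hcd => by
    rw [← hg c, ← hg d]; exact hmk_eq.mp hcd, fieldHaar_closedBall_one] at hcount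
  exact hcount.symm

theorem fieldHaar_closedBall [IsUltrametricDist F] {ϖ : F} (hϖ : IsUniformizer ϖ) (k : ℤ) :
    fieldHaar F (Metric.closedBall 0 (‖ϖ‖ ^ k)) = (resCard F : ENNReal)⁻¹ ^ k := by
  have hball : Metric.closedBall (0 : F) ‖ϖ‖ = Metric.ball 0 1 := by
    ext x
    rw [mem_closedBall_zero_iff, mem_ball_zero_iff, hϖ.norm_le_iff_lt_one]
  rw [fieldHaar_closedBall_norm_zpow hϖ.ne_zero, hball,
    ENNReal.eq_inv_of_mul_eq_one_left ((mul_comm _ _).trans resCard_mul_fieldHaar_ball)]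

theorem pi_fieldHaar_closedBall [IsUltrametricDist F] {ϖ : F} (hϖ : IsUniformizer ϖ) (ι : Type*)
    [Fintype ι] (k : ℤ) : Measure.pi (fun _ : ι => fieldHaar F) (Metric.closedBall 0 (‖ϖ‖ ^ k)) =
      ((resCard F : ENNReal)⁻¹ ^ k) ^ Fintype.card ι := by
  rw [closedBall_pi 0 (zpow_nonneg (norm_nonneg ϖ) k), Measure.pi_pi]
  simp only [Pi.zero_apply, fieldHaar_closedBall hϖ, Finset.prod_const, Finset.card_univ]

end FieldHaar

section SymmetricCoordinates

variable {R : Type*} {n : ℕ}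

/-- Coordinates on the space of symmetric matrices: the entries on and above the diagonal. -/
abbrev UpperCoord (n : ℕ) (R : Type*) := {p : Fin n × Fin n // p.1 ≤ p.2} → R

/-- The coordinates of a symmetric matrix, inverse to `symOfUpper` on symmetric matrices. -/
def upper (X : Matrix (Fin n) (Fin n) R) : UpperCoord n R := fun p => X p.1.1 p.1.2

theorem upper_symOfUpper (x : UpperCoord n R) : upper (symOfUpper x).1 = x := by
  ext ⟨⟨i, j⟩, hij⟩
  simp only [upper, symOfUpper, Matrix.of_apply, min_eq_left (show i ≤ j from hij),
    max_eq_right (show i ≤ j from hij)]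

theorem symOfUpper_upper {X : Matrix (Fin n) (Fin n) R} (hX : X.IsSymm) :
    (symOfUpper (upper X)).1 = X := by
  ext i j
  simp only [symOfUpper, upper, Matrix.of_apply]
  rcases le_total i j with h | h
  · rw [min_eq_left h, max_eq_right h]
  · rw [min_eq_right h, max_eq_left h, hX.apply]

/-- The action `X ↦ γ X ᵗγ` on symmetric matrices, in coordinates. -/
def act [NonUnitalNonAssocSemiring R] (γ : Matrix (Fin n) (Fin n) R) (x : UpperCoord n R) :
    UpperCoord n R :=
  upper (γ * (symOfUpper x).1 * γᵀ)

theorem symOfUpper_act [CommSemiring R] (γ : Matrix (Fin n) (Fin n) R) (x : UpperCoord n R) :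
    (symOfUpper (act γ x)).1 = γ * (symOfUpper x).1 * γᵀ :=
  symOfUpper_upper (isSymm_mul_mul_transpose (symOfUpper x).2 γ)

theorem act_mul [CommSemiring R] (γ η : Matrix (Fin n) (Fin n) R) (x : UpperCoord n R) :
    act (γ * η) x = act γ (act η x) := by
  rw [act, act, symOfUpper_act, Matrix.transpose_mul]
  simp only [Matrix.mul_assoc]

theorem act_one [NonAssocSemiring R] (x : UpperCoord n R) : act 1 x = x := by
  rw [act, Matrix.one_mul, Matrix.transpose_one, Matrix.mul_one, upper_symOfUpper]

theorem act_add [NonUnitalNonAssocSemiring R] (γ : Matrix (Fin n) (Fin n) R)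
    (x y : UpperCoord n R) : act γ (x + y) = act γ x + act γ y := by
  have hadd : (symOfUpper (x + y)).1 = (symOfUpper x).1 + (symOfUpper y).1 := rfl
  rw [act, hadd, Matrix.mul_add, Matrix.add_mul]
  rfl

variable [TopologicalSpace R]

theorem continuous_coe_symOfUpper : Continuous fun x : UpperCoord n R => (symOfUpper x).1 :=
  continuous_matrix fun _ _ => continuous_apply _

theorem continuous_symOfUpper : Continuous (symOfUpper : UpperCoord n R → SymMat n R) :=
  continuous_induced_rng.mpr continuous_coe_symOfUpper

theorem continuous_upper : Continuous (upper : Matrix (Fin n) (Fin n) R → UpperCoord n R) :=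
  continuous_pi fun p => continuous_id.matrix_elem p.1.1 p.1.2

theorem continuous_act [NonUnitalNonAssocSemiring R] [IsTopologicalSemiring R] :
    Continuous fun z : Matrix (Fin n) (Fin n) R × UpperCoord n R => act z.1 z.2 :=
  continuous_upper.comp ((continuous_fst.matrix_mul
    (continuous_coe_symOfUpper.comp continuous_snd)).matrix_mul continuous_fst.matrix_transpose)

theorem continuous_act_right [NonUnitalNonAssocSemiring R] [IsTopologicalSemiring R]
    (γ : Matrix (Fin n) (Fin n) R) : Continuous (act γ) :=
  continuous_act.comp (Continuous.prodMk_right γ)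

theorem continuous_act_left [NonUnitalNonAssocSemiring R] [IsTopologicalSemiring R]
    (x : UpperCoord n R) : Continuous fun γ : Matrix (Fin n) (Fin n) R => act γ x :=
  continuous_act.comp (Continuous.prodMk_left x)

end SymmetricCoordinates

section Volumes

variable {F : Type*} [NontriviallyNormedField F] {n : ℕ}

theorem norm_symOfUpper (x : UpperCoord n F) : ‖(symOfUpper x).1‖ = ‖x‖ := by
  refine le_antisymm ?_ ?_
  · exact (Matrix.norm_le_iff (norm_nonneg x)).mpr fun i j => norm_le_pi_norm x _
  · nth_rewrite 1 [← upper_symOfUpper x]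
    exact (pi_norm_le_iff_of_nonneg (norm_nonneg _)).mpr fun p =>
      norm_entry_le (M := (symOfUpper x).1) le_rfl p.1.1 p.1.2

theorem norm_act_le [IsUltrametricDist F] {γ : Matrix (Fin n) (Fin n) F} (hγ : ‖γ‖ ≤ 1)
    (x : UpperCoord n F) : ‖act γ x‖ ≤ ‖x‖ := by
  rw [← norm_symOfUpper, symOfUpper_act, ← norm_symOfUpper x]
  exact norm_mul_mul_transpose_le hγ _

theorem isOpen_Gamma0 [IsUltrametricDist F] : IsOpen (Gamma0 n F) := by
  refine Metric.isOpen_iff.mpr fun γ hγ => ⟨1, one_pos, fun η hη => ?_⟩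
  exact mem_Gamma0_of_norm_sub_lt_one hγ (mem_ball_iff_norm.mp hη)

variable [ProperSpace F] [MeasurableSpace F] [BorelSpace F]

instance properSpace_matrix : ProperSpace (Matrix (Fin n) (Fin n) F) :=
  inferInstanceAs (ProperSpace (Fin n → Fin n → F))

instance borelSpace_matrix : BorelSpace (Matrix (Fin n) (Fin n) F) :=
  inferInstanceAs (BorelSpace (Fin n → Fin n → F))

instance secondCountableTopology_matrix : SecondCountableTopology (Matrix (Fin n) (Fin n) F) :=
  inferInstanceAs (SecondCountableTopology (Fin n → Fin n → F))

instance sigmaFinite_matrixHaar : SigmaFinite (matrixHaar n F) :=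
  inferInstanceAs (SigmaFinite (Measure.pi fun _ : Fin n => Measure.pi fun _ : Fin n =>
    fieldHaar F))

instance isAddHaarMeasure_matrixHaar : (matrixHaar n F).IsAddHaarMeasure :=
  have : MeasurableAdd (Fin n → F) := inferInstance
  inferInstanceAs (Measure.pi fun _ : Fin n => Measure.pi fun _ : Fin n =>
    fieldHaar F).IsAddHaarMeasure

/-- The Haar measure on `Sym_n(F)` in coordinates; `symHaar` is its image under `symOfUpper`. -/
noncomputable def coordHaar (n : ℕ) (F : Type*) [NontriviallyNormedField F]
    [LocallyCompactSpace F] [MeasurableSpace F] [BorelSpace F] : Measure (UpperCoord n F) :=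
  Measure.pi fun _ => fieldHaar F

instance sigmaFinite_coordHaar : SigmaFinite (coordHaar n F) := by
  unfold coordHaar; infer_instance

instance isAddHaarMeasure_coordHaar : (coordHaar n F).IsAddHaarMeasure := by
  unfold coordHaar; infer_instance

variable [IsUltrametricDist F] {ϖ : F}

theorem coordHaar_closedBall (hϖ : IsUniformizer ϖ) (k : ℤ) :
    coordHaar n F (Metric.closedBall 0 (‖ϖ‖ ^ k)) =
      ((resCard F : ENNReal)⁻¹ ^ k) ^ Fintype.card {p : Fin n × Fin n // p.1 ≤ p.2} :=
  pi_fieldHaar_closedBall hϖ _ k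

theorem matrixHaar_closedBall (hϖ : IsUniformizer ϖ) (k : ℤ) :
    matrixHaar n F (Metric.closedBall 0 (‖ϖ‖ ^ k)) = ((resCard F : ENNReal)⁻¹ ^ k) ^ (n ^ 2) := by
  change (Measure.pi fun _ : Fin n => Measure.pi fun _ : Fin n => fieldHaar F)
    (Metric.closedBall (0 : Fin n → Fin n → F) (‖ϖ‖ ^ k)) = _
  rw [closedBall_pi 0 (zpow_nonneg (norm_nonneg ϖ) k), Measure.pi_pi]
  simp only [Pi.zero_apply, pi_fieldHaar_closedBall hϖ, Finset.prod_const, Finset.card_univ,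
    Fintype.card_fin, ← pow_mul, pow_two]

theorem matrixHaar_Gamma0_ne_top : matrixHaar n F (Gamma0 n F) ≠ ⊤ := by
  have hK : IsCompact (Metric.closedBall (0 : Matrix (Fin n) (Fin n) F) 1) :=
    isCompact_closedBall 0 1
  exact measure_ne_top_of_subset
    (fun _ hγ => mem_closedBall_zero_iff.mpr (norm_le_one_of_mem_Gamma0 hγ)) hK.measure_ne_top

theorem matrixHaar_Gamma0_ne_zero : matrixHaar n F (Gamma0 n F) ≠ 0 :=
  (isOpen_Gamma0.measure_pos _ ⟨1, one_mem_Gamma0⟩).ne'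

theorem map_mul_right_matrixHaar {γ : Matrix (Fin n) (Fin n) F} (hγ : ‖γ‖ ≤ 1)
    (hdet : ‖γ.det‖ = 1) : Measure.map (· * γ) (matrixHaar n F) = matrixHaar n F := by
  have hu := isUnit_det_of_norm_eq_one hdet
  let e : Matrix (Fin n) (Fin n) F ≃+ Matrix (Fin n) (Fin n) F :=
    { toFun := fun M => M * γ
      invFun := fun M => M * γ⁻¹
      left_inv := fun M => Matrix.mul_nonsing_inv_cancel_right _ _ hu
      right_inv := fun M => Matrix.nonsing_inv_mul_cancel_right _ _ hu
      map_add' := fun M N => Matrix.add_mul M N γ }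
  have hmul {γ M : Matrix (Fin n) (Fin n) F} (hγ : ‖γ‖ ≤ 1) (hM : ‖M‖ ≤ 1) : ‖M * γ‖ ≤ 1 :=
    (norm_matrix_mul_le_of_le hM hγ).trans_eq (one_mul 1)
  refine map_eq_of_preimage_eq_self (matrixHaar n F) (e := e)
    (continuous_id.matrix_mul continuous_const) (continuous_id.matrix_mul continuous_const)
    (isCompact_closedBall (0 : Matrix (Fin n) (Fin n) F) 1)
    (IsUltrametricDist.isOpen_closedBall _ one_ne_zero)
    ⟨0, Metric.mem_closedBall_self zero_le_one⟩ ?_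
  ext M
  rw [Set.mem_preimage, mem_closedBall_zero_iff, mem_closedBall_zero_iff]
  refine ⟨fun hM => ?_, hmul hγ⟩
  rw [← Matrix.mul_nonsing_inv_cancel_right γ M hu]
  exact hmul (norm_inv_le_one hγ hdet) hM

theorem map_act_coordHaar {γ : Matrix (Fin n) (Fin n) F} (hγ : ‖γ‖ ≤ 1)
    (hdet : ‖γ.det‖ = 1) : Measure.map (act γ) (coordHaar n F) = coordHaar n F := by
  have hu := isUnit_det_of_norm_eq_one hdet
  have hinv (x : UpperCoord n F) : act γ⁻¹ (act γ x) = x := by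
    rw [← act_mul, Matrix.nonsing_inv_mul _ hu, act_one]
  let e : UpperCoord n F ≃+ UpperCoord n F :=
    { toFun := act γ
      invFun := act γ⁻¹
      left_inv := hinv
      right_inv := fun x => by rw [← act_mul, Matrix.mul_nonsing_inv _ hu, act_one]
      map_add' := act_add γ }
  refine map_eq_of_preimage_eq_self (coordHaar n F) (e := e) (continuous_act_right γ)
    (continuous_act_right γ⁻¹) (isCompact_closedBall 0 1)
    (IsUltrametricDist.isOpen_closedBall _ one_ne_zero)
    ⟨0, Metric.mem_closedBall_self zero_le_one⟩ ?_
  ext x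
  rw [Set.mem_preimage, mem_closedBall_zero_iff, mem_closedBall_zero_iff]
  refine ⟨fun hx => ?_, (norm_act_le hγ x).trans⟩
  rw [← hinv x]
  exact (norm_act_le (norm_inv_le_one hγ hdet) _).trans hx

end Volumes

section OrbitMeasure

variable {F : Type*} [NontriviallyNormedField F] {n : ℕ} {ϖ δ : F}
  {x : Equiv.Perm (Fin n) × (Fin n → ℤ) × (Fin n → F)}

/-- The orbit of `S_{σ,h,ε}` in the coordinates of `Sym_n(F)`. -/
def coordOrbit (ϖ : F) (x : Equiv.Perm (Fin n) × (Fin n → ℤ) × (Fin n → F)) :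
    Set (UpperCoord n F) := {y | (symOfUpper y).1 ∈ orbit ϖ x}

theorem mem_coordOrbit_iff (hx : x ∈ Lam n δ) {y : UpperCoord n F} :
    y ∈ coordOrbit ϖ x ↔ ∃ γ ∈ Gamma0 n F, y = act γ (upper (repS ϖ x)) := by
  refine exists_congr fun γ => and_congr_right fun _ => ⟨fun h => ?_, ?_⟩
  · rw [act, symOfUpper_upper (Lam.isSymm_repS hx), ← h, upper_symOfUpper]
  · rintro rfl
    rw [symOfUpper_act, symOfUpper_upper (Lam.isSymm_repS hx)]

theorem eventually_norm_pow_lt (hϖ : IsUniformizer ϖ) (h : Fin n → ℤ) :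
    ∀ᶠ l : ℕ in atTop, ∀ a, ‖ϖ‖ ^ l < ‖ϖ‖ ^ h a :=
  eventually_all.mpr fun _ => (tendsto_pow_atTop_nhds_zero_of_lt_one (norm_nonneg _)
    hϖ.norm_lt_one).eventually_lt_const (zpow_pos hϖ.norm_pos _)

variable [IsUltrametricDist F]

theorem act_mem_coordOrbit_iff {γ : Matrix (Fin n) (Fin n) F} (hγ : γ ∈ Gamma0 n F)
    {y : UpperCoord n F} : act γ y ∈ coordOrbit ϖ x ↔ y ∈ coordOrbit ϖ x := by
  have hequiv : Gamma0Equiv (symOfUpper y).1 (symOfUpper (act γ y)).1 := ⟨γ, hγ, symOfUpper_act γ y⟩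
  exact ⟨fun h => Gamma0Equiv.trans h hequiv.symm, fun h => Gamma0Equiv.trans h hequiv⟩

theorem norm_le_norm_repS_of_mem_coordOrbit {y : UpperCoord n F} (hy : y ∈ coordOrbit ϖ x) :
    ‖y‖ ≤ ‖repS ϖ x‖ := by
  obtain ⟨γ, hγ, hy⟩ := hy
  rw [← norm_symOfUpper, hy]
  exact norm_mul_mul_transpose_le (norm_le_one_of_mem_Gamma0 hγ) _

theorem isBounded_coordOrbit (ϖ : F) (x : Equiv.Perm (Fin n) × (Fin n → ℤ) × (Fin n → F)) :
    Bornology.IsBounded (coordOrbit ϖ x) :=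
  isBounded_iff_forall_norm_le.mpr ⟨_, fun _ hy => norm_le_norm_repS_of_mem_coordOrbit hy⟩

section Open

variable [CompleteSpace F]

theorem add_mem_coordOrbit (h2 : ‖(2 : F)‖ = 1) (hϖ : IsUniformizer ϖ) (hδ : IsNonsquareUnit δ)
    (hx : x ∈ Lam n δ) {y z : UpperCoord n F} (hy : y ∈ coordOrbit ϖ x)
    (hz : ∀ a, ‖z‖ < ‖ϖ‖ ^ x.2.1 a) : y + z ∈ coordOrbit ϖ x :=
  add_mem_orbit h2 hϖ hδ hx hy (symOfUpper z).2 fun a => (norm_symOfUpper z).trans_lt (hz a)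

theorem isOpen_coordOrbit (h2 : ‖(2 : F)‖ = 1) (hϖ : IsUniformizer ϖ) (hδ : IsNonsquareUnit δ)
    (hx : x ∈ Lam n δ) : IsOpen (coordOrbit ϖ x) := by
  refine Metric.isOpen_iff.mpr fun y hy => ?_
  obtain ⟨l, hl⟩ := (eventually_norm_pow_lt hϖ x.2.1).exists
  refine ⟨‖ϖ‖ ^ l, pow_pos hϖ.norm_pos l, fun z hz => ?_⟩
  rw [← add_sub_cancel y z]
  exact add_mem_coordOrbit h2 hϖ hδ hx hy fun a => (mem_ball_iff_norm.mp hz).trans (hl a)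

end Open

variable [ProperSpace F] [MeasurableSpace F] [BorelSpace F]

theorem coordHaar_coordOrbit_ne_top : coordHaar n F (coordOrbit ϖ x) ≠ ⊤ :=
  (isBounded_coordOrbit ϖ x).measure_lt_top.ne

theorem coordHaar_coordOrbit_ne_zero (h2 : ‖(2 : F)‖ = 1) (hϖ : IsUniformizer ϖ)
    (hδ : IsNonsquareUnit δ) (hx : x ∈ Lam n δ) : coordHaar n F (coordOrbit ϖ x) ≠ 0 :=
  ((isOpen_coordOrbit h2 hϖ hδ hx).measure_pos _
    ⟨act 1 (upper (repS ϖ x)), (mem_coordOrbit_iff hx).mpr ⟨1, one_mem_Gamma0, rfl⟩⟩).ne'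

theorem coordHaar_act_preimage_inter (h2 : ‖(2 : F)‖ = 1) (hϖ : IsUniformizer ϖ)
    (hδ : IsNonsquareUnit δ) (hx : x ∈ Lam n δ) {s : Set (UpperCoord n F)} (hs : MeasurableSet s)
    {γ : Matrix (Fin n) (Fin n) F} (hγ : γ ∈ Gamma0 n F) :
    coordHaar n F (act γ ⁻¹' s ∩ coordOrbit ϖ x) = coordHaar n F (s ∩ coordOrbit ϖ x) := by
  have hpre : act γ ⁻¹' s ∩ coordOrbit ϖ x = act γ ⁻¹' (s ∩ coordOrbit ϖ x) :=
    Set.ext fun _ => and_congr_right fun _ => (act_mem_coordOrbit_iff hγ).symm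
  rw [hpre, ← Measure.map_apply (continuous_act_right γ).measurable
    (hs.inter (isOpen_coordOrbit h2 hϖ hδ hx).measurableSet),
    map_act_coordHaar (norm_le_one_of_mem_Gamma0 hγ) hγ.2.1]

theorem matrixHaar_act_inter (hx : x ∈ Lam n δ) {s : Set (UpperCoord n F)} (hs : MeasurableSet s)
    {y : UpperCoord n F} (hy : y ∈ coordOrbit ϖ x) :
    matrixHaar n F ({γ | act γ y ∈ s} ∩ Gamma0 n F) =
      matrixHaar n F ({γ | act γ (upper (repS ϖ x)) ∈ s} ∩ Gamma0 n F) := by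
  obtain ⟨η, hη, rfl⟩ := (mem_coordOrbit_iff hx).mp hy
  have hpre : {γ | act γ (act η (upper (repS ϖ x))) ∈ s} ∩ Gamma0 n F =
      (· * η) ⁻¹' ({γ | act γ (upper (repS ϖ x)) ∈ s} ∩ Gamma0 n F) := by
    ext γ
    refine and_congr (by rw [Set.mem_ofPred_eq, ← act_mul]; rfl)
      ⟨fun h => mul_mem_Gamma0 h hη, fun h => ?_⟩
    rw [← Matrix.mul_nonsing_inv_cancel_right η γ (isUnit_det_of_norm_eq_one hη.2.1)]
    exact mul_mem_Gamma0 h (inv_mem_Gamma0 hη)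
  have hmul : Continuous (· * η : Matrix (Fin n) (Fin n) F → Matrix (Fin n) (Fin n) F) :=
    continuous_id.matrix_mul continuous_const
  have hmeas : MeasurableSet ({γ | act γ (upper (repS ϖ x)) ∈ s} ∩ Gamma0 n F) :=
    ((continuous_act_left _).measurable hs).inter isOpen_Gamma0.measurableSet
  rw [hpre, ← Measure.map_apply hmul.measurable hmeas,
    map_mul_right_matrixHaar (norm_le_one_of_mem_Gamma0 hη) hη.2.1]

/- Both sides are the measure of `{(γ, y) ∈ Γ₀ × orbit | γ • y ∈ s}`, computed by integrating over
`y` or over `γ` first. -/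
theorem coordHaar_inter_coordOrbit_mul (h2 : ‖(2 : F)‖ = 1) (hϖ : IsUniformizer ϖ)
    (hδ : IsNonsquareUnit δ) (hx : x ∈ Lam n δ) {s : Set (UpperCoord n F)} (hs : MeasurableSet s) :
    coordHaar n F (s ∩ coordOrbit ϖ x) * matrixHaar n F (Gamma0 n F) =
      coordHaar n F (coordOrbit ϖ x) *
        matrixHaar n F ({γ | act γ (upper (repS ϖ x)) ∈ s} ∩ Gamma0 n F) := by
  let μ := (matrixHaar n F).restrict (Gamma0 n F)
  let ν := (coordHaar n F).restrict (coordOrbit ϖ x)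
  let P : Set (Matrix (Fin n) (Fin n) F × UpperCoord n F) := {z | act z.1 z.2 ∈ s}
  have hP : MeasurableSet P := continuous_act.measurable hs
  have hleft (γ) (hγ : γ ∈ Gamma0 n F) :
      ν (Prod.mk γ ⁻¹' P) = coordHaar n F (s ∩ coordOrbit ϖ x) := by
    rw [Measure.restrict_apply (measurable_prodMk_left hP)]
    exact coordHaar_act_preimage_inter h2 hϖ hδ hx hs hγ
  have hright (y) (hy : y ∈ coordOrbit ϖ x) : μ ((fun γ => (γ, y)) ⁻¹' P) =
      matrixHaar n F ({γ | act γ (upper (repS ϖ x)) ∈ s} ∩ Gamma0 n F) := by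
    rw [Measure.restrict_apply (measurable_prodMk_right hP)]
    exact matrixHaar_act_inter hx hs hy
  have hprod := (Measure.prod_apply (μ := μ) (ν := ν) hP).symm.trans (Measure.prod_apply_symm hP)
  rw [setLIntegral_congr_fun isOpen_Gamma0.measurableSet hleft, setLIntegral_const,
    setLIntegral_congr_fun (isOpen_coordOrbit h2 hϖ hδ hx).measurableSet hright,
    setLIntegral_const] at hprod
  rw [hprod, mul_comm]

theorem setIntegral_coordOrbit (h2 : ‖(2 : F)‖ = 1) (hϖ : IsUniformizer ϖ)
    (hδ : IsNonsquareUnit δ) (hx : x ∈ Lam n δ) {φ : UpperCoord n F → ℂ}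
    (hφ : StronglyMeasurable φ) :
    ∫ y in coordOrbit ϖ x, φ y ∂(coordHaar n F) =
      ((coordHaar n F).real (coordOrbit ϖ x) / (matrixHaar n F).real (Gamma0 n F) : ℝ) *
        ∫ γ in Gamma0 n F, φ (act γ (upper (repS ϖ x))) ∂(matrixHaar n F) := by
  have hact := continuous_act_left (upper (repS ϖ x))
  have hmap : (coordHaar n F).restrict (coordOrbit ϖ x) =
      (coordHaar n F (coordOrbit ϖ x) / matrixHaar n F (Gamma0 n F)) •
        Measure.map (fun γ => act γ (upper (repS ϖ x)))
          ((matrixHaar n F).restrict (Gamma0 n F)) := by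
    ext s hs
    rw [Measure.restrict_apply hs, Measure.smul_apply, Measure.map_apply hact.measurable hs,
      Measure.restrict_apply (hact.measurable hs), smul_eq_mul, ENNReal.div_eq_inv_mul,
      mul_assoc, Set.preimage, ← coordHaar_inter_coordOrbit_mul h2 hϖ hδ hx hs, mul_comm,
      ENNReal.mul_inv_cancel_right matrixHaar_Gamma0_ne_zero matrixHaar_Gamma0_ne_top]
  rw [hmap, integral_smul_measure, integral_map hact.aemeasurable hφ.aestronglyMeasurable,
    ENNReal.toReal_div, Complex.real_smul]
  rfl

end OrbitMeasure

/-! ### Local densities -/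

section Density

theorem card_upper_add_choose (n : ℕ) :
    Fintype.card {p : Fin n × Fin n // p.1 ≤ p.2} + n.choose 2 = n ^ 2 := by
  rw [← Fintype.card_congr Sym2.sortEquiv, Sym2.card, Fintype.card_fin]
  have hpascal (m : ℕ) : (m + 1).choose 2 = m + m.choose 2 := by
    rw [Nat.choose_succ_succ, Nat.choose_one_right]
  induction n with
  | zero => rfl
  | succ n ih =>
    rw [hpascal] at ih
    rw [hpascal, hpascal]
    linarith

variable {F : Type*} [NontriviallyNormedField F] {n : ℕ} {ϖ δ : F}
  {x : Equiv.Perm (Fin n) × (Fin n → ℤ) × (Fin n → F)}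

theorem norm_le_inv_norm_pow_denExp (hϖ : IsUniformizer ϖ) (Y : Matrix (Fin n) (Fin n) F) :
    ‖Y‖ ≤ (‖ϖ‖ ^ denExp ϖ Y)⁻¹ := by
  have hmem (m : ℕ) : (∀ i j, ‖ϖ ^ m * Y i j‖ ≤ 1) ↔ ‖Y‖ ≤ (‖ϖ‖ ^ m)⁻¹ := by
    have hpos := pow_pos hϖ.norm_pos m
    rw [Matrix.norm_le_iff (inv_nonneg.mpr hpos.le)]
    simp only [norm_mul, norm_pow, ← one_div, le_div_iff₀' hpos]
  have hne : {m : ℕ | ∀ i j, ‖ϖ ^ m * Y i j‖ ≤ 1}.Nonempty := by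
    obtain ⟨m, hm⟩ := exists_pow_lt_of_lt_one (inv_pos.mpr (by positivity : 0 < ‖Y‖ + 1))
      hϖ.norm_lt_one
    refine ⟨m, (hmem m).mpr ?_⟩
    exact (lt_add_one _).le.trans ((lt_inv_comm₀ (pow_pos hϖ.norm_pos m) (by positivity)).mp hm).le
  exact (hmem _).mp (Nat.sInf_mem hne)

variable [IsUltrametricDist F]

theorem mem_congrLattice_iff {k : ℕ} {M : Matrix (Fin n) (Fin n) F} :
    M ∈ congrLattice n ϖ k ↔ ‖M‖ ≤ ‖ϖ‖ ^ k :=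
  (Matrix.norm_le_iff (pow_nonneg (norm_nonneg ϖ) k)).symm

theorem coe_congrLattice (k : ℕ) :
    (congrLattice n ϖ k : Set (Matrix (Fin n) (Fin n) F)) = Metric.closedBall 0 (‖ϖ‖ ^ k) :=
  Set.ext fun _ => mem_congrLattice_iff.trans mem_closedBall_zero_iff.symm

/-- The solutions `γ ∈ Γ₀` of `γ Y ᵗγ ≡ Y mod 𝔭^l`, whose classes are counted by `solCount`. -/
def solSet (ϖ : F) (Y : Matrix (Fin n) (Fin n) F) (l : ℕ) : Set (Matrix (Fin n) (Fin n) F) :=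
  {γ | γ ∈ Gamma0 n F ∧ γ * Y * γᵀ - Y ∈ congrLattice n ϖ l}

theorem add_mem_solSet (hϖ : IsUniformizer ϖ) {Y γ M : Matrix (Fin n) (Fin n) F} {l : ℕ}
    (hl : l ≠ 0) (hγ : γ ∈ solSet ϖ Y l) (hM : M ∈ congrLattice n ϖ (l + denExp ϖ Y)) :
    γ + M ∈ solSet ϖ Y l := by
  rw [mem_congrLattice_iff] at hM
  have hpos : 0 < ‖ϖ‖ ^ denExp ϖ Y := pow_pos hϖ.norm_pos _
  have hcancel : ‖ϖ‖ ^ (l + denExp ϖ Y) * (‖ϖ‖ ^ denExp ϖ Y)⁻¹ = ‖ϖ‖ ^ l := by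
    rw [pow_add, mul_inv_cancel_right₀ hpos.ne']
  have hM1 : ‖M‖ < 1 := hM.trans_lt (pow_lt_one₀ (norm_nonneg _) hϖ.norm_lt_one (by omega))
  have hγM : γ + M ∈ Gamma0 n F :=
    mem_Gamma0_of_norm_sub_lt_one hγ.1 (by rwa [add_sub_cancel_left])
  have hleft : ‖M * Y * (γ + M)ᵀ‖ ≤ ‖ϖ‖ ^ l := by
    refine (norm_matrix_mul_le_of_le
      (norm_matrix_mul_le_of_le hM (norm_le_inv_norm_pow_denExp hϖ Y)) ?_).trans_eq
        ((mul_one _).trans hcancel)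
    exact (Matrix.norm_transpose _).trans_le (norm_le_one_of_mem_Gamma0 hγM)
  have hright : ‖γ * (Y * Mᵀ)‖ ≤ ‖ϖ‖ ^ l := by
    refine (norm_matrix_mul_le_of_le (norm_le_one_of_mem_Gamma0 hγ.1)
      (norm_matrix_mul_le_of_le (norm_le_inv_norm_pow_denExp hϖ Y) ?_)).trans_eq
        ((one_mul _).trans ((mul_comm _ _).trans hcancel))
    exact (Matrix.norm_transpose _).trans_le hM
  refine ⟨hγM, ?_⟩
  have hsplit : (γ + M) * Y * (γ + M)ᵀ - Y =
      M * Y * (γ + M)ᵀ + γ * (Y * Mᵀ) + (γ * Y * γᵀ - Y) := by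
    rw [Matrix.transpose_add]; noncomm_ring
  rw [hsplit]
  exact add_mem (mem_congrLattice_iff.mpr (norm_add_le_of_le_of_le hleft hright)) hγ.2

variable [ProperSpace F]

theorem resCard_ne_zero : resCard F ≠ 0 := by
  borelize F
  exact fun h => zero_ne_one (α := ENNReal) (by simpa [h] using resCard_mul_fieldHaar_ball (F := F))

variable [MeasurableSpace F] [BorelSpace F]

theorem matrixHaar_solSet (hϖ : IsUniformizer ϖ) (Y : Matrix (Fin n) (Fin n) F) {l : ℕ}
    (hl : l ≠ 0) :
    (matrixHaar n F).real (solSet ϖ Y l) = solCount ϖ Y l / (resCard F : ℝ) ^ (l * n ^ 2) := by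
  have hopen : IsOpen (congrLattice n ϖ (l + denExp ϖ Y) : Set (Matrix (Fin n) (Fin n) F)) := by
    rw [coe_congrLattice]
    exact IsUltrametricDist.isOpen_closedBall _ (pow_pos hϖ.norm_pos _).ne'
  have hK : IsCompact (Metric.closedBall (0 : Matrix (Fin n) (Fin n) F) 1) :=
    isCompact_closedBall 0 1
  have hcount := measure_eq_ncard_image_mk_mul (matrixHaar n F) hopen.measurableSet
    (fun γ hγ M hM => add_mem_solSet hϖ hl hγ hM) (finite_image_mk_of_isOpen hopen hK
      fun γ hγ => mem_closedBall_zero_iff.mpr (norm_le_one_of_mem_Gamma0 hγ.1))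
  have hvol := matrixHaar_closedBall (n := n) hϖ ((l + denExp ϖ Y : ℕ) : ℤ)
  rw [zpow_natCast, zpow_natCast, ← coe_congrLattice] at hvol
  rw [Measure.real, hcount, hvol, ENNReal.toReal_mul, ENNReal.toReal_natCast, ENNReal.toReal_pow,
    ENNReal.toReal_pow, ENNReal.toReal_inv, ENNReal.toReal_natCast, solCount, solSet, div_div,
    ← pow_add, ← pow_mul, inv_pow, ← div_eq_mul_inv, ← add_mul, add_comm l]

theorem matrixHaar_solSet_mul (h2 : ‖(2 : F)‖ = 1) (hϖ : IsUniformizer ϖ)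
    (hδ : IsNonsquareUnit δ) (hx : x ∈ Lam n δ) {l : ℕ} (hl : ∀ a, ‖ϖ‖ ^ l < ‖ϖ‖ ^ x.2.1 a) :
    (matrixHaar n F).real (solSet ϖ (repS ϖ x) l) * (coordHaar n F).real (coordOrbit ϖ x) =
      (matrixHaar n F).real (Gamma0 n F) /
        (resCard F : ℝ) ^ (l * Fintype.card {p : Fin n × Fin n // p.1 ≤ p.2}) := by
  set y := upper (repS ϖ x)
  have hy : (symOfUpper y).1 = repS ϖ x := symOfUpper_upper (Lam.isSymm_repS hx)
  have hymem : y ∈ coordOrbit ϖ x := by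
    rw [coordOrbit, Set.mem_ofPred_eq, hy]
    exact Gamma0Equiv.refl
  have hball : Metric.closedBall y (‖ϖ‖ ^ l) ∩ coordOrbit ϖ x = Metric.closedBall y (‖ϖ‖ ^ l) := by
    refine Set.inter_eq_left.mpr fun z hz => ?_
    rw [← add_sub_cancel y z]
    exact add_mem_coordOrbit h2 hϖ hδ hx hymem fun a =>
      (mem_closedBall_iff_norm.mp hz).trans_lt (hl a)
  have hsol : {γ | act γ y ∈ Metric.closedBall y (‖ϖ‖ ^ l)} ∩ Gamma0 n F =
      solSet ϖ (repS ϖ x) l := by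
    ext γ
    have hsub : (symOfUpper (act γ y - y)).1 = γ * repS ϖ x * γᵀ - repS ϖ x := by
      change (symOfUpper (act γ y)).1 - (symOfUpper y).1 = _
      rw [symOfUpper_act, hy]
    rw [Set.inter_comm]
    refine and_congr_right fun _ => ?_
    rw [mem_congrLattice_iff, ← hsub, norm_symOfUpper]
    exact mem_closedBall_iff_norm
  have hmeas := coordHaar_inter_coordOrbit_mul h2 hϖ hδ hx
    (s := Metric.closedBall y (‖ϖ‖ ^ l)) Metric.isClosed_closedBall.measurableSet
  have hvol := coordHaar_closedBall (n := n) hϖ l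
  rw [zpow_natCast, zpow_natCast] at hvol
  rw [hball, hsol, Measure.addHaar_closedBall_center, hvol] at hmeas
  have hreal := congrArg ENNReal.toReal hmeas
  simp only [ENNReal.toReal_mul, ENNReal.toReal_pow, ENNReal.toReal_inv,
    ENNReal.toReal_natCast] at hreal
  rw [← pow_mul, inv_pow] at hreal
  rw [div_eq_mul_inv, mul_comm, mul_comm _ (_ ^ _)⁻¹]
  exact hreal.symm

theorem densitySeq_eq (h2 : ‖(2 : F)‖ = 1) (hϖ : IsUniformizer ϖ)
    (hδ : IsNonsquareUnit δ) (hx : x ∈ Lam n δ) {l : ℕ} (hl0 : l ≠ 0)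
    (hl : ∀ a, ‖ϖ‖ ^ l < ‖ϖ‖ ^ x.2.1 a) :
    densitySeq ϖ (repS ϖ x) l =
      (matrixHaar n F).real (Gamma0 n F) / (coordHaar n F).real (coordOrbit ϖ x) := by
  have hq : (resCard F : ℝ) ≠ 0 := Nat.cast_ne_zero.mpr resCard_ne_zero
  have horbit : (coordHaar n F).real (coordOrbit ϖ x) ≠ 0 :=
    ENNReal.toReal_ne_zero.mpr ⟨coordHaar_coordOrbit_ne_zero h2 hϖ hδ hx,
      coordHaar_coordOrbit_ne_top⟩
  have hvol := matrixHaar_solSet_mul h2 hϖ hδ hx hl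
  rw [matrixHaar_solSet hϖ _ hl0, ← card_upper_add_choose, mul_add, pow_add] at hvol
  rw [densitySeq]
  field_simp at hvol ⊢
  exact hvol

theorem tendsto_densitySeq (h2 : ‖(2 : F)‖ = 1) (hϖ : IsUniformizer ϖ)
    (hδ : IsNonsquareUnit δ) (hx : x ∈ Lam n δ) :
    Tendsto (densitySeq ϖ (repS ϖ x)) atTop
      (𝓝 ((matrixHaar n F).real (Gamma0 n F) / (coordHaar n F).real (coordOrbit ϖ x))) := by
  refine tendsto_const_nhds.congr' ?_
  filter_upwards [eventually_norm_pow_lt hϖ x.2.1, eventually_ne_atTop 0] with l hl hl0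
  exact (densitySeq_eq h2 hϖ hδ hx hl0 hl).symm

theorem localDensity_eq (h2 : ‖(2 : F)‖ = 1) (hϖ : IsUniformizer ϖ)
    (hδ : IsNonsquareUnit δ) (hx : x ∈ Lam n δ) :
    localDensity ϖ (repS ϖ x) =
      (matrixHaar n F).real (Gamma0 n F) / (coordHaar n F).real (coordOrbit ϖ x) :=
  (tendsto_densitySeq h2 hϖ hδ hx).limUnder_eq

theorem localDensity_pos (h2 : ‖(2 : F)‖ = 1) (hϖ : IsUniformizer ϖ)
    (hδ : IsNonsquareUnit δ) (hx : x ∈ Lam n δ) : 0 < localDensity ϖ (repS ϖ x) := by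
  rw [localDensity_eq h2 hϖ hδ hx]
  exact div_pos (ENNReal.toReal_pos matrixHaar_Gamma0_ne_zero matrixHaar_Gamma0_ne_top)
    (ENNReal.toReal_pos (coordHaar_coordOrbit_ne_zero h2 hϖ hδ hx) coordHaar_coordOrbit_ne_top)

end Density

/-! ### The section `f₀` -/

section Character

variable {F : Type*} [NormedField F] {ω : MulChar F ℂ}

theorem mulChar_mul_self (hω : ω ^ 2 = 1) {a : F} (ha : a ≠ 0) : ω a * ω a = 1 := by
  rw [← MulChar.mul_apply, ← pow_two, hω, MulChar.one_apply ha.isUnit]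

theorem mulChar_inv (hω : ω ^ 2 = 1) {a : F} (ha : a ≠ 0) : ω a⁻¹ = ω a := by
  have hmul := mulChar_mul_self hω ha
  refine mul_right_cancel₀ (left_ne_zero_of_mul_eq_one hmul) ?_
  rw [hmul, ← map_mul, inv_mul_cancel₀ ha, map_one]

theorem ofReal_inv_cpow {r : ℝ} (hr : 0 ≤ r) (s : ℂ) : ((r⁻¹ : ℝ) : ℂ) ^ s = (r : ℂ) ^ (-s) := by
  rw [Complex.ofReal_inv, Complex.inv_cpow, Complex.cpow_neg]
  rw [Complex.arg_ofReal_of_nonneg hr]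
  exact Real.pi_pos.ne

end Character

theorem mulChar_eq_of_norm_sub_lt_one {F : Type*} [NontriviallyNormedField F]
    [IsUltrametricDist F] [CompleteSpace F] {ω : MulChar F ℂ} (h2 : ‖(2 : F)‖ = 1)
    (hω : ω ^ 2 = 1) {u v : F} (hv : ‖v‖ = 1) (huv : ‖u - v‖ < 1) : ω u = ω v := by
  have hv0 : v ≠ 0 := norm_ne_zero_iff.mp (hv ▸ one_ne_zero)
  obtain ⟨r, hr, hr2⟩ := exists_sq_eq_one_add h2 (a := u / v - 1)
    (by rwa [div_sub_one hv0, norm_div, hv, div_one])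
  have hr0 : r ≠ 0 := by rintro rfl; simp at hr
  have hu : u = r * r * v := by rw [← pow_two, hr2, add_sub_cancel, div_mul_cancel₀ _ hv0]
  rw [hu, map_mul, map_mul, mulChar_mul_self hω hr0, one_mul]

section Blocks

variable {F : Type*} {n : ℕ}

section Field

variable [Field F]

/-- The block `B` of `g = (A, B; C, D)`. -/
def blockB (g : Sp n F) : Matrix (Fin n) (Fin n) F :=
  (g : Matrix (Fin n ⊕ Fin n) (Fin n ⊕ Fin n) F).toBlocks₁₂

theorem coe_eq_fromBlocks (g : Sp n F) :
    (g : Matrix (Fin n ⊕ Fin n) (Fin n ⊕ Fin n) F) =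
      Matrix.fromBlocks (blockA g) (blockB g) (blockC g) (blockD g) :=
  (Matrix.fromBlocks_toBlocks _).symm

theorem transpose_blockA_mul_blockD_sub (g : Sp n F) :
    (blockA g)ᵀ * blockD g - (blockC g)ᵀ * blockB g = 1 := by
  have hg := g.2
  rw [coe_eq_fromBlocks g, SymplecticGroup.fromBlocks_mem_iff] at hg
  exact hg.2.2

theorem coe_mul_eq_fromBlocks (g h : Sp n F) :
    ((g * h : Sp n F) : Matrix (Fin n ⊕ Fin n) (Fin n ⊕ Fin n) F) =
      Matrix.fromBlocks (blockA g * blockA h + blockB g * blockC h)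
        (blockA g * blockB h + blockB g * blockD h) (blockC g * blockA h + blockD g * blockC h)
        (blockC g * blockB h + blockD g * blockD h) := by
  rw [Submonoid.coe_mul, coe_eq_fromBlocks g, coe_eq_fromBlocks h, Matrix.fromBlocks_multiply]

theorem blockC_mul (g h : Sp n F) :
    blockC (g * h) = blockC g * blockA h + blockD g * blockC h := by
  rw [blockC, coe_mul_eq_fromBlocks, Matrix.toBlocks_fromBlocks₂₁]

theorem blockD_mul (g h : Sp n F) :
    blockD (g * h) = blockC g * blockB h + blockD g * blockD h := by
  rw [blockD, coe_mul_eq_fromBlocks, Matrix.toBlocks_fromBlocks₂₂]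

theorem coe_inv_eq_fromBlocks (g : Sp n F) :
    ((g⁻¹ : Sp n F) : Matrix (Fin n ⊕ Fin n) (Fin n ⊕ Fin n) F) =
      Matrix.fromBlocks (blockD g)ᵀ (-(blockB g)ᵀ) (-(blockC g)ᵀ) (blockA g)ᵀ := by
  rw [SymplecticGroup.coe_inv, coe_eq_fromBlocks g, Matrix.J, Matrix.fromBlocks_transpose,
    Matrix.fromBlocks_neg, Matrix.fromBlocks_multiply, Matrix.fromBlocks_multiply]
  simp

variable {p : Sp n F}

theorem det_blockA_mul_det_blockD (hp : p ∈ siegelParabolic n F) :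
    (blockA p).det * (blockD p).det = 1 := by
  have hrel := transpose_blockA_mul_blockD_sub p
  rw [show blockC p = 0 from hp, Matrix.transpose_zero, Matrix.zero_mul, sub_zero] at hrel
  rw [← Matrix.det_transpose, ← Matrix.det_mul, hrel, Matrix.det_one]

theorem blockD_parabolic_mul (hp : p ∈ siegelParabolic n F) (g : Sp n F) :
    blockD (p * g) = blockD p * blockD g := by
  rw [blockD_mul, show blockC p = 0 from hp, Matrix.zero_mul, zero_add]

theorem blockC_parabolic_mul (hp : p ∈ siegelParabolic n F) (g : Sp n F) :
    blockC (p * g) = blockD p * blockC g := by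
  rw [blockC_mul, show blockC p = 0 from hp, Matrix.zero_mul, zero_add]

end Field

variable [NontriviallyNormedField F] {k : Sp n F}

theorem mem_siegelGamma_iff : k ∈ siegelGamma n F ↔
    ‖blockA k‖ ≤ 1 ∧ ‖blockB k‖ ≤ 1 ∧ ‖blockC k‖ < 1 ∧ ‖blockD k‖ ≤ 1 := by
  simp only [Matrix.norm_le_iff zero_le_one, Matrix.norm_lt_iff one_pos]
  refine ⟨fun h => ⟨fun _ _ => h.1 _ _, fun _ _ => h.1 _ _, h.2, fun _ _ => h.1 _ _⟩,
    fun ⟨hA, hB, hC, hD⟩ => ⟨?_, hC⟩⟩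
  rintro (i | i) (j | j)
  exacts [hA i j, hB i j, (hC i j).le, hD i j]

theorem inv_mem_siegelGamma (hk : k ∈ siegelGamma n F) : k⁻¹ ∈ siegelGamma n F := by
  have hinv := coe_inv_eq_fromBlocks k
  rw [mem_siegelGamma_iff] at hk ⊢
  rw [blockA, blockB, blockC, blockD, hinv, Matrix.toBlocks_fromBlocks₁₁,
    Matrix.toBlocks_fromBlocks₁₂, Matrix.toBlocks_fromBlocks₂₁, Matrix.toBlocks_fromBlocks₂₂]
  simp only [norm_neg, Matrix.norm_transpose]
  exact ⟨hk.2.2.2, hk.2.1, hk.2.2.1, hk.1⟩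

variable [IsUltrametricDist F]

theorem norm_det_blockD_eq_one (hk : k ∈ siegelGamma n F) : ‖(blockD k).det‖ = 1 := by
  obtain ⟨hA, hB, hC, hD⟩ := mem_siegelGamma_iff.mp hk
  have hA' : ‖(blockA k)ᵀ‖ ≤ 1 := (Matrix.norm_transpose _).trans_le hA
  have hC' : ‖(blockC k)ᵀ * blockB k‖ < 1 :=
    ((norm_matrix_mul_le_of_le (Matrix.norm_transpose _).le hB).trans_eq (mul_one _)).trans_lt hC
  have hAD : ‖((blockA k)ᵀ * blockD k).det - (1 : Matrix (Fin n) (Fin n) F).det‖ < 1 := by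
    refine norm_det_sub_det_lt_one
      ((norm_matrix_mul_le_of_le hA' hD).trans_eq (mul_one 1)) norm_one_matrix_le ?_
    rwa [← transpose_blockA_mul_blockD_sub k, sub_sub_cancel]
  have hprod : ‖((blockA k)ᵀ * blockD k).det‖ = 1 := by
    have h := norm_eq_of_norm_sub_lt (hAD.trans_eq (by rw [Matrix.det_one, norm_one]))
    rwa [Matrix.det_one, norm_one] at h
  rw [Matrix.det_mul, norm_mul] at hprod
  refine le_antisymm (norm_det_le_one hD) (hprod.symm.trans_le ?_)
  exact mul_le_of_le_one_left (norm_nonneg _) (norm_det_le_one hA')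

theorem mem_siegelGamma_of_norm_sub_one_lt
    (hk : ‖(k : Matrix (Fin n ⊕ Fin n) (Fin n ⊕ Fin n) F) - 1‖ < 1) : k ∈ siegelGamma n F := by
  have hle : ‖(k : Matrix (Fin n ⊕ Fin n) (Fin n ⊕ Fin n) F)‖ ≤ 1 := by
    rw [← sub_add_cancel (k : Matrix (Fin n ⊕ Fin n) (Fin n ⊕ Fin n) F) 1]
    exact norm_add_le_of_le_of_le hk.le norm_one_matrix_le
  refine ⟨norm_entry_le hle, fun i j => ?_⟩
  simpa using! norm_entry_lt hk (Sum.inr i) (Sum.inl j)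

theorem norm_det_blockD_sub_one_lt
    (hk : ‖(k : Matrix (Fin n ⊕ Fin n) (Fin n ⊕ Fin n) F) - 1‖ < 1) :
    ‖(blockD k).det - 1‖ < 1 := by
  obtain ⟨-, -, -, hD⟩ := mem_siegelGamma_iff.mp (mem_siegelGamma_of_norm_sub_one_lt hk)
  rw [← Matrix.det_one (n := Fin n)]
  refine norm_det_sub_det_lt_one hD norm_one_matrix_le
    ((Matrix.norm_lt_iff one_pos).mpr fun i j => ?_)
  simpa [blockD, Matrix.toBlocks₂₂, Matrix.one_apply] using norm_entry_lt hk (Sum.inr i) (Sum.inr j)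

end Blocks

section CellSection

variable {F : Type*} [NontriviallyNormedField F] {n : ℕ} {ω : MulChar F ℂ} {p g k : Sp n F}

/-- The open cell `P Γ` of `Sp_n(F)`. -/
def openCell (n : ℕ) (F : Type*) [NontriviallyNormedField F] : Set (Sp n F) :=
  {g | (blockD g).det ≠ 0 ∧ ‖(blockD g)⁻¹ * blockC g‖ < 1}

theorem parabolic_mul_mem_openCell_iff (hp : p ∈ siegelParabolic n F) :
    p * g ∈ openCell n F ↔ g ∈ openCell n F := by
  have hdet := right_ne_zero_of_mul_eq_one (det_blockA_mul_det_blockD hp)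
  rw [openCell, Set.mem_ofPred_eq, Set.mem_ofPred_eq, blockC_parabolic_mul hp,
    blockD_parabolic_mul hp, Matrix.det_mul, Matrix.mul_inv_rev, Matrix.mul_assoc,
    Matrix.nonsing_inv_mul_cancel_left _ _ hdet.isUnit, mul_ne_zero_iff_left hdet]

open Classical in
/-- The standard section `f₀`: it is supported on the open cell `P Γ`, where `D` determines its
value. -/
noncomputable def cellSection (ω : MulChar F ℂ) (s : ℂ) (g : Sp n F) : ℂ :=
  if g ∈ openCell n F then ω (blockD g).det * ((‖(blockD g).det‖ : ℝ) : ℂ) ^ (-s) else 0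

theorem cellSection_parabolic_mul (hω : ω ^ 2 = 1) (s : ℂ) (hp : p ∈ siegelParabolic n F) :
    cellSection ω s (p * g) =
      ω (blockA p).det * ((‖(blockA p).det‖ : ℝ) : ℂ) ^ s * cellSection ω s g := by
  by_cases hg : g ∈ openCell n F
  · have hmul := det_blockA_mul_det_blockD hp
    rw [cellSection, if_pos ((parabolic_mul_mem_openCell_iff hp).mpr hg), cellSection, if_pos hg,
      blockD_parabolic_mul hp, Matrix.det_mul, map_mul, norm_mul, Complex.ofReal_mul,
      Complex.mul_cpow_ofReal_nonneg (norm_nonneg _) (norm_nonneg _),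
      eq_inv_of_mul_eq_one_right hmul, mulChar_inv hω (left_ne_zero_of_mul_eq_one hmul), norm_inv,
      ofReal_inv_cpow (norm_nonneg _), neg_neg]
    ring
  · rw [cellSection, if_neg (mt (parabolic_mul_mem_openCell_iff hp).mp hg), cellSection,
      if_neg hg, mul_zero]

theorem blockD_mul_eq (hg : g ∈ openCell n F) :
    blockD (g * k) = blockD g * (blockD k + (blockD g)⁻¹ * blockC g * blockB k) := by
  rw [blockD_mul, Matrix.mul_add, ← Matrix.mul_assoc, ← Matrix.mul_assoc,
    Matrix.mul_nonsing_inv _ hg.1.isUnit, Matrix.one_mul, add_comm]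

theorem cellSection_weyl (s : ℂ) {i : ℕ} (hi : i ≤ n) :
    cellSection ω s (weyl n i F) = if 0 = i then 1 else 0 := by
  have hD : blockD (weyl n i F) = lowIdem n i F := Matrix.toBlocks_fromBlocks₂₂ _ _ _ _
  have hC : blockC (weyl n i F) = highIdem n i F := Matrix.toBlocks_fromBlocks₂₁ _ _ _ _
  rw [cellSection, openCell, Set.mem_ofPred_eq, hD, hC]
  split_ifs with hcell h0 h0
  · subst h0
    simp [lowIdem]
  · refine absurd ?_ hcell.1
    rw [lowIdem, Matrix.det_diagonal]
    exact Finset.prod_eq_zero (Finset.mem_univ ⟨n - i, by omega⟩) (if_neg (by simp [hi]))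
  · subst h0
    simp [lowIdem, highIdem] at hcell
  · rfl

variable [IsUltrametricDist F]

theorem norm_blockD_add_le_one (hg : g ∈ openCell n F) (hk : k ∈ siegelGamma n F) :
    ‖blockD k + (blockD g)⁻¹ * blockC g * blockB k‖ ≤ 1 := by
  obtain ⟨-, hB, -, hD⟩ := mem_siegelGamma_iff.mp hk
  exact norm_add_le_of_le_of_le hD
    ((norm_matrix_mul_le_of_le hg.2.le hB).trans_eq (mul_one 1))

theorem norm_det_blockD_add_sub_lt_one (hg : g ∈ openCell n F) (hk : k ∈ siegelGamma n F) :
    ‖(blockD k + (blockD g)⁻¹ * blockC g * blockB k).det - (blockD k).det‖ < 1 := by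
  obtain ⟨-, hB, -, hD⟩ := mem_siegelGamma_iff.mp hk
  refine norm_det_sub_det_lt_one (norm_blockD_add_le_one hg hk) hD ?_
  rw [add_sub_cancel_left]
  exact ((norm_matrix_mul_le_of_le le_rfl hB).trans_eq (mul_one _)).trans_lt hg.2

theorem norm_det_blockD_add_eq_one (hg : g ∈ openCell n F) (hk : k ∈ siegelGamma n F) :
    ‖(blockD k + (blockD g)⁻¹ * blockC g * blockB k).det‖ = 1 := by
  rw [← norm_det_blockD_eq_one hk]
  refine norm_eq_of_norm_sub_lt ?_
  rw [norm_det_blockD_eq_one hk]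
  exact norm_det_blockD_add_sub_lt_one hg hk

theorem mul_mem_openCell (hg : g ∈ openCell n F) (hk : k ∈ siegelGamma n F) :
    g * k ∈ openCell n F := by
  obtain ⟨hA, -, hC, -⟩ := mem_siegelGamma_iff.mp hk
  set E := (blockD g)⁻¹ * blockC g with hE
  have hnorm : ‖(blockD k + E * blockB k).det‖ = 1 := norm_det_blockD_add_eq_one hg hk
  have hCgk : blockC (g * k) = blockD g * (E * blockA k + blockC k) := by
    rw [blockC_mul, Matrix.mul_add, ← Matrix.mul_assoc, hE,
      Matrix.mul_nonsing_inv_cancel_left _ _ hg.1.isUnit]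
  refine ⟨?_, ?_⟩
  · rw [blockD_mul_eq hg, Matrix.det_mul]
    exact mul_ne_zero hg.1 (norm_ne_zero_iff.mp (hnorm ▸ one_ne_zero))
  · rw [blockD_mul_eq hg, hCgk, Matrix.mul_inv_rev, Matrix.mul_assoc,
      Matrix.nonsing_inv_mul_cancel_left _ _ hg.1.isUnit]
    refine ((norm_matrix_mul_le_of_le (norm_inv_le_one (norm_blockD_add_le_one hg hk) hnorm)
      le_rfl).trans_eq (one_mul _)).trans_lt (norm_add_lt_of_lt ?_ hC)
    exact ((norm_matrix_mul_le_of_le le_rfl hA).trans_eq (mul_one _)).trans_lt hg.2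

theorem mul_mem_openCell_iff (hk : k ∈ siegelGamma n F) :
    g * k ∈ openCell n F ↔ g ∈ openCell n F := by
  refine ⟨fun h => ?_, fun h => mul_mem_openCell h hk⟩
  simpa using mul_mem_openCell h (inv_mem_siegelGamma hk)

variable [CompleteSpace F]

theorem cellSection_mul (h2 : ‖(2 : F)‖ = 1) (hω : ω ^ 2 = 1) (s : ℂ)
    (hk : k ∈ siegelGamma n F) :
    cellSection ω s (g * k) = ω (blockD k).det * cellSection ω s g := by
  by_cases hg : g ∈ openCell n F
  · rw [cellSection, if_pos (mul_mem_openCell hg hk), cellSection, if_pos hg, blockD_mul_eq hg,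
      Matrix.det_mul, map_mul, norm_mul, norm_det_blockD_add_eq_one hg hk, mul_one,
      mulChar_eq_of_norm_sub_lt_one h2 hω (norm_det_blockD_eq_one hk)
        (norm_det_blockD_add_sub_lt_one hg hk)]
    ring
  · rw [cellSection, if_neg (mt (mul_mem_openCell_iff hk).mp hg), cellSection, if_neg hg, mul_zero]

theorem isLocallyConstant_cellSection (h2 : ‖(2 : F)‖ = 1) (hω : ω ^ 2 = 1) (s : ℂ) :
    IsLocallyConstant (cellSection ω s : Sp n F → ℂ) := by
  rw [IsLocallyConstant.iff_eventually_eq]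
  intro g
  have hcont : Continuous fun h : Sp n F =>
      ((g⁻¹ * h : Sp n F) : Matrix (Fin n ⊕ Fin n) (Fin n ⊕ Fin n) F) - 1 := by
    simp only [Submonoid.coe_mul]
    exact (continuous_const.matrix_mul continuous_subtype_val).sub continuous_const
  have hnear : ∀ᶠ h in 𝓝 g,
      ‖((g⁻¹ * h : Sp n F) : Matrix (Fin n ⊕ Fin n) (Fin n ⊕ Fin n) F) - 1‖ < 1 :=
    (hcont.norm.tendsto g).eventually_lt_const (by simp)
  filter_upwards [hnear] with h hh
  rw [← mul_inv_cancel_left g h, cellSection_mul h2 hω s (mem_siegelGamma_of_norm_sub_one_lt hh),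
    mulChar_eq_of_norm_sub_lt_one h2 hω norm_one (norm_det_blockD_sub_one_lt hh), map_one, one_mul]

theorem isStandardSection_cellSection (h2 : ‖(2 : F)‖ = 1) (hω : ω ^ 2 = 1) (s : ℂ) :
    IsStandardSection ω s 0 (cellSection ω s : Sp n F → ℂ) := by
  refine ⟨⟨isLocallyConstant_cellSection h2 hω s, fun p hp g => ?_,
    fun k hk g => cellSection_mul h2 hω s hk⟩, fun i hi => cellSection_weyl s hi⟩
  rw [cellSection_parabolic_mul hω s hp, sub_add_cancel]

end CellSection

section Values

variable {F : Type*} [NontriviallyNormedField F] {n : ℕ}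

theorem coe_weyl_mul_unipotent (X : SymMat n F) :
    ((weyl n n F * unipotent X : Sp n F) : Matrix (Fin n ⊕ Fin n) (Fin n ⊕ Fin n) F) =
      Matrix.fromBlocks 0 (-1) 1 X.1 := by
  simp [weyl, unipotent, lowIdem, highIdem, Matrix.fromBlocks_multiply]

theorem continuous_weyl_mul_unipotent :
    Continuous fun X : SymMat n F => weyl n n F * unipotent X := by
  refine continuous_induced_rng.mpr ?_
  rw [show Subtype.val ∘ (fun X : SymMat n F => weyl n n F * unipotent X) =
    fun X => Matrix.fromBlocks 0 (-1) 1 X.1 from funext coe_weyl_mul_unipotent]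
  exact continuous_const.matrix_fromBlocks continuous_const continuous_const
    continuous_subtype_val

/-- The element `(γ, 0; 0, ᵗγ⁻¹)` of the Levi subgroup of `P`. -/
noncomputable def levi {γ : Matrix (Fin n) (Fin n) F} (hγ : IsUnit γ.det) : Sp n F :=
  ⟨Matrix.fromBlocks γ 0 0 γ⁻¹ᵀ, by
    rw [SymplecticGroup.fromBlocks_mem_iff]
    simp [← Matrix.transpose_mul, Matrix.nonsing_inv_mul _ hγ]⟩

/-- The element `(1, 0; W, 1)` of `Sp_n(F)`. -/
def lowerUnipotent (W : SymMat n F) : Sp n F :=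
  ⟨Matrix.fromBlocks 1 0 W.1 1, by
    rw [SymplecticGroup.fromBlocks_mem_iff]
    simp [show W.1ᵀ = W.1 from W.2]⟩

theorem unipotent_mem_siegelGamma {X : SymMat n F} (hX : ‖X.1‖ ≤ 1) :
    unipotent X ∈ siegelGamma n F := by
  refine mem_siegelGamma_iff.mpr ⟨norm_one_matrix_le, hX, ?_, norm_one_matrix_le⟩
  exact norm_zero.trans_lt one_pos

theorem lowerUnipotent_mem_siegelGamma {W : SymMat n F} (hW : ‖W.1‖ < 1) :
    lowerUnipotent W ∈ siegelGamma n F :=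
  mem_siegelGamma_iff.mpr
    ⟨norm_one_matrix_le, norm_zero.trans_le zero_le_one, hW, norm_one_matrix_le⟩

theorem levi_mem_siegelGamma [IsUltrametricDist F] {γ : Matrix (Fin n) (Fin n) F}
    (hγ : ‖γ‖ ≤ 1) (hdet : ‖γ.det‖ = 1) :
    levi (isUnit_det_of_norm_eq_one hdet) ∈ siegelGamma n F :=
  mem_siegelGamma_iff.mpr ⟨hγ, norm_zero.trans_le zero_le_one, norm_zero.trans_lt one_pos,
    (Matrix.norm_transpose _).trans_le (norm_inv_le_one hγ hdet)⟩

theorem lowIdem_add_highIdem (n i : ℕ) : lowIdem n i F + highIdem n i F = 1 := by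
  rw [lowIdem, highIdem, Matrix.diagonal_add, ← Matrix.diagonal_one]
  congr 1
  funext j
  split_ifs <;> simp

theorem lowIdem_mul_self (n i : ℕ) : lowIdem n i F * lowIdem n i F = lowIdem n i F := by
  simp [lowIdem]

theorem highIdem_mul_lowIdem (n i : ℕ) : highIdem n i F * lowIdem n i F = 0 := by
  rw [lowIdem, highIdem, Matrix.diagonal_mul_diagonal, ← Matrix.diagonal_zero]
  congr 1
  funext j
  split_ifs <;> simp

theorem lowIdem_mul_highIdem (n i : ℕ) : lowIdem n i F * highIdem n i F = 0 := by
  rw [← highIdem_mul_lowIdem n i, lowIdem, highIdem, Matrix.diagonal_mul_diagonal,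
    Matrix.diagonal_mul_diagonal]
  simp only [mul_comm]

theorem highIdem_mul_self (n i : ℕ) : highIdem n i F * highIdem n i F = highIdem n i F := by
  simp [highIdem]

theorem isSymm_lowIdem (n i : ℕ) : (lowIdem n i F).IsSymm := Matrix.diagonal_transpose _

theorem isSymm_highIdem (n i : ℕ) : (highIdem n i F).IsSymm := Matrix.diagonal_transpose _

theorem isSymm_mul_of_commute {E M : Matrix (Fin n) (Fin n) F} (hE : E.IsSymm) (hM : M.IsSymm)
    (hEM : Commute E M) : (E * M).IsSymm := by
  rw [Matrix.IsSymm, Matrix.transpose_mul, hE, hM, hEM.eq]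

theorem commute_highIdem {i : ℕ} {M : Matrix (Fin n) (Fin n) F}
    (hM : Commute (lowIdem n i F) M) : Commute (highIdem n i F) M := by
  rw [← add_sub_cancel_left (lowIdem n i F) (highIdem n i F), lowIdem_add_highIdem]
  exact (Commute.one_left M).sub_left hM

theorem commute_inv {E M : Matrix (Fin n) (Fin n) F} (hM : IsUnit M.det) (hEM : Commute E M) :
    Commute E M⁻¹ := by
  rw [Commute, SemiconjBy, ← Matrix.mul_nonsing_inv_cancel_right M (M⁻¹ * E) hM,
    Matrix.mul_assoc M⁻¹, hEM.eq, Matrix.nonsing_inv_mul_cancel_left M E hM]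

section Factorization

variable {i : ℕ} {Y : Matrix (Fin n) (Fin n) F}

theorem lowIdem_mul_inv_add_highIdem_mul (hY : IsUnit Y.det)
    (hcomm : Commute (lowIdem n i F) Y) :
    (lowIdem n i F * Y⁻¹ + highIdem n i F) * (lowIdem n i F * Y + highIdem n i F) = 1 := by
  have hcomm' := commute_inv hY hcomm
  have hlow : lowIdem n i F * Y⁻¹ * (lowIdem n i F * Y) = lowIdem n i F := by
    rw [hcomm'.eq, mul_assoc, ← mul_assoc _ _ Y, lowIdem_mul_self, ← mul_assoc, ← hcomm'.eq,
      Matrix.nonsing_inv_mul_cancel_right Y _ hY]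
  have hlow_high : lowIdem n i F * Y⁻¹ * highIdem n i F = 0 := by
    rw [hcomm'.eq, mul_assoc, lowIdem_mul_highIdem, mul_zero]
  have hhigh_low : highIdem n i F * (lowIdem n i F * Y) = 0 := by
    rw [← mul_assoc, highIdem_mul_lowIdem, zero_mul]
  rw [add_mul, mul_add, mul_add, hlow, hlow_high, hhigh_low, highIdem_mul_self, add_zero,
    zero_add, lowIdem_add_highIdem]

theorem isUnit_det_lowIdem_mul_inv_add_highIdem (hY : IsUnit Y.det)
    (hcomm : Commute (lowIdem n i F) Y) :
    IsUnit (lowIdem n i F * Y⁻¹ + highIdem n i F).det :=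
  Matrix.isUnit_det_of_right_inverse (lowIdem_mul_inv_add_highIdem_mul hY hcomm)

theorem unipotent_mul_weyl_mul_unipotent {Y W R : SymMat n F} (hY : IsUnit Y.1.det)
    (hcomm : Commute (lowIdem n i F) Y.1) (hW : W.1 = lowIdem n i F * Y.1⁻¹)
    (hR : R.1 = highIdem n i F * Y.1) :
    unipotent W * (weyl n n F * unipotent Y) =
      levi (isUnit_det_lowIdem_mul_inv_add_highIdem hY hcomm) *
        (weyl n i F * lowerUnipotent W) * unipotent R := by
  have hlow : lowIdem n i F * W.1 = W.1 := by rw [hW, ← mul_assoc, lowIdem_mul_self]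
  have hlow' : W.1 * lowIdem n i F = W.1 := by
    rw [hW, (commute_inv hY hcomm).eq, mul_assoc, lowIdem_mul_self]
  have hhigh : highIdem n i F * W.1 = 0 := by
    rw [← hlow, ← mul_assoc, highIdem_mul_lowIdem, zero_mul]
  have hhigh' : W.1 * highIdem n i F = 0 := by
    rw [← hlow', mul_assoc, lowIdem_mul_highIdem, mul_zero]
  have hWY : W.1 * Y.1 = lowIdem n i F := by rw [hW, Matrix.nonsing_inv_mul_cancel_right _ _ hY]
  have hinv : (W.1 + highIdem n i F)⁻¹ = lowIdem n i F * Y.1 + highIdem n i F := by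
    rw [hW]
    exact Matrix.inv_eq_right_inv (lowIdem_mul_inv_add_highIdem_mul hY hcomm)
  have hsymm : (lowIdem n i F * Y.1 + highIdem n i F)ᵀ = lowIdem n i F * Y.1 + highIdem n i F :=
    (isSymm_mul_of_commute (isSymm_lowIdem n i) Y.2 hcomm).add (isSymm_highIdem n i)
  have hYlow : lowIdem n i F * Y.1 * lowIdem n i F = lowIdem n i F * Y.1 := by
    rw [mul_assoc, ← hcomm.eq, ← mul_assoc, lowIdem_mul_self]
  have hYhigh : lowIdem n i F * Y.1 * highIdem n i F = 0 := by
    rw [mul_assoc, ← (commute_highIdem hcomm).eq, ← mul_assoc, lowIdem_mul_highIdem, zero_mul]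
  have hYW : lowIdem n i F * Y.1 * W.1 = lowIdem n i F := by
    rw [hW, ← mul_assoc, hYlow, Matrix.mul_nonsing_inv_cancel_right _ _ hY]
  have hsum := lowIdem_add_highIdem (F := F) n i
  refine Subtype.ext ?_
  rw [Submonoid.coe_mul, coe_weyl_mul_unipotent]
  simp only [Submonoid.coe_mul, weyl, lowerUnipotent, unipotent, levi, ← hW, hinv, hsymm, hR,
    Matrix.fromBlocks_multiply, Matrix.fromBlocks_inj]
  simp only [mul_zero, zero_mul, mul_one, one_mul, zero_add, add_zero, mul_neg, neg_mul, mul_add,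
    add_mul, neg_zero, ← mul_assoc, hlow, hlow', hhigh, hhigh', hWY, hYlow, hYhigh, hYW,
    highIdem_mul_self, highIdem_mul_lowIdem, lowIdem_mul_highIdem]
  refine ⟨trivial, ?_, ?_, ?_⟩
  · rw [← hsum, neg_add_rev, neg_add_cancel_right]
  · rw [add_comm, hsum]
  · rw [← add_mul, add_comm, hsum, one_mul]

end Factorization

section StandardSection

variable {ω : MulChar F ℂ} {s : ℂ} {f : Sp n F → ℂ} {i : ℕ} {X Y : SymMat n F}

namespace IsStandardSection

theorem apply_mul_of_blockD_eq_one {k : Sp n F} (hf : IsStandardSection ω s 0 f)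
    (hk : k ∈ siegelGamma n F) (hD : blockD k = 1) (g : Sp n F) : f (g * k) = f g := by
  rw [hf.1.right k hk, hD, Matrix.det_one, map_one, one_mul]

theorem apply_unipotent_mul (hf : IsStandardSection ω s 0 f) (X : SymMat n F) (g : Sp n F) :
    f (unipotent X * g) = f g := by
  have hA : blockA (unipotent X) = 1 := Matrix.toBlocks_fromBlocks₁₁ _ _ _ _
  rw [hf.1.left _ (Matrix.toBlocks_fromBlocks₂₁ _ _ _ _), hA, Matrix.det_one]
  simp

theorem apply_levi_mul {γ : Matrix (Fin n) (Fin n) F} (hf : IsStandardSection ω s 0 f)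
    (hγ : IsUnit γ.det) (g : Sp n F) :
    f (levi hγ * g) = ω γ.det * ((‖γ.det‖ : ℝ) : ℂ) ^ s * f g := by
  have hA : blockA (levi hγ) = γ := Matrix.toBlocks_fromBlocks₁₁ _ _ _ _
  rw [hf.1.left _ (Matrix.toBlocks_fromBlocks₂₁ _ _ _ _), hA, sub_add_cancel]

theorem apply_mul_mul_transpose [IsUltrametricDist F] {γ : Matrix (Fin n) (Fin n) F}
    (hf : IsStandardSection ω s 0 f) (hγ : ‖γ‖ ≤ 1) (hdet : ‖γ.det‖ = 1)
    (hY : Y.1 = γ * X.1 * γᵀ) :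
    f (weyl n n F * unipotent Y) = f (weyl n n F * unipotent X) := by
  have hu := isUnit_det_of_norm_eq_one hdet
  have hdet' : γ⁻¹.det = γ.det⁻¹ := by rw [Matrix.det_nonsing_inv, Ring.inverse_eq_inv']
  have hdet_inv : ‖γ⁻¹.det‖ = 1 := by rw [hdet', norm_inv, hdet, inv_one]
  have hui := isUnit_det_of_norm_eq_one hdet_inv
  have hut : IsUnit γᵀ.det := by rwa [Matrix.det_transpose]
  have hfactor : levi hut * (weyl n n F * unipotent Y) =
      weyl n n F * unipotent X * levi hui := by
    refine Subtype.ext ?_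
    change (levi hut).1 * (weyl n n F * unipotent Y).1 =
      (weyl n n F * unipotent X).1 * (levi hui).1
    rw [coe_weyl_mul_unipotent, coe_weyl_mul_unipotent, hY, levi, levi,
      Matrix.fromBlocks_multiply, Matrix.fromBlocks_multiply]
    simp [Matrix.nonsing_inv_nonsing_inv _ hu, Matrix.transpose_nonsing_inv, ← mul_assoc,
      Matrix.nonsing_inv_mul _ hu]
  have hD : blockD (levi hui) = γᵀ := (Matrix.toBlocks_fromBlocks₂₂ _ _ _ _).trans
    (by rw [Matrix.nonsing_inv_nonsing_inv _ hu])
  have happly := congrArg f hfactor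
  rw [apply_levi_mul hf, hf.1.right _ (levi_mem_siegelGamma (norm_inv_le_one hγ hdet) hdet_inv),
    hD, Matrix.det_transpose, hdet, Complex.ofReal_one, Complex.one_cpow, mul_one] at happly
  exact mul_left_cancel₀ ((hu.map ω).ne_zero) happly

theorem apply_of_commute (hf : IsStandardSection ω s 0 f) (hY : IsUnit Y.1.det)
    (hcomm : Commute (lowIdem n i F) Y.1) (hlow : ‖lowIdem n i F * Y.1⁻¹‖ < 1)
    (hhigh : ‖highIdem n i F * Y.1‖ ≤ 1) :
    f (weyl n n F * unipotent Y) = ω (lowIdem n i F * Y.1⁻¹ + highIdem n i F).det *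
      ((‖(lowIdem n i F * Y.1⁻¹ + highIdem n i F).det‖ : ℝ) : ℂ) ^ s * f (weyl n i F) := by
  have hinv : Y.1⁻¹.IsSymm := by rw [Matrix.IsSymm, Matrix.transpose_nonsing_inv, Y.2]
  let W : SymMat n F := ⟨lowIdem n i F * Y.1⁻¹,
    isSymm_mul_of_commute (isSymm_lowIdem n i) hinv (commute_inv hY hcomm)⟩
  let R : SymMat n F := ⟨highIdem n i F * Y.1,
    isSymm_mul_of_commute (isSymm_highIdem n i) Y.2 (commute_highIdem hcomm)⟩
  have hR := unipotent_mem_siegelGamma (X := R) hhigh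
  have hW := lowerUnipotent_mem_siegelGamma (W := W) hlow
  rw [← apply_unipotent_mul hf W,
    unipotent_mul_weyl_mul_unipotent hY hcomm (W := W) (R := R) rfl rfl,
    apply_mul_of_blockD_eq_one hf hR (Matrix.toBlocks_fromBlocks₂₂ _ _ _ _), apply_levi_mul hf,
    apply_mul_of_blockD_eq_one hf hW (Matrix.toBlocks_fromBlocks₂₂ _ _ _ _)]

theorem apply_of_norm_inv_lt_one (hf : IsStandardSection ω s 0 f) (hY : IsUnit Y.1.det)
    (hinv : ‖Y.1⁻¹‖ < 1) : f (weyl n n F * unipotent Y) =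
      ω Y.1⁻¹.det * ((‖Y.1⁻¹.det‖ : ℝ) : ℂ) ^ s := by
  have hlow : lowIdem n 0 F = 1 := by simp [lowIdem]
  have hhigh : highIdem n 0 F = 0 := by simp [highIdem]
  have h := apply_of_commute (i := 0) hf hY (hlow ▸ Commute.one_left _)
    (by rwa [hlow, one_mul]) (by rw [hhigh, zero_mul, norm_zero]; exact zero_le_one)
  rwa [hlow, hhigh, one_mul, add_zero, hf.2 0 (Nat.zero_le n), if_pos rfl, mul_one] at h

end IsStandardSection

theorem exists_perm_lt_iff (p : Fin n → Prop) :
    ∃ (m : ℕ) (ρ : Equiv.Perm (Fin n)), m ≤ n ∧ ∀ k : Fin n, (k : ℕ) < m ↔ p (ρ k) := by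
  classical
  have hm : Fintype.card {k // p k} ≤ n := (Fintype.card_subtype_le p).trans_eq (Fintype.card_fin n)
  let e : {k : Fin n // (k : ℕ) < Fintype.card {k // p k}} ≃ {k // p k} :=
    Fintype.equivOfCardEq (Fintype.card_fin_lt_of_le hm)
  exact ⟨_, e.extendSubtype, hm, fun k => ⟨e.extendSubtype_mem k,
    fun hk => by_contra fun hk' => e.extendSubtype_not_mem k hk' hk⟩⟩

theorem IsStandardSection.apply_eq_zero [IsUltrametricDist F] {p : Fin n → Prop}
    (hf : IsStandardSection ω s 0 f) (hX : IsUnit X.1.det) (hp : ∃ k, ¬ p k)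
    (hblock : ∀ k l, X.1 k l ≠ 0 → (p k ↔ p l)) (hinv : ∀ k, p k → ∀ l, ‖X.1⁻¹ k l‖ < 1)
    (hint : ∀ k, ¬ p k → ∀ l, ‖X.1 k l‖ ≤ 1) : f (weyl n n F * unipotent X) = 0 := by
  obtain ⟨m, ρ, hmn, hρ⟩ := exists_perm_lt_iff p
  have hm : m ≠ n := by
    rintro rfl
    obtain ⟨k, hk⟩ := hp
    exact hk (by simpa using (hρ (ρ.symm k)).mp (ρ.symm k).2)
  have hρ' (k : Fin n) : (k : ℕ) + (n - m) < n ↔ p (ρ k) := by rw [← hρ]; omega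
  let Y : SymMat n F := ⟨X.1.submatrix ρ ρ, X.2.submatrix ρ⟩
  have hYinv : Y.1⁻¹ = X.1⁻¹.submatrix ρ ρ := Matrix.inv_submatrix_equiv _ _ _
  have hYdet : IsUnit Y.1.det := by rwa [Matrix.det_submatrix_equiv_self]
  have hYX : Y.1 = ρ.permMatrix F * X.1 * (ρ.permMatrix F)ᵀ := by
    rw [Equiv.Perm.permMatrix, ← PEquiv.toMatrix_symm, ← Equiv.toPEquiv_symm,
      PEquiv.toMatrix_toPEquiv_mul, PEquiv.mul_toMatrix_toPEquiv]
    rfl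
  rw [← apply_mul_mul_transpose hf (norm_permMatrix_le_one ρ) (norm_det_permMatrix ρ) hYX,
    apply_of_commute (i := n - m) hf hYdet ?_ ?_ ?_, hf.2 _ (Nat.sub_le n m),
    if_neg (by omega), mul_zero]
  · ext k l
    have hYkl : Y.1 k l = X.1 (ρ k) (ρ l) := rfl
    by_cases hkl : X.1 (ρ k) (ρ l) = 0
    · simp only [lowIdem, Matrix.diagonal_mul, Matrix.mul_diagonal, hYkl, hkl, mul_zero, zero_mul]
    · have hkl' : (k : ℕ) + (n - m) < n ↔ (l : ℕ) + (n - m) < n := by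
        rw [hρ', hρ', hblock _ _ hkl]
      simp only [lowIdem, Matrix.diagonal_mul, Matrix.mul_diagonal, hkl', mul_comm (Y.1 k l)]
  · refine (Matrix.norm_lt_iff one_pos).mpr fun k l => ?_
    simp only [lowIdem, Matrix.diagonal_mul, hYinv, Matrix.submatrix_apply]
    split_ifs with hk
    · simpa only [one_mul] using hinv _ ((hρ' k).mp hk) _
    · simp only [zero_mul, norm_zero, one_pos]
  · refine (Matrix.norm_le_iff zero_le_one).mpr fun k l => ?_
    have hYkl : Y.1 k l = X.1 (ρ k) (ρ l) := rfl
    simp only [highIdem, Matrix.diagonal_mul, hYkl]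
    split_ifs with hk
    · simp only [zero_mul, norm_zero, zero_le_one]
    · simpa only [one_mul] using hint _ (mt (hρ' k).mpr hk) _

end StandardSection

end Values

section OrbitValues

variable {F : Type*} [NontriviallyNormedField F] {n : ℕ} {ϖ δ : F} {ω : MulChar F ℂ} {s : ℂ}
  {f : Sp n F → ℂ} {x : Equiv.Perm (Fin n) × (Fin n → ℤ) × (Fin n → F)} {X : SymMat n F}

theorem Lam.norm_repS_apply_le (hδ : IsNonsquareUnit δ) (hx : x ∈ Lam n δ) (k l : Fin n) :
    ‖repS ϖ x k l‖ ≤ ‖ϖ‖ ^ x.2.1 k := by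
  rw [← norm_repCoeff hδ hx]
  change ‖if k = x.1 l then repCoeff ϖ x k else 0‖ ≤ _
  split_ifs
  · exact le_rfl
  · exact norm_zero.trans_le (norm_nonneg _)

theorem Lam.zpow_le_norm_repS (hδ : IsNonsquareUnit δ) (hx : x ∈ Lam n δ) (i : Fin n) :
    ‖ϖ‖ ^ x.2.1 i ≤ ‖repS ϖ x‖ := by
  have hentry : repS ϖ x i (x.1 i) = repCoeff ϖ x i := if_pos ((eq_apply_iff hx).mpr rfl)
  rw [← norm_repCoeff hδ hx, ← hentry]
  exact norm_entry_le le_rfl i (x.1 i)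

theorem norm_zpow_lt_one_iff (hϖ : IsUniformizer ϖ) {h : ℤ} : ‖ϖ‖ ^ (-h) < 1 ↔ h ≤ -1 := by
  rw [zpow_lt_one_iff_right_of_lt_one₀ hϖ.norm_pos hϖ.norm_lt_one]
  omega

theorem one_le_norm_det_repS (hϖ : IsUniformizer ϖ) (hδ : IsNonsquareUnit δ)
    (hx : x ∈ LamNeg n δ) : 1 ≤ ‖(repS ϖ x).det‖ := by
  rw [Lam.norm_det_repS hδ hx.1]
  refine Finset.prod_induction _ (1 ≤ ·) (fun _ _ => one_le_mul_of_one_le_of_one_le) le_rfl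
    fun i _ => one_le_zpow_of_nonpos₀ hϖ.norm_pos hϖ.norm_lt_one.le ?_
  exact (hx.2 i).trans (by norm_num)

variable [IsUltrametricDist F]

theorem Lam.norm_inv_repS_apply_le (hϖ : IsUniformizer ϖ) (hδ : IsNonsquareUnit δ)
    (hx : x ∈ Lam n δ) (k l : Fin n) : ‖(repS ϖ x)⁻¹ k l‖ ≤ ‖ϖ‖ ^ (-x.2.1 k) := by
  have hmul := congrFun₂ (Matrix.mul_nonsing_inv _ (det_repS_ne_zero hϖ hδ hx).isUnit) (x.1 k) l
  rw [repS_mul_apply hx, involutive hx, repCoeff_apply hx] at hmul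
  have hcoeff : repCoeff ϖ x k ≠ 0 :=
    norm_ne_zero_iff.mp (norm_repCoeff hδ hx k ▸ zpow_ne_zero _ hϖ.norm_pos.ne')
  rw [← inv_mul_cancel_left₀ hcoeff ((repS ϖ x)⁻¹ k l), hmul, norm_mul, norm_inv,
    norm_repCoeff hδ hx, ← _root_.zpow_neg]
  exact mul_le_of_le_one_right (zpow_nonneg (norm_nonneg _) _)
    (norm_entry_le norm_one_matrix_le _ _)

namespace IsStandardSection

theorem apply_of_mem_orbit (hω : ω ^ 2 = 1) (hϖ : IsUniformizer ϖ) (hδ : IsNonsquareUnit δ)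
    (hf : IsStandardSection ω s 0 f) (hx : x ∈ LamNeg n δ) (hX : X.1 ∈ orbit ϖ x) :
    f (weyl n n F * unipotent X) =
      ω (repS ϖ x).det * ((‖(repS ϖ x).det‖ : ℝ) : ℂ) ^ (-s) := by
  obtain ⟨γ, hγ, hγX⟩ := hX
  have hdet := Lam.det_repS_ne_zero hϖ hδ hx.1
  have hinv : ‖(repS ϖ x)⁻¹‖ < 1 := (Matrix.norm_lt_iff one_pos).mpr fun k l =>
    (Lam.norm_inv_repS_apply_le hϖ hδ hx.1 k l).trans_lt ((norm_zpow_lt_one_iff hϖ).mpr (hx.2 k))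
  let S : SymMat n F := ⟨repS ϖ x, Lam.isSymm_repS hx.1⟩
  rw [apply_mul_mul_transpose (X := S) hf (norm_le_one_of_mem_Gamma0 hγ) hγ.2.1 hγX,
    apply_of_norm_inv_lt_one hf (Y := S) hdet.isUnit hinv]
  change ω (repS ϖ x)⁻¹.det * ((‖(repS ϖ x)⁻¹.det‖ : ℝ) : ℂ) ^ s = _
  rw [Matrix.det_nonsing_inv, Ring.inverse_eq_inv', mulChar_inv hω hdet, norm_inv,
    ofReal_inv_cpow (norm_nonneg _)]

theorem apply_of_mem_orbit_of_notMem (hϖ : IsUniformizer ϖ) (hδ : IsNonsquareUnit δ)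
    (hf : IsStandardSection ω s 0 f) (hx : x ∈ Lam n δ) (hneg : x ∉ LamNeg n δ)
    (hX : X.1 ∈ orbit ϖ x) : f (weyl n n F * unipotent X) = 0 := by
  obtain ⟨γ, hγ, hγX⟩ := hX
  rw [apply_mul_mul_transpose (X := ⟨repS ϖ x, Lam.isSymm_repS hx⟩) hf
    (norm_le_one_of_mem_Gamma0 hγ) hγ.2.1 hγX]
  refine apply_eq_zero (p := fun k => x.2.1 k ≤ -1) hf (Lam.det_repS_ne_zero hϖ hδ hx).isUnit
    (not_forall.mp fun h => hneg ⟨hx, h⟩) (fun k l hkl => ?_)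
    (fun k hk l => (Lam.norm_inv_repS_apply_le hϖ hδ hx k l).trans_lt
      ((norm_zpow_lt_one_iff hϖ).mpr hk))
    (fun k hk l => (Lam.norm_repS_apply_le hδ hx k l).trans
      (zpow_le_one₀ hϖ.norm_pos hϖ.norm_lt_one.le (by omega)))
  obtain rfl : k = x.1 l := by_contra fun h => hkl (if_neg h)
  rw [hx.2.1]

end IsStandardSection

end OrbitValues

section Degenerate

variable {F : Type*} [NontriviallyNormedField F] {n : ℕ}

theorem frequently_det_ne_zero (X : SymMat n F) : ∃ᶠ Y in 𝓝 X, Y.1.det ≠ 0 := by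
  let T (t : F) : SymMat n F := ⟨X.1 + t • 1, X.2.add (Matrix.isSymm_one.smul t)⟩
  have hT : Tendsto T (𝓝[≠] 0) (𝓝 X) := by
    have hcont : Continuous T :=
      continuous_induced_rng.mpr (continuous_const.add (continuous_id.smul continuous_const))
    have hT0 : T 0 = X := Subtype.ext (by simp [T])
    exact hT0 ▸ (hcont.tendsto 0).mono_left nhdsWithin_le_nhds
  have hdet (t : F) : (T t).1.det = (-X.1).charpoly.eval t := by
    rw [Matrix.eval_charpoly, sub_neg_eq_add, add_comm]
    simp [T, Matrix.smul_one_eq_diagonal, Matrix.scalar_apply]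
  have hfin : {t | (-X.1).charpoly.IsRoot t}.Finite :=
    Polynomial.finite_setOfPred_isRoot (Matrix.charpoly_monic _).ne_zero
  have hne : ∀ᶠ t in 𝓝[≠] (0 : F), (T t).1.det ≠ 0 := by
    filter_upwards [nhdsNE_le_cofinite 0 hfin.compl_mem_cofinite] with t ht
    rwa [hdet]
  exact hT.frequently hne.frequently

theorem IsStandardSection.apply_eq_zero_of_det_eq_zero [IsUltrametricDist F] [CompleteSpace F]
    {ϖ δ : F} {ω : MulChar F ℂ} {s : ℂ} {f : Sp n F → ℂ} {X : SymMat n F} (h2 : ‖(2 : F)‖ = 1)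
    (hϖ : IsUniformizer ϖ) (hδ : IsNonsquareUnit δ) (hf : IsStandardSection ω s 0 f)
    (hdet : X.1.det = 0) : f (weyl n n F * unipotent X) = 0 := by
  have hconst : ∀ᶠ Y in 𝓝 X, f (weyl n n F * unipotent Y) = f (weyl n n F * unipotent X) :=
    continuous_weyl_mul_unipotent.continuousAt.eventually
      ((IsLocallyConstant.iff_eventually_eq f).mp hf.1.smooth _)
  have hsmall : ∀ᶠ Y in 𝓝 X, ‖Y.1.det‖ < 1 := by
    have hcont : Continuous fun Y : SymMat n F => ‖Y.1.det‖ :=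
      (Continuous.matrix_det continuous_subtype_val).norm
    have hX : ‖X.1.det‖ < 1 := by rw [hdet, norm_zero]; exact one_pos
    exact hcont.continuousAt.eventually_lt_const hX
  obtain ⟨Y, hY, hYconst, hYdet⟩ :=
    ((frequently_det_ne_zero X).and_eventually (hconst.and hsmall)).exists
  obtain ⟨x, hx, hYx⟩ := exists_mem_orbit h2 hϖ hδ Y.2 hY
  have hneg : x ∉ LamNeg n δ := fun hneg =>
    (one_le_norm_det_repS hϖ hδ hneg).not_gt (hYx.norm_det ▸ hYdet)
  rw [← hYconst, apply_of_mem_orbit_of_notMem hϖ hδ hf hx hneg hYx]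

end Degenerate

/-! ### Vanishing of the character sums -/

section Oscillation

variable {G : Type*} [AddGroup G] [MeasurableSpace G] [MeasurableAdd₂ G] {μ : Measure G}
  [μ.IsAddRightInvariant]

theorem setIntegral_add_right {A : Set G} (hA : MeasurableSet A) (φ : G → ℂ) {M : G}
    (hM : ∀ γ, γ + M ∈ A ↔ γ ∈ A) : ∫ γ in A, φ (γ + M) ∂μ = ∫ γ in A, φ γ ∂μ := by
  rw [← integral_indicator hA, ← integral_indicator hA,
    ← integral_add_right_eq_self (A.indicator φ) M]
  refine integral_congr_ae (Eventually.of_forall fun γ => ?_)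
  change A.indicator (fun γ => φ (γ + M)) γ = A.indicator φ (γ + M)
  by_cases h : γ ∈ A
  · rw [Set.indicator_of_mem h, Set.indicator_of_mem ((hM γ).mpr h)]
  · rw [Set.indicator_of_notMem h, Set.indicator_of_notMem (mt (hM γ).mp h)]

theorem setIntegral_eq_zero_of_oscillation {A : Set G} {L : AddSubgroup G}
    (hA : MeasurableSet A) (hL : MeasurableSet (L : Set G)) (hAfin : μ A ≠ ⊤) (hLfin : μ L ≠ ⊤)
    (hL0 : μ L ≠ 0) (hAL : ∀ γ ∈ A, ∀ M ∈ L, γ + M ∈ A) {φ : G → ℂ} (hφ : Measurable φ)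
    (hφ1 : ∀ γ, ‖φ γ‖ ≤ 1)
    (hosc : ∀ γ ∈ A, ∃ M₀ ∈ L, ∃ c : ℂ, c ≠ 1 ∧ ∀ M ∈ L, φ (γ + (M + M₀)) = c * φ (γ + M)) :
    ∫ γ in A, φ γ ∂μ = 0 := by
  have : IsFiniteMeasure (μ.restrict A) := isFiniteMeasure_restrict.mpr hAfin
  have : IsFiniteMeasure (μ.restrict L) := isFiniteMeasure_restrict.mpr hLfin
  have hinner (γ) (hγ : γ ∈ A) : ∫ M in L, φ (γ + M) ∂μ = 0 := by
    obtain ⟨M₀, hM₀, c, hc, hφc⟩ := hosc γ hγ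
    have hshift := setIntegral_add_right (μ := μ) hL (fun M => φ (γ + M)) (M := M₀)
      fun M => L.add_mem_cancel_right hM₀
    rw [setIntegral_congr_fun hL hφc, integral_const_mul] at hshift
    exact (mul_left_eq_self₀.mp hshift).resolve_left hc
  have hA_add (M) (hM : M ∈ L) (γ) : γ + M ∈ A ↔ γ ∈ A :=
    ⟨fun h => by simpa using hAL _ h _ (L.neg_mem hM), fun h => hAL _ h _ hM⟩
  have hint : Integrable (Function.uncurry fun γ M => φ (γ + M))
      ((μ.restrict A).prod (μ.restrict L)) :=
    Integrable.of_bound (hφ.comp measurable_add).aestronglyMeasurable 1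
      (Eventually.of_forall fun _ => hφ1 _)
  have hswap := integral_integral_swap hint
  rw [setIntegral_congr_fun hA hinner,
    setIntegral_congr_fun hL fun M hM => setIntegral_add_right hA φ (hA_add M hM),
    integral_zero, setIntegral_const] at hswap
  exact (smul_eq_zero.mp hswap.symm).resolve_left (ENNReal.toReal_ne_zero.mpr ⟨hL0, hLfin⟩)

end Oscillation

theorem trace_quadratic_add {R : Type*} [CommRing R] {n : ℕ} {S B : Matrix (Fin n) (Fin n) R}
    (hS : S.IsSymm) (hB : B.IsSymm) (γ M : Matrix (Fin n) (Fin n) R) :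
    (S * ((γ + M)ᵀ * B * (γ + M))).trace =
      (S * (γᵀ * B * γ)).trace + 2 * (S * γᵀ * B * M).trace + (S * (Mᵀ * B * M)).trace := by
  have hcross : (S * (Mᵀ * B * γ)).trace = (S * γᵀ * B * M).trace := by
    rw [← Matrix.trace_transpose, Matrix.transpose_mul, Matrix.transpose_mul, Matrix.transpose_mul,
      Matrix.transpose_transpose, hS.eq, hB.eq, Matrix.trace_mul_comm]
    simp only [Matrix.mul_assoc]
  have hexpand : S * ((γ + M)ᵀ * B * (γ + M)) = S * (γᵀ * B * γ) + S * (Mᵀ * B * γ) +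
      S * γᵀ * B * M + S * (Mᵀ * B * M) := by
    rw [Matrix.transpose_add]
    noncomm_ring
  rw [hexpand, Matrix.trace_add, Matrix.trace_add, Matrix.trace_add, hcross]
  ring

section CharSum

variable {F : Type*} [NontriviallyNormedField F] [IsUltrametricDist F] {n : ℕ} {ϖ : 𝒪[F]}
  {ψ : AddChar F Circle} {S B : Matrix (Fin n) (Fin n) F}

theorem HasOrderZero.continuous (hψ : HasOrderZero ϖ ψ) : Continuous fun x => (ψ x : ℂ) := by
  refine continuous_iff_continuousAt.mpr fun x =>
    continuousAt_const.congr (f := fun _ => (ψ x : ℂ)) ?_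
  filter_upwards [Metric.closedBall_mem_nhds x one_pos] with y hy
  rw [← sub_add_cancel y x, AddChar.map_add_eq_mul, hψ.eq_one (mem_closedBall_iff_norm.mp hy),
    one_mul]

theorem norm_trace_le (M : Matrix (Fin n) (Fin n) F) : ‖M.trace‖ ≤ ‖M‖ :=
  IsUltrametricDist.norm_sum_le_of_forall_le_of_nonneg (norm_nonneg M) fun i _ =>
    norm_entry_le le_rfl i i

theorem HasOrderZero.apply_trace_quadratic_add (hψ : HasOrderZero ϖ ψ) (hS : S.IsSymm)
    (hB : B.IsSymm) {c : ℝ} (hc : ‖S‖ * ‖B‖ * c ^ 2 ≤ 1) (γ : Matrix (Fin n) (Fin n) F)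
    {M : Matrix (Fin n) (Fin n) F} (hM : ‖M‖ ≤ c) :
    ψ (-(S * ((γ + M)ᵀ * B * (γ + M))).trace) =
      ψ (-(S * (γᵀ * B * γ)).trace) * ψ (-(2 * (S * γᵀ * B * M).trace)) := by
  have hMT : ‖Mᵀ‖ ≤ c := (Matrix.norm_transpose M).trans_le hM
  have hsmall : ‖-(S * (Mᵀ * B * M)).trace‖ ≤ 1 := by
    calc ‖-(S * (Mᵀ * B * M)).trace‖ ≤ ‖S * (Mᵀ * B * M)‖ := (norm_neg _).trans_le (norm_trace_le _)
      _ ≤ ‖S‖ * (c * ‖B‖ * c) := norm_matrix_mul_le_of_le le_rfl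
          (norm_matrix_mul_le_of_le (norm_matrix_mul_le_of_le hMT le_rfl) hM)
      _ = ‖S‖ * ‖B‖ * c ^ 2 := by ring
      _ ≤ 1 := hc
  rw [trace_quadratic_add hS hB, neg_add, neg_add, AddChar.map_add_eq_mul,
    AddChar.map_add_eq_mul, hψ.eq_one hsmall, mul_one]

theorem norm_le_norm_mul_mul_inv {γ : Matrix (Fin n) (Fin n) F} (hγ : γ ∈ Gamma0 n F)
    (hB : B.det ≠ 0) : ‖S‖ ≤ ‖S * γᵀ * B‖ * ‖B⁻¹‖ := by
  have hu : IsUnit γᵀ.det := by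
    rw [Matrix.det_transpose]
    exact isUnit_det_of_norm_eq_one hγ.2.1
  have hγ' : ‖γᵀ⁻¹‖ ≤ 1 := by
    rw [← Matrix.transpose_nonsing_inv, Matrix.norm_transpose]
    exact norm_le_one_of_mem_Gamma0 (inv_mem_Gamma0 hγ)
  calc ‖S‖ = ‖S * γᵀ * B * B⁻¹ * γᵀ⁻¹‖ := by
        rw [Matrix.mul_nonsing_inv_cancel_right _ _ hB.isUnit,
          Matrix.mul_nonsing_inv_cancel_right _ _ hu]
    _ ≤ ‖S * γᵀ * B‖ * ‖B⁻¹‖ * 1 :=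
        norm_matrix_mul_le_of_le (norm_matrix_mul_le _ _) hγ'
    _ = _ := mul_one _

theorem HasOrderZero.exists_apply_trace_ne_one (hψ : HasOrderZero ϖ ψ)
    (hϖ : IsUniformizer (ϖ : F)) (h2 : ‖(2 : F)‖ = 1) {N : Matrix (Fin n) (Fin n) F} {r : ℕ}
    (hN : 1 < ‖N‖ * ‖(ϖ : F)‖ ^ r) :
    ∃ M : Matrix (Fin n) (Fin n) F, ‖M‖ ≤ ‖(ϖ : F)‖ ^ r ∧ ψ (-(2 * (N * M).trace)) ≠ 1 := by
  have hpos := pow_pos hϖ.norm_pos r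
  obtain ⟨i, j, hij⟩ : ∃ i j, 1 < ‖N i j‖ * ‖(ϖ : F)‖ ^ r := by
    by_contra! hle
    refine hN.not_ge ((le_div_iff₀ hpos).mp ?_)
    exact (Matrix.norm_le_iff (by positivity)).mpr fun i j => (le_div_iff₀ hpos).mpr (hle i j)
  obtain ⟨z, hz, hψz⟩ := hψ.exists_ne_one hϖ (y := -(2 * (N i j * (ϖ : F) ^ r)))
    (by rwa [norm_neg, norm_mul, h2, one_mul, norm_mul, norm_pow])
  refine ⟨Matrix.single j i ((ϖ : F) ^ r * z), (Matrix.norm_le_iff hpos.le).mpr fun k l => ?_, ?_⟩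
  · rw [Matrix.single_apply]
    split_ifs
    · rw [norm_mul, norm_pow]
      exact mul_le_of_le_one_right hpos.le hz
    · exact norm_zero.trans_le hpos.le
  · convert hψz using 2
    rw [Matrix.trace_mul_single, op_smul_eq_mul]
    ring

variable [ProperSpace F] [MeasurableSpace F] [BorelSpace F]

theorem charSum_eq_zero_of_pow (h2 : ‖(2 : F)‖ = 1) (hϖ : IsUniformizer (ϖ : F))
    (hψ : HasOrderZero ϖ ψ) (hS : S.IsSymm) (hB : B.IsSymm) (hdet : B.det ≠ 0) {r : ℕ}
    (hr : r ≠ 0) (hquad : ‖S‖ * ‖B‖ * (‖(ϖ : F)‖ ^ r) ^ 2 ≤ 1)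
    (hlin : ‖B⁻¹‖ < ‖S‖ * ‖(ϖ : F)‖ ^ r) : charSum ψ S B = 0 := by
  have hpos := pow_pos hϖ.norm_pos r
  have hopen : IsOpen (congrLattice n (ϖ : F) r : Set (Matrix (Fin n) (Fin n) F)) := by
    rw [coe_congrLattice]
    exact IsUltrametricDist.isOpen_closedBall _ hpos.ne'
  have hcompact : IsCompact (congrLattice n (ϖ : F) r : Set (Matrix (Fin n) (Fin n) F)) := by
    rw [coe_congrLattice]
    exact isCompact_closedBall _ _
  have hcont : Continuous fun γ : Matrix (Fin n) (Fin n) F =>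
      (ψ (-(S * (γᵀ * B * γ)).trace) : ℂ) :=
    hψ.continuous.comp (Continuous.neg (Continuous.matrix_trace (continuous_const.matrix_mul
      ((continuous_id.matrix_transpose.matrix_mul continuous_const).matrix_mul continuous_id))))
  refine setIntegral_eq_zero_of_oscillation (L := congrLattice n (ϖ : F) r)
    isOpen_Gamma0.measurableSet hopen.measurableSet matrixHaar_Gamma0_ne_top
    hcompact.measure_ne_top (hopen.measure_pos _ ⟨0, zero_mem _⟩).ne' (fun γ hγ M hM => ?_)
    hcont.measurable (fun γ => (Circle.norm_coe _).le) fun γ hγ => ?_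
  · refine mem_Gamma0_of_norm_sub_lt_one hγ ?_
    rw [add_sub_cancel_left]
    exact (mem_congrLattice_iff.mp hM).trans_lt
      (pow_lt_one₀ (norm_nonneg _) hϖ.norm_lt_one hr)
  · have hN : 1 < ‖S * γᵀ * B‖ * ‖(ϖ : F)‖ ^ r := by
      by_contra! hle
      refine hlin.not_ge ?_
      calc ‖S‖ * ‖(ϖ : F)‖ ^ r ≤ ‖S * γᵀ * B‖ * ‖B⁻¹‖ * ‖(ϖ : F)‖ ^ r := by
            gcongr
            exact norm_le_norm_mul_mul_inv hγ hdet
        _ = ‖S * γᵀ * B‖ * ‖(ϖ : F)‖ ^ r * ‖B⁻¹‖ := by ring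
        _ ≤ ‖B⁻¹‖ := mul_le_of_le_one_left (norm_nonneg _) hle
    obtain ⟨M₀, hM₀, hne⟩ := hψ.exists_apply_trace_ne_one hϖ h2 hN
    refine ⟨M₀, mem_congrLattice_iff.mpr hM₀, _, by rwa [Ne, Circle.coe_eq_one], fun M hM => ?_⟩
    rw [hψ.apply_trace_quadratic_add hS hB hquad γ (norm_add_le_of_le_of_le
        (mem_congrLattice_iff.mp hM) hM₀),
      hψ.apply_trace_quadratic_add hS hB hquad γ (mem_congrLattice_iff.mp hM), Matrix.mul_add,
      Matrix.trace_add, mul_add, neg_add, AddChar.map_add_eq_mul]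
    push_cast
    ring

theorem charSum_eq_zero (h2 : ‖(2 : F)‖ = 1) (hϖ : IsUniformizer (ϖ : F)) (hψ : HasOrderZero ϖ ψ)
    (hS : S.IsSymm) (hB : B.IsSymm) (hdet : B.det ≠ 0) (hlarge : 1 < ‖S‖ * ‖B‖)
    (hvlarge : ‖B‖ * ‖B⁻¹‖ ^ 2 < ‖(ϖ : F)‖ ^ 2 * ‖S‖) : charSum ψ S B = 0 := by
  have hpos := hϖ.norm_pos
  have hex : ∃ r : ℕ, ‖S‖ * ‖B‖ * (‖(ϖ : F)‖ ^ r) ^ 2 ≤ 1 := by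
    have hlim : Tendsto (fun r : ℕ => ‖S‖ * ‖B‖ * (‖(ϖ : F)‖ ^ r) ^ 2) atTop
        (𝓝 (‖S‖ * ‖B‖ * 0 ^ 2)) :=
      ((tendsto_pow_atTop_nhds_zero_of_lt_one hpos.le hϖ.norm_lt_one).pow 2).const_mul _
    rw [zero_pow two_ne_zero, mul_zero] at hlim
    exact (hlim.eventually_le_const one_pos).exists
  classical
  -- on the ball of radius `‖ϖ‖ ^ r` the quadratic term in `tr(S ᵗγ B γ)` is integral; taking `r`
  -- least possible leaves the linear term room to oscillate
  obtain ⟨r, hr, hmin⟩ : ∃ r, ‖S‖ * ‖B‖ * (‖(ϖ : F)‖ ^ r) ^ 2 ≤ 1 ∧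
      ∀ k < r, 1 < ‖S‖ * ‖B‖ * (‖(ϖ : F)‖ ^ k) ^ 2 :=
    ⟨Nat.find hex, Nat.find_spec hex, fun k hk => not_le.mp (Nat.find_min hex hk)⟩
  obtain _ | r := r
  · rw [pow_zero, one_pow, mul_one] at hr
    exact absurd hr hlarge.not_ge
  refine charSum_eq_zero_of_pow h2 hϖ hψ hS hB hdet r.succ_ne_zero hr ?_
  have hBpos : 0 < ‖B‖ := pos_of_mul_pos_right (one_pos.trans hlarge) (norm_nonneg _)
  have hSpos : 0 < ‖S‖ := pos_of_mul_pos_left (one_pos.trans hlarge) hBpos.le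
  refine lt_of_pow_lt_pow_left₀ 2 (by positivity) ((mul_lt_mul_iff_right₀ hBpos).mp ?_)
  calc ‖B‖ * ‖B⁻¹‖ ^ 2 < ‖(ϖ : F)‖ ^ 2 * ‖S‖ * 1 := by rwa [mul_one]
    _ < ‖(ϖ : F)‖ ^ 2 * ‖S‖ * (‖S‖ * ‖B‖ * (‖(ϖ : F)‖ ^ r) ^ 2) := by
        gcongr
        exact hmin r r.lt_succ_self
    _ = ‖B‖ * (‖S‖ * ‖(ϖ : F)‖ ^ (r + 1)) ^ 2 := by ring

variable {δ : F} {x : Equiv.Perm (Fin n) × (Fin n → ℤ) × (Fin n → F)}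

theorem finite_charSum_ne_zero (h2 : ‖(2 : F)‖ = 1) (hϖ : IsUniformizer (ϖ : F))
    (hδ : IsNonsquareUnit δ) (hψ : HasOrderZero ϖ ψ) (hB : B.IsSymm) (hdet : B.det ≠ 0) :
    {x ∈ LamNeg n δ | charSum ψ (repS (ϖ : F) x) B ≠ 0}.Finite := by
  obtain ⟨k, hk⟩ : ∃ k : ℕ,
      max (‖B‖⁻¹) (‖B‖ * ‖B⁻¹‖ ^ 2 / ‖(ϖ : F)‖ ^ 2) < ‖(ϖ : F)‖ ^ (-(k : ℤ)) := by
    obtain ⟨k, hk⟩ := pow_unbounded_of_one_lt (max (‖B‖⁻¹) (‖B‖ * ‖B⁻¹‖ ^ 2 / ‖(ϖ : F)‖ ^ 2))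
      ((one_lt_inv₀ hϖ.norm_pos).mpr hϖ.norm_lt_one)
    exact ⟨k, by rwa [_root_.zpow_neg, zpow_natCast, ← inv_pow]⟩
  have hfin : (Set.univ ×ˢ ((Set.pi Set.univ fun _ => Set.Icc (-(k : ℤ)) (-1)) ×ˢ
      (Set.pi Set.univ fun _ => {1, δ})) :
      Set (Equiv.Perm (Fin n) × (Fin n → ℤ) × (Fin n → F))).Finite :=
    Set.finite_univ.prod ((Set.Finite.pi fun _ => Set.finite_Icc _ _).prod
      (Set.Finite.pi fun _ => Set.toFinite _))
  refine hfin.subset ?_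
  rintro x ⟨hx, hne⟩
  refine ⟨trivial, fun i _ => ⟨?_, hx.2 i⟩, fun i _ => hx.1.2.2.1 i⟩
  by_contra! hlt
  have hlarge := (hk.trans_le (zpow_le_zpow_right_of_le_one₀ hϖ.norm_pos hϖ.norm_lt_one.le
    hlt.le)).trans_le (Lam.zpow_le_norm_repS hδ hx.1 i)
  have hB0 : B ≠ 0 := by
    rintro rfl
    exact hdet (Matrix.det_eq_zero_of_row_eq_zero i fun _ => rfl)
  refine hne (charSum_eq_zero h2 hϖ hψ (Lam.isSymm_repS hx.1) hB hdet ?_ ?_)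
  · exact (inv_lt_iff_one_lt_mul₀ (norm_pos_iff.mpr hB0)).mp ((le_max_left _ _).trans_lt hlarge)
  · exact (div_lt_iff₀' (pow_pos hϖ.norm_pos 2)).mp ((le_max_right _ _).trans_lt hlarge)

end CharSum

/-! ### The Siegel series -/

section SiegelSeries

variable {F : Type*} [NontriviallyNormedField F] {n : ℕ} {δ : F} {ω : MulChar F ℂ} {s : ℂ}
  {f : Sp n F → ℂ} {x : Equiv.Perm (Fin n) × (Fin n → ℤ) × (Fin n → F)}

theorem norm_mulChar_eq_one (hω : ω ^ 2 = 1) {a : F} (ha : a ≠ 0) : ‖ω a‖ = 1 :=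
  Complex.norm_eq_one_of_pow_eq_one ((pow_two _).trans (mulChar_mul_self hω ha)) two_ne_zero

theorem norm_repS_le_norm_det {ϖ : F} (hϖ : IsUniformizer ϖ) (hδ : IsNonsquareUnit δ)
    (hx : x ∈ LamNeg n δ) : ‖repS ϖ x‖ ≤ ‖(repS ϖ x).det‖ := by
  refine (Matrix.norm_le_iff (norm_nonneg _)).mpr fun k l => ?_
  calc ‖repS ϖ x k l‖ ≤ ‖ϖ‖ ^ x.2.1 k := Lam.norm_repS_apply_le hδ hx.1 k l
    _ = ∏ i, if i = k then ‖ϖ‖ ^ x.2.1 i else 1 := by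
        rw [Finset.prod_ite_eq', if_pos (Finset.mem_univ k)]
    _ ≤ ∏ i, ‖ϖ‖ ^ x.2.1 i := by
        refine Finset.prod_le_prod (fun i _ => ?_) fun i _ => ?_
        · split_ifs
          exacts [zpow_nonneg (norm_nonneg _) _, zero_le_one]
        · split_ifs
          · exact le_rfl
          · exact one_le_zpow_of_nonpos₀ hϖ.norm_pos hϖ.norm_lt_one.le (by linarith [hx.2 i])
    _ = ‖(repS ϖ x).det‖ := (Lam.norm_det_repS hδ hx.1).symm

theorem trace_mul_mul_mul_transpose {R : Type*} [CommRing R] (S γ B : Matrix (Fin n) (Fin n) R) :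
    (B * (γ * S * γᵀ)).trace = (S * (γᵀ * B * γ)).trace := by
  rw [← Matrix.mul_assoc, ← Matrix.mul_assoc, Matrix.trace_mul_comm, Matrix.trace_mul_comm S]
  simp only [Matrix.mul_assoc]

theorem countable_LamNeg : (LamNeg n δ).Countable := by
  have hcountable : (Set.univ ×ˢ (Set.univ ×ˢ (Set.pi Set.univ fun _ => {1, δ})) :
      Set (Equiv.Perm (Fin n) × (Fin n → ℤ) × (Fin n → F))).Countable :=
    Set.countable_univ.prod (Set.countable_univ.prod
      (Set.Finite.pi fun _ => Set.toFinite _).countable)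
  refine hcountable.mono fun x hx => ?_
  exact ⟨trivial, trivial, fun i _ => hx.1.2.2.1 i⟩

variable [IsUltrametricDist F]

theorem exists_norm_det_repS_eq_zpow {ϖ : F} (hϖ : IsUniformizer ϖ) (hδ : IsNonsquareUnit δ)
    (hx : x ∈ LamNeg n δ) : ∃ k : ℕ, ‖(repS ϖ x).det‖ = ‖ϖ‖ ^ (-(k : ℤ)) := by
  obtain ⟨m, hm⟩ := hϖ.exists_norm_eq_zpow _ (Lam.det_repS_ne_zero hϖ hδ hx.1)
  have hm0 : m ≤ 0 :=
    (one_le_zpow_iff_right_of_lt_one₀ hϖ.norm_pos hϖ.norm_lt_one).mp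
      (hm ▸ one_le_norm_det_repS hϖ hδ hx)
  obtain ⟨k, rfl⟩ := Int.exists_eq_neg_ofNat hm0
  exact ⟨k, hm⟩

variable {ϖ : 𝒪[F]} {ψ : AddChar F Circle} {B : Matrix (Fin n) (Fin n) F}

/-- The integrand of the Siegel series in terms of the entries on and above the diagonal. -/
noncomputable def coordIntegrand (ψ : AddChar F Circle) (B : Matrix (Fin n) (Fin n) F)
    (f : Sp n F → ℂ) (y : UpperCoord n F) : ℂ :=
  siegelIntegrand ψ B f (symOfUpper y)

theorem continuous_siegelIntegrand (hψ : HasOrderZero ϖ ψ) (hf : IsStandardSection ω s 0 f) :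
    Continuous (siegelIntegrand ψ B f) :=
  (hf.1.smooth.continuous.comp continuous_weyl_mul_unipotent).mul
    (hψ.continuous.comp (Continuous.neg (Continuous.matrix_trace
      (continuous_const.matrix_mul continuous_subtype_val))))

theorem coordIntegrand_of_mem (hω : ω ^ 2 = 1) (hϖ : IsUniformizer (ϖ : F))
    (hδ : IsNonsquareUnit δ) (hf : IsStandardSection ω s 0 f) (hx : x ∈ LamNeg n δ)
    {y : UpperCoord n F} (hy : y ∈ coordOrbit (ϖ : F) x) :
    coordIntegrand ψ B f y = ω (repS (ϖ : F) x).det * ((‖(repS (ϖ : F) x).det‖ : ℝ) : ℂ) ^ (-s) *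
      (ψ (-(B * (symOfUpper y).1).trace) : ℂ) :=
  congrArg (· * _) (hf.apply_of_mem_orbit hω hϖ hδ hx hy)

theorem coordIntegrand_of_notMem [CompleteSpace F] (h2 : ‖(2 : F)‖ = 1)
    (hϖ : IsUniformizer (ϖ : F)) (hδ : IsNonsquareUnit δ) (hf : IsStandardSection ω s 0 f)
    {y : UpperCoord n F} (hy : ∀ x ∈ LamNeg n δ, y ∉ coordOrbit (ϖ : F) x) :
    coordIntegrand ψ B f y = 0 := by
  refine mul_eq_zero_of_left ?_ _
  by_cases hdet : (symOfUpper y).1.det = 0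
  · exact hf.apply_eq_zero_of_det_eq_zero h2 hϖ hδ hdet
  · obtain ⟨x, hx, hxy⟩ := exists_mem_orbit h2 hϖ hδ (symOfUpper y).2 hdet
    exact hf.apply_of_mem_orbit_of_notMem hϖ hδ hx (fun h => hy x h hxy) hxy

theorem enorm_coordIntegrand_le [CompleteSpace F] (h2 : ‖(2 : F)‖ = 1) (hω : ω ^ 2 = 1)
    (hϖ : IsUniformizer (ϖ : F)) (hδ : IsNonsquareUnit δ) (hf : IsStandardSection ω s 0 f)
    (y : UpperCoord n F) :
    ‖coordIntegrand ψ B f y‖ₑ ≤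
      ∑' k : ℕ, (Metric.closedBall (0 : UpperCoord n F) (‖(ϖ : F)‖ ^ (-(k : ℤ)))).indicator
        (fun _ => ENNReal.ofReal ((‖(ϖ : F)‖ ^ s.re) ^ k)) y := by
  by_cases hy : ∃ x ∈ LamNeg n δ, y ∈ coordOrbit (ϖ : F) x
  · obtain ⟨x, hx, hxy⟩ := hy
    obtain ⟨k, hk⟩ := exists_norm_det_repS_eq_zpow hϖ hδ hx
    have hball : y ∈ Metric.closedBall (0 : UpperCoord n F) (‖(ϖ : F)‖ ^ (-(k : ℤ))) :=
      mem_closedBall_zero_iff.mpr ((norm_le_norm_repS_of_mem_coordOrbit hxy).trans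
        ((norm_repS_le_norm_det hϖ hδ hx).trans_eq hk))
    have hnorm : ‖coordIntegrand ψ B f y‖ = (‖(ϖ : F)‖ ^ s.re) ^ k := by
      rw [coordIntegrand_of_mem hω hϖ hδ hf hx hxy, norm_mul, norm_mul, Circle.norm_coe, mul_one,
        norm_mulChar_eq_one hω (Lam.det_repS_ne_zero hϖ hδ hx.1), one_mul, hk,
        Complex.norm_cpow_eq_rpow_re_of_pos (zpow_pos hϖ.norm_pos _), Complex.neg_re,
        ← Real.rpow_intCast, ← Real.rpow_mul hϖ.norm_pos.le, ← Real.rpow_natCast,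
        ← Real.rpow_mul hϖ.norm_pos.le]
      push_cast
      ring_nf
    calc ‖coordIntegrand ψ B f y‖ₑ = ENNReal.ofReal ((‖(ϖ : F)‖ ^ s.re) ^ k) := by
          rw [← ofReal_norm, hnorm]
      _ ≤ _ := by
          refine le_trans ?_ (ENNReal.le_tsum k)
          rw [Set.indicator_of_mem hball]
  · push Not at hy
    rw [coordIntegrand_of_notMem h2 hϖ hδ hf hy, enorm_zero]
    exact zero_le

variable [ProperSpace F] [MeasurableSpace F] [BorelSpace F]

theorem integral_siegelIntegrand (hψ : HasOrderZero ϖ ψ) (hf : IsStandardSection ω s 0 f) :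
    ∫ X, siegelIntegrand ψ B f X ∂(symHaar n F) = ∫ y, coordIntegrand ψ B f y ∂(coordHaar n F) :=
  integral_map continuous_symOfUpper.measurable.aemeasurable
    (continuous_siegelIntegrand hψ hf).measurable.aestronglyMeasurable

theorem integrable_siegelIntegrand_iff (hψ : HasOrderZero ϖ ψ) (hf : IsStandardSection ω s 0 f) :
    Integrable (siegelIntegrand ψ B f) (symHaar n F) ↔
      Integrable (coordIntegrand ψ B f) (coordHaar n F) :=
  integrable_map_measure (continuous_siegelIntegrand hψ hf).measurable.aestronglyMeasurable
    continuous_symOfUpper.measurable.aemeasurable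

theorem setIntegral_coordIntegrand (h2 : ‖(2 : F)‖ = 1) (hω : ω ^ 2 = 1)
    (hϖ : IsUniformizer (ϖ : F)) (hδ : IsNonsquareUnit δ) (hψ : HasOrderZero ϖ ψ)
    (hf : IsStandardSection ω s 0 f) (hx : x ∈ LamNeg n δ) :
    ∫ y in coordOrbit (ϖ : F) x, coordIntegrand ψ B f y ∂(coordHaar n F) =
      ω (repS (ϖ : F) x).det * ((‖(repS (ϖ : F) x).det‖ : ℝ) : ℂ) ^ (-s) *
        (charSum ψ (repS (ϖ : F) x) B / (localDensity (ϖ : F) (repS (ϖ : F) x) : ℂ)) := by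
  have hcont : Continuous fun y : UpperCoord n F => (ψ (-(B * (symOfUpper y).1).trace) : ℂ) :=
    hψ.continuous.comp (Continuous.neg (Continuous.matrix_trace
      (continuous_const.matrix_mul continuous_coe_symOfUpper)))
  have htrace (γ : Matrix (Fin n) (Fin n) F) :
      (B * (symOfUpper (act γ (upper (repS (ϖ : F) x)))).1).trace =
        (repS (ϖ : F) x * (γᵀ * B * γ)).trace := by
    rw [symOfUpper_act, symOfUpper_upper (Lam.isSymm_repS hx.1), trace_mul_mul_mul_transpose]
  rw [setIntegral_congr_fun (isOpen_coordOrbit h2 hϖ hδ hx.1).measurableSet fun y hy =>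
      coordIntegrand_of_mem hω hϖ hδ hf hx hy, integral_const_mul,
    setIntegral_coordOrbit h2 hϖ hδ hx.1 hcont.measurable.stronglyMeasurable,
    localDensity_eq h2 hϖ hδ hx.1, charSum]
  simp only [htrace]
  push_cast
  rw [div_div_eq_mul_div, div_mul_eq_mul_div, mul_comm (_ : ℂ) (∫ γ in _, _ ∂_)]

theorem integral_siegelIntegrand_eq_orbitSum (h2 : ‖(2 : F)‖ = 1) (hω : ω ^ 2 = 1)
    (hϖ : IsUniformizer (ϖ : F)) (hδ : IsNonsquareUnit δ) (hψ : HasOrderZero ϖ ψ)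
    (hB : B.IsSymm) (hdet : B.det ≠ 0) (hf : IsStandardSection ω s 0 f)
    (hint : Integrable (siegelIntegrand ψ B f) (symHaar n F)) :
    ∫ X, siegelIntegrand ψ B f X ∂(symHaar n F) = orbitSum (ϖ : F) δ ψ ω B s := by
  have : Countable (LamNeg n δ) := countable_LamNeg
  have hdisj : Pairwise (Function.onFun Disjoint
      fun x : LamNeg n δ => coordOrbit (ϖ : F) x.1) := fun x y hxy =>
    Set.disjoint_left.mpr fun z hz hz' =>
      hxy (Subtype.ext (eq_of_mem_orbit hϖ hδ x.2.1 y.2.1 hz hz'))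
  have hsum := hasSum_integral_iUnion (μ := coordHaar n F)
    (fun x : LamNeg n δ => (isOpen_coordOrbit h2 hϖ hδ x.2.1).measurableSet) hdisj
    ((integrable_siegelIntegrand_iff hψ hf).mp hint).integrableOn
  rw [setIntegral_eq_integral_of_forall_compl_eq_zero fun y hy =>
    coordIntegrand_of_notMem h2 hϖ hδ hf fun x hx hxy =>
      hy (Set.mem_iUnion.mpr ⟨⟨x, hx⟩, hxy⟩)] at hsum
  rw [integral_siegelIntegrand hψ hf, ← hsum.tsum_eq, tsum_congr fun x : LamNeg n δ =>
    setIntegral_coordIntegrand h2 hω hϖ hδ hψ hf x.2, orbitSum, ← finsum_set_coe_eq_finsum_mem]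
  refine tsum_eq_finsum (Set.Finite.of_finite_image (f := Subtype.val)
    ((finite_charSum_ne_zero h2 hϖ hδ hψ hB hdet).subset ?_) Subtype.val_injective.injOn)
  rintro _ ⟨x, hx, rfl⟩
  exact ⟨x.2, fun h => hx (mul_eq_zero_of_right _ (by rw [h, zero_div]))⟩

theorem differentiable_orbitSum (h2 : ‖(2 : F)‖ = 1) (hϖ : IsUniformizer (ϖ : F))
    (hδ : IsNonsquareUnit δ) (hψ : HasOrderZero ϖ ψ) (hB : B.IsSymm) (hdet : B.det ≠ 0) :
    Differentiable ℂ (orbitSum (ϖ : F) δ ψ ω B) := by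
  have hfinite := finite_charSum_ne_zero h2 hϖ hδ hψ hB hdet
  have hsum : orbitSum (ϖ : F) δ ψ ω B = fun s => ∑ x ∈ hfinite.toFinset,
      ω (repS (ϖ : F) x).det * ((‖(repS (ϖ : F) x).det‖ : ℝ) : ℂ) ^ (-s) *
        (charSum ψ (repS (ϖ : F) x) B / (localDensity (ϖ : F) (repS (ϖ : F) x) : ℂ)) := by
    funext s
    refine finsum_mem_eq_sum_of_inter_support_eq _ (Set.ext fun x => ?_)
    rw [Set.Finite.coe_toFinset]
    exact ⟨fun h => ⟨⟨h.1, fun h0 => h.2 (mul_eq_zero_of_right _ (by rw [h0, zero_div]))⟩, h.2⟩,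
      fun h => ⟨h.1.1, h.2⟩⟩
  rw [hsum]
  refine Differentiable.fun_sum fun x hx => ?_
  have hpos := one_pos.trans_le (one_le_norm_det_repS hϖ hδ (hfinite.mem_toFinset.mp hx).1)
  exact ((differentiable_id.neg.const_cpow
    (Or.inl (Complex.ofReal_ne_zero.mpr hpos.ne'))).const_mul _).mul_const _

theorem integrable_siegelIntegrand (h2 : ‖(2 : F)‖ = 1) (hω : ω ^ 2 = 1)
    (hϖ : IsUniformizer (ϖ : F)) (hδ : IsNonsquareUnit δ) (hψ : HasOrderZero ϖ ψ)
    (hf : IsStandardSection ω s 0 f) (hs : ‖(ϖ : F)‖ ^ s.re *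
      (resCard F : ℝ) ^ Fintype.card {p : Fin n × Fin n // p.1 ≤ p.2} < 1) :
    Integrable (siegelIntegrand ψ B f) (symHaar n F) := by
  rw [integrable_siegelIntegrand_iff hψ hf]
  refine ⟨((continuous_siegelIntegrand hψ hf).comp
    continuous_symOfUpper).measurable.aestronglyMeasurable, ?_⟩
  have hball (k : ℕ) : MeasurableSet (Metric.closedBall (0 : UpperCoord n F)
      (‖(ϖ : F)‖ ^ (-(k : ℤ)))) := Metric.isClosed_closedBall.measurableSet
  have hterm (k : ℕ) : ∫⁻ y, (Metric.closedBall (0 : UpperCoord n F)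
      (‖(ϖ : F)‖ ^ (-(k : ℤ)))).indicator (fun _ => ENNReal.ofReal ((‖(ϖ : F)‖ ^ s.re) ^ k)) y
        ∂(coordHaar n F) = ENNReal.ofReal (‖(ϖ : F)‖ ^ s.re *
          (resCard F : ℝ) ^ Fintype.card {p : Fin n × Fin n // p.1 ≤ p.2}) ^ k := by
    rw [lintegral_indicator_const (hball k), coordHaar_closedBall hϖ, ENNReal.zpow_neg,
      zpow_natCast, ← ENNReal.inv_pow, ← ENNReal.inv_pow, ← ENNReal.inv_pow, inv_inv, ← pow_mul,
      mul_comm k, pow_mul,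
      ENNReal.ofReal_pow (Real.rpow_nonneg hϖ.norm_pos.le _), ← mul_pow,
      ENNReal.ofReal_mul (Real.rpow_nonneg hϖ.norm_pos.le _),
      ENNReal.ofReal_pow (Nat.cast_nonneg _), ENNReal.ofReal_natCast]
  refine (lintegral_mono (enorm_coordIntegrand_le h2 hω hϖ hδ hf)).trans_lt ?_
  rw [lintegral_tsum fun k => (measurable_const.indicator (hball k)).aemeasurable,
    tsum_congr hterm, ENNReal.tsum_geometric]
  exact ENNReal.inv_lt_top.mpr (tsub_pos_of_lt (ENNReal.ofReal_lt_one.mpr hs))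

theorem exists_forall_lt_re_integrable (h2 : ‖(2 : F)‖ = 1) (hω : ω ^ 2 = 1)
    (hϖ : IsUniformizer (ϖ : F)) (hδ : IsNonsquareUnit δ) (hψ : HasOrderZero ϖ ψ)
    (B : Matrix (Fin n) (Fin n) F) :
    ∃ a : ℝ, ∀ (s : ℂ) (f : Sp n F → ℂ), a < s.re → IsStandardSection ω s 0 f →
      Integrable (siegelIntegrand ψ B f) (symHaar n F) := by
  have hlim := (tendsto_rpow_atTop_of_base_lt_one ‖(ϖ : F)‖ (by linarith [hϖ.norm_pos])
    hϖ.norm_lt_one).mul_const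
      ((resCard F : ℝ) ^ Fintype.card {p : Fin n × Fin n // p.1 ≤ p.2})
  rw [zero_mul] at hlim
  obtain ⟨a, ha⟩ := eventually_atTop.mp (hlim.eventually_lt_const one_pos)
  exact ⟨a, fun s f hs hf => integrable_siegelIntegrand h2 hω hϖ hδ hψ hf (ha s.re hs.le)⟩

end SiegelSeries

theorem eq_of_eq_on_halfPlane {f g : ℂ → ℂ} (hf : MeromorphicNFOn f Set.univ)
    (hg : MeromorphicNFOn g Set.univ) {a : ℝ} (h : ∀ s : ℂ, a < s.re → f s = g s) : f = g := by
  have hfg : MeromorphicOn (f - g) Set.univ := hf.meromorphicOn.sub hg.meromorphicOn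
  have htop : ∀ s : ℂ, meromorphicOrderAt (f - g) s = ⊤ := by
    by_contra! hne
    obtain ⟨s, hs⟩ := hne
    refine (hfg.exists_meromorphicOrderAt_ne_top_iff_forall isConnected_univ).mp
      ⟨⟨s, trivial⟩, hs⟩ ⟨((a + 1 : ℝ) : ℂ), trivial⟩ (meromorphicOrderAt_eq_top_iff.mpr ?_)
    have hopen : IsOpen {s : ℂ | a < s.re} := isOpen_lt continuous_const Complex.continuous_re
    refine nhdsWithin_le_nhds (mem_of_superset (hopen.mem_nhds (lt_add_one a)) fun s hs => ?_)
    exact sub_eq_zero.mpr (h s hs)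
  funext s
  refine EventuallyEq.eq_of_nhds (x := s) ?_
  rw [← (hf (Set.mem_univ s)).eventuallyEq_nhdsNE_iff_eventuallyEq_nhds (hg (Set.mem_univ s))]
  filter_upwards [meromorphicOrderAt_eq_top_iff.mp (htop s)] with z hz
  exact sub_eq_zero.mp hz

end RamifiedSiegel

open RamifiedSiegel in
theorem theorem3p5_general
    {F : Type*} [NontriviallyNormedField F] [IsUltrametricDist F] [LocallyCompactSpace F]
    [MeasurableSpace F] [BorelSpace F]
    (hq : Odd (resCard F))
    (ϖ : 𝒪[F]) (hϖ : Irreducible ϖ)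
    (δ : 𝒪[F]ˣ) (hδ : ¬ IsSquare δ)
    (ψ : AddChar F Circle) (hψ : HasOrderZero ϖ ψ)
    (ω : MulChar F ℂ) (hω : ω ^ 2 = 1)
    (n : ℕ) (B : Matrix (Fin n) (Fin n) F) (hB : B.IsSymm) (hdet : B.det ≠ 0) :
    (∀ s : ℂ, ∃ f : Sp n F → ℂ, IsStandardSection ω s 0 f) ∧
    (∀ x ∈ LamNeg n ((δ : 𝒪[F]) : F),
      Tendsto (densitySeq (ϖ : F) (repS (ϖ : F) x)) atTop
        (𝓝 (localDensity (ϖ : F) (repS (ϖ : F) x))) ∧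
      0 < localDensity (ϖ : F) (repS (ϖ : F) x)) ∧
    {x ∈ LamNeg n ((δ : 𝒪[F]) : F) |
      charSum ψ (repS (ϖ : F) x) B ≠ 0}.Finite ∧
    ∀ f : ℂ → Sp n F → ℂ,
      (∀ s : ℂ, IsStandardSection ω s 0 (f s)) →
      (∀ s : ℂ,
        Integrable (siegelIntegrand ψ B (f s)) (symHaar n F) →
        ∫ X, siegelIntegrand ψ B (f s) X ∂(symHaar n F) =
          orbitSum (ϖ : F) ((δ : 𝒪[F]) : F) ψ ω B s) ∧
      (∃ Z : ℂ → ℂ, IsSiegelSeries ψ B f Z) ∧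
      ∀ Z : ℂ → ℂ, IsSiegelSeries ψ B f Z →
        ∀ s : ℂ, Z s = orbitSum (ϖ : F) ((δ : 𝒪[F]) : F) ψ ω B s := by
  have : ProperSpace F := ProperSpace.of_locallyCompactSpace F
  have h2 := norm_two_eq_one hq
  have hϖ := isUniformizer_of_irreducible hϖ
  have hδ := isNonsquareUnit_of_not_isSquare hq hδ
  refine ⟨fun s => ⟨_, isStandardSection_cellSection h2 hω s⟩,
    fun x hx => ⟨?_, localDensity_pos h2 hϖ hδ hx.1⟩,
    finite_charSum_ne_zero h2 hϖ hδ hψ hB hdet, fun f hf => ?_⟩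
  · rw [localDensity_eq h2 hϖ hδ hx.1]
    exact tendsto_densitySeq h2 hϖ hδ hx.1
  have hformula := fun s =>
    integral_siegelIntegrand_eq_orbitSum h2 hω hϖ hδ hψ hB hdet (hf s)
  have hNF : MeromorphicNFOn (orbitSum (ϖ : F) ((δ : 𝒪[F]) : F) ψ ω B) Set.univ := fun s _ =>
    ((differentiable_orbitSum h2 hϖ hδ hψ hB hdet).analyticAt s).meromorphicNFAt
  obtain ⟨a, ha⟩ := exists_forall_lt_re_integrable h2 hω hϖ hδ hψ B
  refine ⟨hformula, ⟨_, hNF, a, fun s hs =>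
    ⟨ha s _ hs (hf s), (hformula s (ha s _ hs (hf s))).symm⟩⟩, ?_⟩
  rintro Z ⟨hZ, a, ha⟩ s
  refine congrFun (eq_of_eq_on_halfPlane hZ hNF (a := a) fun s hs => ?_) s
  rw [(ha s hs).2, hformula s (ha s hs).1]

theorem theorem3p5
    {F : Type*} [NontriviallyNormedField F] [IsUltrametricDist F] [LocallyCompactSpace F]
    [CharZero F] [MeasurableSpace F] [BorelSpace F]
    (hq : Odd (RamifiedSiegel.resCard F))
    (ϖ : 𝒪[F]) (hϖ : Irreducible ϖ)
    (hnorm : ‖(ϖ : F)‖ = ((RamifiedSiegel.resCard F : ℕ) : ℝ)⁻¹)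
    (δ : 𝒪[F]ˣ) (hδ : ¬ IsSquare δ)
    (ψ : AddChar F Circle) (hψ : RamifiedSiegel.HasOrderZero ϖ ψ)
    (ω : MulChar F ℂ) (hω : ω ^ 2 = 1)
    (n : ℕ) (B : Matrix (Fin n) (Fin n) F) (hB : B.IsSymm) (hdet : B.det ≠ 0) :
    -- `f_0` exists for every `s`
    (∀ s : ℂ, ∃ f : RamifiedSiegel.Sp n F → ℂ, RamifiedSiegel.IsStandardSection ω s 0 f) ∧
    -- the local densities exist and are positive
    (∀ x ∈ RamifiedSiegel.LamNeg n ((δ : 𝒪[F]) : F),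
      Tendsto (RamifiedSiegel.densitySeq (ϖ : F) (RamifiedSiegel.repS (ϖ : F) x)) atTop
        (𝓝 (RamifiedSiegel.localDensity (ϖ : F) (RamifiedSiegel.repS (ϖ : F) x))) ∧
      0 < RamifiedSiegel.localDensity (ϖ : F) (RamifiedSiegel.repS (ϖ : F) x)) ∧
    -- the sum is finite
    {x ∈ RamifiedSiegel.LamNeg n ((δ : 𝒪[F]) : F) |
      RamifiedSiegel.charSum ψ (RamifiedSiegel.repS (ϖ : F) x) B ≠ 0}.Finite ∧
    ∀ f : ℂ → RamifiedSiegel.Sp n F → ℂ,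
      (∀ s : ℂ, RamifiedSiegel.IsStandardSection ω s 0 (f s)) →
      -- the formula holds wherever the integral converges absolutely
      (∀ s : ℂ,
        Integrable (RamifiedSiegel.siegelIntegrand ψ B (f s)) (RamifiedSiegel.symHaar n F) →
        ∫ X, RamifiedSiegel.siegelIntegrand ψ B (f s) X ∂(RamifiedSiegel.symHaar n F) =
          RamifiedSiegel.orbitSum (ϖ : F) ((δ : 𝒪[F]) : F) ψ ω B s) ∧
      -- the Siegel series exists as a meromorphic function, and equals the sum for every `s`
      (∃ Z : ℂ → ℂ, RamifiedSiegel.IsSiegelSeries ψ B f Z) ∧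
      ∀ Z : ℂ → ℂ, RamifiedSiegel.IsSiegelSeries ψ B f Z →
        ∀ s : ℂ, Z s = RamifiedSiegel.orbitSum (ϖ : F) ((δ : 𝒪[F]) : F) ψ ω B s := by
  exact theorem3p5_general hq ϖ hϖ δ hδ ψ hψ ω hω n B hB hdet
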